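/- **Definitions.** Let $p$ be a prime. A $\mathbb Z_p$-complex is a finite simplicial complex $K$ with a permutation $t$ of its vertices that maps simplices to simplices, satisfies $t^p=1$, and is such that $t^k\sigma\ne\sigma$ for every non-empty simplex $\sigma$ and every $k\not\equiv 0 \pmod p$. Let $C_n(K)$ be the oriented integral simplicial chains and $C^n(K)$ the cochains ($n\ge 0$, not augmented), $d=1-t$ and $s=1+t+\dots+t^{p-1}$, acting on chains and, dually, on cochains. The $d$-cohomology $H^*_d(K)$ and the $s$-cohomology $H^*_s(K)$ are the cohomologies of the cochain complexes $\ker d$ and $\ker s$. A resolution of the cocycle $1\in C^0(K)$ is a sequence $\psi_j\in C^j(K)$, $j\ge 0$, with $s\psi_0=1$, and $\delta\psi_j=d\psi_{j+1}$ for $j$ even, $\delta\psi_j=s\psi_{j+1}$ for $j$ odd. The $j$-th Smith class $A^j(K)$ is $[s\psi_j]\in H^j_d(K)$ for $j$ even and $[d\psi_j]\in H^j_s(K)$ for $j$ odd (it does not depend on the resolution). The Smith index $I(K)$ is the smallest $n$ with $A^n(K)=0$, and $I_p(K)$ is the smallest $n$ such that the reduction of $A^n(K)$ modulo $p$ is zero.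 The join $K*L$ carries the action that is given by those on $K$ and on $L$. **Theorem.** Let $p$ be a prime and let $K$ and $L$ be $\mathbb Z_p$-complexes. 1. If $I_p(K)=I(K)-1$ and $I_p(L)=I(L)-1$, then $I(K*L)\le I(K)+I(L)-1$. 2. If $p=2$, $I_2(K)=I(K)$ and $I_2(L)=I(L)$, then $I_2(K*L)=I(K*L)=I(K)+I(L)$. 3. If $p=2$, $I_2(K)=I(K)-1$ and $I_2(L)=I(L)$, then $I(K*L)=I(K)+I(L)$ or $I(K*L)=I(K)+I(L)-1$. Both cases occur: there are $\mathbb Z_2$-complexes $K$ and $L\neq\emptyset$ that satisfy these hypotheses with $I(K*L)=I(K)+I(L)$, and others with $I(K*L)=I(K)+I(L)-1$. 4. If $p>2$, $I_p(K)=I(K)$, $I_p(L)=I(L)$, and at least one of $K$, $L$ satisfies condition (E) below, then $I_p(K*L)=I(K*L)=I(K)+I(L)$. Condition (E) on a $\mathbb Z_p$-complex $M$: the number $n=I(M)-1$ is positive and even, and the class $A^n(M)=[s\psi_n]$ has a dual chain that is boundary-equivariant modulo $p$, that is, there is a chain $c\in C_n(M)$ with $\partial(sc)\equiv 0$, $(s\psi_n)(c)\not\equiv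 0$ and $d(\partial c)\equiv 0 \pmod p$. -/

import Mathlib

/-- A finite simplicial complex with a simple action of the cyclic group of order `p`:
an abstract simplicial complex whose vertex set is all of `V`, with a permutation `t` of the
vertices that maps simplices to simplices, satisfies `t ^ p = 1`, and is such that `t ^ k` fixes
no (non-empty) simplex setwise unless `p ∣ k`. Mathlib's abstract simplicial complexes list the
non-empty simplices only; finiteness is the assumption `[Fintype V]`, made where it is used. -/
structure ZpComplex (p : ℕ) (V : Type*) extends AbstractSimplicialComplex V where
  t : Equiv.Perm V
  t_pow : t ^ p = 1
  map_mem : ∀ σ ∈ faces, σ.map t.toEmbedding ∈ faces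
  simple : ∀ σ ∈ faces, ∀ k : ℕ, ¬ p ∣ k → σ.map (t ^ k).toEmbedding ≠ σ

/-- The two special elements `d = 1 - t` and `s = 1 + t + ⋯ + t ^ (p - 1)` of the group ring. -/
inductive Special
  | d
  | s

namespace Special

/-- `d` and `s` annihilate each other; `bar` exchanges them. -/
def bar : Special → Special
  | d => s
  | s => d

/-- The `j`-th Smith class lives in `d`-cohomology for even `j`, in `s`-cohomology for odd `j`. -/
def parity (j : ℕ) : Special := if Even j then d else s

end Special

noncomputable section

namespace ZpComplex

section

variable {V W : Type*}

/-! ### Vertex sets of joins -/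

/-- The vertices in `V` of a set of vertices of the join. -/
def leftPart (σ : Finset (V ⊕ₗ W)) : Finset V := (σ.map ofLex.toEmbedding).toLeft

/-- The vertices in `W` of a set of vertices of the join. -/
def rightPart (σ : Finset (V ⊕ₗ W)) : Finset W := (σ.map ofLex.toEmbedding).toRight

/-- The permutation of the disjoint union given by `g` on `V` and by `h` on `W`. -/
def joinPerm (g : Equiv.Perm V) (h : Equiv.Perm W) : Equiv.Perm (V ⊕ₗ W) :=
  (ofLex.trans (Equiv.sumCongr g h)).trans toLex

theorem joinPerm_one : joinPerm (1 : Equiv.Perm V) (1 : Equiv.Perm W) = 1 := by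
  ext x
  obtain ⟨x, rfl⟩ := toLex.surjective x
  rcases x with x | x <;> rfl

theorem joinPerm_mul (g g' : Equiv.Perm V) (h h' : Equiv.Perm W) :
    joinPerm (g * g') (h * h') = joinPerm g h * joinPerm g' h' := by
  ext x
  obtain ⟨x, rfl⟩ := toLex.surjective x
  rcases x with x | x <;> rfl

theorem joinPerm_pow (g : Equiv.Perm V) (h : Equiv.Perm W) (k : ℕ) :
    joinPerm g h ^ k = joinPerm (g ^ k) (h ^ k) := by
  induction k with
  | zero => simp only [pow_zero, joinPerm_one]
  | succ k ih => rw [pow_succ, pow_succ, pow_succ, ih, joinPerm_mul]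

theorem leftPart_map (g : Equiv.Perm V) (h : Equiv.Perm W) (σ : Finset (V ⊕ₗ W)) :
    leftPart (σ.map (joinPerm g h).toEmbedding) = (leftPart σ).map g.toEmbedding := by
  ext x
  simp only [leftPart, Finset.mem_toLeft, Finset.mem_map, Equiv.coe_toEmbedding]
  constructor
  · rintro ⟨_, ⟨y, hy, rfl⟩, hx⟩
    obtain ⟨y, rfl⟩ := toLex.surjective y
    rcases y with y | y
    · exact ⟨y, ⟨_, hy, rfl⟩, Sum.inl_injective hx⟩
    · exact absurd hx Sum.inr_ne_inl
  · rintro ⟨y, ⟨z, hz, hy⟩, rfl⟩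
    exact ⟨_, ⟨z, hz, rfl⟩, by simp [joinPerm, hy]⟩

theorem rightPart_map (g : Equiv.Perm V) (h : Equiv.Perm W) (σ : Finset (V ⊕ₗ W)) :
    rightPart (σ.map (joinPerm g h).toEmbedding) = (rightPart σ).map h.toEmbedding := by
  ext x
  simp only [rightPart, Finset.mem_toRight, Finset.mem_map, Equiv.coe_toEmbedding]
  constructor
  · rintro ⟨_, ⟨y, hy, rfl⟩, hx⟩
    obtain ⟨y, rfl⟩ := toLex.surjective y
    rcases y with y | y
    · exact absurd hx Sum.inl_ne_inr
    · exact ⟨y, ⟨_, hy, rfl⟩, Sum.inr_injective hx⟩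
  · rintro ⟨y, ⟨z, hz, hy⟩, rfl⟩
    exact ⟨_, ⟨z, hz, rfl⟩, by simp [joinPerm, hy]⟩

end

variable {p : ℕ} {V W : Type*} [LinearOrder V] [LinearOrder W]

/-! ### The oriented simplicial chain complex

Every simplex carries the orientation given by the order of the vertices. -/

/-- The `n`-dimensional simplices. -/
abbrev Simplex (K : ZpComplex p V) (n : ℕ) : Type _ :=
  {σ : Finset V // σ ∈ K.faces ∧ σ.card = n + 1}

/-- The integral `n`-chains. -/
abbrev Chain (K : ZpComplex p V) (n : ℕ) : Type _ := K.Simplex n →₀ ℤ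

/-- The face of `σ` opposite to the vertex `v`. -/
def face (K : ZpComplex p V) {n : ℕ} (σ : K.Simplex (n + 1)) (v : {v // v ∈ σ.1}) :
    K.Simplex n :=
  have hc : (σ.1.erase v.1).card = n + 1 := by
    rw [Finset.card_erase_of_mem v.2, σ.2.2]; rfl
  ⟨σ.1.erase v.1,
    (K.isRelLowerSet_faces σ.2.1).2 (Finset.erase_subset _ _)
      (Finset.card_pos.mp (by rw [hc]; exact Nat.succ_pos n)), hc⟩

/-- The number of vertices of `σ` that precede `v`. -/
def position (σ : Finset V) (v : V) : ℕ := (σ.filter (fun u => u < v)).card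

/-- The boundary operator `∂ [v₀, …, vₙ₊₁] = ∑ᵢ (-1)ⁱ [v₀, …, v̂ᵢ, …, vₙ₊₁]`. -/
def boundary (K : ZpComplex p V) (n : ℕ) : K.Chain (n + 1) →ₗ[ℤ] K.Chain n :=
  Finsupp.linearCombination ℤ fun σ : K.Simplex (n + 1) =>
    ∑ v ∈ σ.1.attach, (-1 : ℤ) ^ position σ.1 v.1 • Finsupp.single (K.face σ v) (1 : ℤ)

/-- The image of a simplex under `t`. -/
def act (K : ZpComplex p V) {n : ℕ} (σ : K.Simplex n) : K.Simplex n :=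
  ⟨σ.1.map K.t.toEmbedding, K.map_mem σ.1 σ.2.1, by rw [Finset.card_map, σ.2.2]⟩

/-- The number of pairs of vertices of `σ` whose order is reversed by `g`. -/
def inversions (g : Equiv.Perm V) (σ : Finset V) : ℕ :=
  ((σ ×ˢ σ).filter (fun x => x.1 < x.2 ∧ g x.2 < g x.1)).card

/-- The chain map induced by `t`: it takes the oriented simplex `[v₀, …, vₙ]` to
`[t v₀, …, t vₙ]`, which is the simplex `t σ` with its standard orientation, up to the sign of
the permutation that sorts `t v₀, …, t vₙ`. -/
def tChain (K : ZpComplex p V) (n : ℕ) : Module.End ℤ (K.Chain n) :=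
  Finsupp.linearCombination ℤ fun σ : K.Simplex n =>
    (-1 : ℤ) ^ inversions K.t σ.1 • Finsupp.single (K.act σ) (1 : ℤ)

/-- The operators `d` and `s` on chains. -/
def op (K : ZpComplex p V) (n : ℕ) : Special → Module.End ℤ (K.Chain n)
  | .d => 1 - K.tChain n
  | .s => ∑ i ∈ Finset.range p, K.tChain n ^ i

/-! ### Cochains and special cohomology -/

/-- The `n`-cochains with coefficients in `A`. -/
abbrev Cochain (K : ZpComplex p V) (A : Type*) [AddCommGroup A] (n : ℕ) : Type _ :=
  K.Chain n →ₗ[ℤ] A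

/-- The coboundary operator, dual to `∂`. -/
def coboundary (K : ZpComplex p V) (A : Type*) [AddCommGroup A] (n : ℕ) :
    K.Cochain A n →ₗ[ℤ] K.Cochain A (n + 1) :=
  LinearMap.lcomp ℤ A (K.boundary n)

/-- The operators `d` and `s` on cochains, dual to those on chains. -/
def coop (K : ZpComplex p V) (A : Type*) [AddCommGroup A] (ρ : Special) (n : ℕ) :
    Module.End ℤ (K.Cochain A n) :=
  LinearMap.lcomp ℤ A (K.op n ρ)

/-- The `ρ`-cochains, that is, the kernel of `ρ` on cochains. -/
def specialCochains (K : ZpComplex p V) (A : Type*) [AddCommGroup A] (ρ : Special) (n : ℕ) :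
    Submodule ℤ (K.Cochain A n) :=
  LinearMap.ker (K.coop A ρ n)

/-- The `ρ`-cocycles. -/
def cocycles (K : ZpComplex p V) (A : Type*) [AddCommGroup A] (ρ : Special) (n : ℕ) :
    Submodule ℤ (K.Cochain A n) :=
  K.specialCochains A ρ n ⊓ LinearMap.ker (K.coboundary A n)

/-- The `ρ`-coboundaries: the coboundaries of `ρ`-cochains (of dimension at least `0`; the
cochain complex is not augmented, so there are none in dimension `0`). -/
def coboundaries (K : ZpComplex p V) (A : Type*) [AddCommGroup A] (ρ : Special) :
    (n : ℕ) → Submodule ℤ (K.Cochain A n)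
  | 0 => ⊥
  | n + 1 => (K.specialCochains A ρ n).map (K.coboundary A n)

/-- The `ρ`-cohomology: `d`-cohomology or `s`-cohomology. -/
abbrev Cohomology (K : ZpComplex p V) (A : Type*) [AddCommGroup A] (ρ : Special) (n : ℕ) :
    Type _ :=
  K.cocycles A ρ n ⧸ (K.coboundaries A ρ n).submoduleOf (K.cocycles A ρ n)

/-- Reduction of an integral cochain modulo `q`. -/
def reduce (K : ZpComplex p V) (q n : ℕ) : K.Cochain ℤ n →ₗ[ℤ] K.Cochain (ZMod q) n :=
  LinearMap.compRight ℤ (Int.castAddHom (ZMod q)).toIntLinearMap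

theorem reduce_mem_specialCochains (K : ZpComplex p V) (q n : ℕ) (ρ : Special)
    (z : K.Cochain ℤ n) (hz : z ∈ K.specialCochains ℤ ρ n) :
    K.reduce q n z ∈ K.specialCochains (ZMod q) ρ n := by
  have h : K.coop ℤ ρ n z = 0 := hz
  have h' : K.coop (ZMod q) ρ n (K.reduce q n z) = K.reduce q n (K.coop ℤ ρ n z) := rfl
  show K.coop (ZMod q) ρ n (K.reduce q n z) = 0
  rw [h', h, map_zero]

theorem reduce_mem_cocycles (K : ZpComplex p V) (q n : ℕ) (ρ : Special)
    (z : K.Cochain ℤ n) (hz : z ∈ K.cocycles ℤ ρ n) :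
    K.reduce q n z ∈ K.cocycles (ZMod q) ρ n := by
  refine ⟨K.reduce_mem_specialCochains q n ρ z hz.1, ?_⟩
  have h : K.coboundary ℤ n z = 0 := hz.2
  have h' : K.coboundary (ZMod q) n (K.reduce q n z) =
    K.reduce q (n + 1) (K.coboundary ℤ n z) := rfl
  show K.coboundary (ZMod q) n (K.reduce q n z) = 0
  rw [h', h, map_zero]

theorem reduce_mem_coboundaries (K : ZpComplex p V) (q n : ℕ) (ρ : Special)
    (z : K.Cochain ℤ n) (hz : z ∈ K.coboundaries ℤ ρ n) :
    K.reduce q n z ∈ K.coboundaries (ZMod q) ρ n := by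
  cases n with
  | zero =>
    have h : z = 0 := hz
    rw [h, map_zero]
    exact Submodule.zero_mem _
  | succ n =>
    obtain ⟨y, hy, rfl⟩ := hz
    exact ⟨K.reduce q n y, K.reduce_mem_specialCochains q n ρ y hy, rfl⟩

/-- Reduction modulo `q` on special cohomology. -/
def cohomologyReduce (K : ZpComplex p V) (q n : ℕ) (ρ : Special) :
    K.Cohomology ℤ ρ n →ₗ[ℤ] K.Cohomology (ZMod q) ρ n :=
  Submodule.mapQ _ _
    ((K.reduce q n).restrict fun z hz => K.reduce_mem_cocycles q n ρ z hz)
    fun z hz => K.reduce_mem_coboundaries q n ρ z.1 hz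

/-! ### Smith classes and Smith index -/

/-- The cochain `1`, with value `1` on every vertex. -/
def one (K : ZpComplex p V) : K.Cochain ℤ 0 :=
  Finsupp.linearCombination ℤ fun _ : K.Simplex 0 => (1 : ℤ)

/-- `s ψ` for a cochain `ψ` of even dimension `j`, and `d ψ` for one of odd dimension. -/
def smithOp (K : ZpComplex p V) (j : ℕ) : Module.End ℤ (K.Cochain ℤ j) :=
  K.coop ℤ (Special.parity j).bar j

/-- `ψ` is a resolution of the cocycle `1`: `1 = s ψ₀`, and `δ ψⱼ` is `d ψⱼ₊₁` for even `j` and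
`s ψⱼ₊₁` for odd `j`. -/
def IsResolution (K : ZpComplex p V) (ψ : (j : ℕ) → K.Cochain ℤ j) : Prop :=
  K.coop ℤ .s 0 (ψ 0) = K.one ∧
    ∀ j, (Even j → K.coboundary ℤ j (ψ j) = K.coop ℤ .d (j + 1) (ψ (j + 1))) ∧
      (Odd j → K.coboundary ℤ j (ψ j) = K.coop ℤ .s (j + 1) (ψ (j + 1)))

/-- `a` is the `j`-th Smith class: the class of `s ψⱼ` in `d`-cohomology if `j` is even, and that
of `d ψⱼ` in `s`-cohomology if `j` is odd, for a resolution `ψ` of `1`. (Resolutions exist, and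
the class does not depend on the resolution.) -/
def IsSmithClass (K : ZpComplex p V) (j : ℕ) (a : K.Cohomology ℤ (Special.parity j) j) : Prop :=
  ∃ ψ : (j : ℕ) → K.Cochain ℤ j, K.IsResolution ψ ∧
    ∃ h : K.smithOp j (ψ j) ∈ K.cocycles ℤ (Special.parity j) j,
      a = Submodule.Quotient.mk ⟨K.smithOp j (ψ j), h⟩

/-- The Smith index: the smallest `n` such that the `n`-th Smith class is zero. -/
def smithIndex (K : ZpComplex p V) : ℕ := sInf {n | K.IsSmithClass n 0}

/-- The Smith index modulo `q`: the smallest `n` such that the `n`-th Smith class becomes zero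
under reduction of the coefficients modulo `q`. -/
def smithIndexMod (K : ZpComplex p V) (q : ℕ) : ℕ :=
  sInf {n | ∃ a, K.IsSmithClass n a ∧ K.cohomologyReduce q n (Special.parity n) a = 0}

/-! ### Boundary-equivariant duals -/

/-- The chain `c` is dual to the `d`-cocycle `z`, modulo `p`: `s c` is a cycle modulo `p`, and the
value of `z` on `s c` is non-zero modulo `p`. Here a `d`-cocycle `z = s φ` is regarded as a
functional on `d`-chains by `z (s c) := φ (s c)`, for `φ` supported in a fundamental domain
containing `c`; for arbitrary `c` this functional takes the value `z c` on `s c`. -/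
def IsDual (K : ZpComplex p V) {m : ℕ} (z : K.Cochain ℤ (m + 1)) (c : K.Chain (m + 1)) : Prop :=
  (∃ y : K.Chain m, K.boundary m (K.op (m + 1) .s c) = (p : ℤ) • y) ∧ ¬ (p : ℤ) ∣ z c

/-- The chain `c` is boundary-equivariant modulo `q`: `d (∂ c) = 0` modulo `q`. -/
def IsBoundaryEquivariant (K : ZpComplex p V) (q : ℕ) {m : ℕ} (c : K.Chain (m + 1)) : Prop :=
  ∃ y : K.Chain m, K.op m .d (K.boundary m c) = (q : ℤ) • y

/-- The top Smith class has positive even dimension `m + 1 = I(K) - 1`, and it has a dual that is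
boundary-equivariant modulo `p`. -/
def HasBoundaryEquivariantDual (K : ZpComplex p V) : Prop :=
  ∃ m : ℕ, Even (m + 1) ∧ K.smithIndex = m + 2 ∧
    ∃ ψ : (j : ℕ) → K.Cochain ℤ j, K.IsResolution ψ ∧
      ∃ c : K.Chain (m + 1), K.IsDual (K.coop ℤ .s (m + 1) (ψ (m + 1))) c ∧
        K.IsBoundaryEquivariant p c

/-! ### The join of complexes -/

/-- The join `K * L`, on the disjoint union of the vertex sets, with the vertices of `K` before
those of `L`: a non-empty set of vertices is a simplex if its part in `V` is empty or a simplex of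
`K`, and its part in `W` is empty or a simplex of `L`. The action is that of `K` on `V` and that
of `L` on `W`. -/
def join (K : ZpComplex p V) (L : ZpComplex p W) : ZpComplex p (V ⊕ₗ W) where
  faces := {σ | σ.Nonempty ∧ (leftPart σ = ∅ ∨ leftPart σ ∈ K.faces) ∧
    (rightPart σ = ∅ ∨ rightPart σ ∈ L.faces)}
  isRelLowerSet_faces := by
    rintro σ ⟨hσ, hl, hr⟩
    refine ⟨hσ, fun τ hτ hne => ⟨hne, ?_, ?_⟩⟩
    · have hsub : leftPart τ ⊆ leftPart σ := Finset.toLeft_subset_toLeft (Finset.map_subset_map.2 hτ)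
      rcases Finset.eq_empty_or_nonempty (leftPart τ) with h | h
      · exact Or.inl h
      · rcases hl with hl | hl
        · exact Or.inl (Finset.subset_empty.1 (hl ▸ hsub))
        · exact Or.inr ((K.isRelLowerSet_faces hl).2 hsub h)
    · have hsub : rightPart τ ⊆ rightPart σ :=
        Finset.toRight_subset_toRight (Finset.map_subset_map.2 hτ)
      rcases Finset.eq_empty_or_nonempty (rightPart τ) with h | h
      · exact Or.inl h
      · rcases hr with hr | hr
        · exact Or.inl (Finset.subset_empty.1 (hr ▸ hsub))
        · exact Or.inr ((L.isRelLowerSet_faces hr).2 hsub h)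
  singleton_mem := by
    intro v
    refine ⟨Finset.singleton_nonempty v, ?_⟩
    obtain ⟨v, rfl⟩ := toLex.surjective v
    rcases v with v | w
    · have h1 : leftPart ({toLex (Sum.inl v)} : Finset (V ⊕ₗ W)) = {v} := by
        ext x; simp [leftPart]
      have h2 : rightPart ({toLex (Sum.inl v)} : Finset (V ⊕ₗ W)) = ∅ := by
        ext x; simp [rightPart]
      exact ⟨Or.inr (h1 ▸ K.singleton_mem v), Or.inl h2⟩
    · have h1 : leftPart ({toLex (Sum.inr w)} : Finset (V ⊕ₗ W)) = ∅ := by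
        ext x; simp [leftPart]
      have h2 : rightPart ({toLex (Sum.inr w)} : Finset (V ⊕ₗ W)) = {w} := by
        ext x; simp [rightPart]
      exact ⟨Or.inl h1, Or.inr (h2 ▸ L.singleton_mem w)⟩
  t := joinPerm K.t L.t
  t_pow := by rw [joinPerm_pow, K.t_pow, L.t_pow, joinPerm_one]
  map_mem := by
    rintro σ ⟨hσ, hl, hr⟩
    refine ⟨hσ.map, ?_, ?_⟩
    · rw [leftPart_map]
      exact hl.imp (fun h => by rw [h, Finset.map_empty]) (K.map_mem _)
    · rw [rightPart_map]
      exact hr.imp (fun h => by rw [h, Finset.map_empty]) (L.map_mem _)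
  simple := by
    rintro σ ⟨hσ, hl, hr⟩ k hk h
    rw [joinPerm_pow] at h
    have h1 := congrArg leftPart h
    have h2 := congrArg rightPart h
    rw [leftPart_map] at h1
    rw [rightPart_map] at h2
    rcases hl with hl | hl
    · rcases hr with hr | hr
      · obtain ⟨x, hx⟩ := hσ
        obtain ⟨x, rfl⟩ := toLex.surjective x
        rcases x with x | x
        · have : x ∈ leftPart σ := by simpa [leftPart] using hx
          simp [hl] at this
        · have : x ∈ rightPart σ := by simpa [rightPart] using hx
          simp [hr] at this
      · exact L.simple _ hr k hk h2
    · exact K.simple _ hl k hk h1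

end ZpComplex

end

set_option linter.unusedSectionVars false

noncomputable section

namespace ZpComplex

/-! ### Signs of sorted images -/

section Signs

variable {V : Type*} [LinearOrder V]

/-! Adjoin the empty simplex and count vertices instead of dimensions. A resolution of 1 is then a
single functional F on the augmented chains, with value 1 on the empty simplex and F(∂x) = F(ρₙ x)
for chains x with n vertices, where ρₙ is d for even n and s for odd n (`IsAugResolution`). The
class A^N concerns chains with N + 1 vertices. Since the action is free, ker d = im s and ker s = im
d on chains and on cochains over every ring, except on the empty simplex (`exists_contraction`).
Hence partial resolutions extend. Moreover A^N = 0 if and only if some resolution vanishes on all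
chains with more than N vertices (`exists_vanishing_of_isSmithClass_zero`), and if A^N = 0 modulo p,
some resolution is pη on chains with N + 1 vertices (`exists_divisible_of_isSmithClass_mod`).

Upper bounds. Chains of K * L are spanned by products, and resolutions F of K and F' of L combine to
a resolution of the join (`IsAugResolution.joinF`). Its components are F ⊗ F', FT ⊗ F' and a
triangular sum of products of translates, as in the diagonal approximation for the periodic
resolution of the cyclic group. Vanishing of F and F' in high dimensions gives I(K * L) ≤ I(K) +
I(L). If the classes of K and L vanish modulo p in dimensions n and m, the top cochains can be taken
to be ηs (even dimension) or pη - ηs (odd dimension), and zero above (`IsAugResolution.exists_top`).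
The coboundary of the join resolution in the critical dimension is then zero or an explicit special
coboundary (`isSmithClass_join_zero`). So I(K * L) ≤ I_p(K) + I_p(L) + 1 always, which is the bound
in (1).

Lower bounds. Over the field with p elements, A^N ≠ 0 is witnessed by a chain c with ρ(∂c) = 0 and
F(∂c) ≠ 0 (`Detects`). Writing ∂c = ρb lowers the dimension without changing F(∂c), down to the
empty simplex. This descent shows that F(∂c) does not depend on F, and that F is multiplicative on
suitable products in the join. If ∂c is invariant, and p = 2 or the dimension of c is even, then c ⊗
ρb detects a class of the join (`Detects.join_right`), so that the indices modulo p add up at least.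
For p = 2 invariance is automatic, because d = s modulo 2; for p > 2 it is what (E) provides.

Examples for (3). If y is an arc from a vertex to its antipode, F(sy) is odd for every resolution F.
Discs e with ∂e = 2sy give a complex with I_2 = 2 and I = 3. Joining it with two points raises the
index to 4, by a computation modulo 4. Joining it with a complex whose top Smith class is nonzero
modulo 2, while twice its top cochain is a coboundary, gives only 5 = 3 + 3 - 1
(`isSmithClass_join_zero_of_torsion`). -/

theorem inversions_eq_sum (g : Equiv.Perm V) (σ : Finset V) :
    inversions g σ = ∑ x ∈ σ, ∑ y ∈ σ, if x < y ∧ g y < g x then 1 else 0 := by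
  rw [inversions, Finset.card_filter, Finset.sum_product]

theorem position_eq_sum (σ : Finset V) (v : V) :
    position σ v = ∑ u ∈ σ, if u < v then 1 else 0 := by
  rw [position, Finset.card_filter]

theorem inversions_one (σ : Finset V) : inversions (1 : Equiv.Perm V) σ = 0 := by
  rw [inversions_eq_sum]
  refine Finset.sum_eq_zero fun x _ => Finset.sum_eq_zero fun y _ => if_neg ?_
  rintro ⟨h1, h2⟩
  exact lt_asymm h1 h2

/-- Multiplicativity of the sign of the sorting permutation: c counts the pairs that g reverses and
h puts back in order. -/
theorem inversions_mul (g h : Equiv.Perm V) (σ : Finset V) :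
    ∃ c, inversions g σ + inversions h (σ.map g.toEmbedding) = inversions (h * g) σ + 2 * c := by
  refine ⟨∑ x ∈ σ, ∑ y ∈ σ, if x < y ∧ g y < g x ∧ h (g x) < h (g y) then 1 else 0, ?_⟩
  have key : ∑ x ∈ σ, ∑ y ∈ σ, (if g x < g y ∧ h (g y) < h (g x) then 1 else 0) =
      ∑ x ∈ σ, ∑ y ∈ σ, ((if x < y ∧ g x < g y ∧ h (g y) < h (g x) then 1 else 0) +
        (if x < y ∧ g y < g x ∧ h (g x) < h (g y) then 1 else 0)) := by
    simp only [Finset.sum_add_distrib]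
    rw [Finset.sum_comm (f := fun x y =>
      if x < y ∧ g y < g x ∧ h (g x) < h (g y) then 1 else 0)]
    rw [← Finset.sum_add_distrib]
    refine Finset.sum_congr rfl fun x _ => ?_
    rw [← Finset.sum_add_distrib]
    refine Finset.sum_congr rfl fun y _ => ?_
    rcases lt_trichotomy x y with h1 | h1 | h1
    · simp [h1, h1.not_gt]
    · simp [h1]
    · simp [h1, h1.not_gt]
  simp only [inversions_eq_sum, Finset.sum_map, Equiv.coe_toEmbedding]
  rw [key, Finset.mul_sum, ← Finset.sum_add_distrib, ← Finset.sum_add_distrib]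
  refine Finset.sum_congr rfl fun x _ => ?_
  rw [Finset.mul_sum, ← Finset.sum_add_distrib, ← Finset.sum_add_distrib]
  refine Finset.sum_congr rfl fun y _ => ?_
  simp only [Equiv.Perm.mul_apply]
  rcases lt_trichotomy x y with h1 | h1 | h1
  · have hne : g x ≠ g y := fun h => h1.ne (g.injective h)
    have hne' : h (g x) ≠ h (g y) := fun h' => hne (h.injective h')
    rcases lt_or_gt_of_ne hne with h2 | h2 <;> rcases lt_or_gt_of_ne hne' with h3 | h3 <;>
      simp [h1, h2, h3, h2.not_gt, h3.not_gt]
  · simp [h1]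
  · simp [h1.not_gt]

/-- The inverted pairs that involve v correspond to the symmetric difference of {u < v} and {g u < g
v}; c is the size of the intersection. This is the sign identity behind the commutation of t with ∂.
-/
theorem inversions_erase (g : Equiv.Perm V) (σ : Finset V) (v : V) (hv : v ∈ σ) :
    ∃ c, position σ v + position (σ.map g.toEmbedding) (g v) + inversions g (σ.erase v) =
      inversions g σ + 2 * c := by
  refine ⟨∑ u ∈ σ, if u < v ∧ g u < g v then 1 else 0, ?_⟩
  have h1 : inversions g σ = inversions g (σ.erase v) +
      (∑ u ∈ σ, ((if u < v ∧ g v < g u then 1 else 0) + (if v < u ∧ g u < g v then 1 else 0))) := by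
    simp only [inversions_eq_sum]
    rw [← Finset.add_sum_erase σ _ hv, Finset.sum_add_distrib, ← Finset.add_sum_erase σ
      (fun u => if u < v ∧ g v < g u then 1 else 0) hv]
    simp only [lt_irrefl, false_and, if_false, zero_add]
    have : ∀ x ∈ σ.erase v, (∑ y ∈ σ, if x < y ∧ g y < g x then 1 else 0) =
        (if x < v ∧ g v < g x then 1 else 0) +
          ∑ y ∈ σ.erase v, if x < y ∧ g y < g x then 1 else 0 := fun x _ => by
      rw [← Finset.add_sum_erase σ _ hv]
    rw [Finset.sum_congr rfl this, Finset.sum_add_distrib]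
    ring
  rw [h1]
  simp only [position_eq_sum, Finset.sum_map, Equiv.coe_toEmbedding]
  rw [add_assoc, add_comm _ (inversions g _), ← add_assoc, add_comm _ (inversions g _), add_assoc,
    add_assoc, Finset.mul_sum, ← Finset.sum_add_distrib, ← Finset.sum_add_distrib]
  congr 1
  refine Finset.sum_congr rfl fun u _ => ?_
  by_cases h0 : u = v
  · subst h0; simp
  · have hne : g u ≠ g v := fun h => h0 (g.injective h)
    rcases lt_or_gt_of_ne hne with h2 | h2 <;> rcases lt_or_gt_of_ne h0 with h3 | h3 <;>
      simp [h2, h3, h2.not_gt, h3.not_gt]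

theorem neg_one_pow_of_add_two_mul (R : Type*) [CommRing R] {a b c : ℕ} (h : a = b + 2 * c) :
    (-1 : R) ^ a = (-1) ^ b := by
  rw [h, pow_add, pow_mul]; simp

theorem position_erase_of_lt {σ : Finset V} {v w : V} (h : w < v) :
    position (σ.erase v) w = position σ w := by
  unfold position
  congr 1
  ext u
  simp only [Finset.mem_filter, Finset.mem_erase]
  constructor
  · rintro ⟨⟨_, h2⟩, h3⟩; exact ⟨h2, h3⟩
  · rintro ⟨h2, h3⟩; exact ⟨⟨fun h4 => by subst h4; exact lt_asymm h h3, h2⟩, h3⟩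

theorem position_erase_of_gt {σ : Finset V} {v w : V} (hw : w ∈ σ) (h : w < v) :
    position (σ.erase w) v + 1 = position σ v := by
  unfold position
  rw [Finset.filter_erase, Finset.card_erase_add_one]
  simp [hw, h]

end Signs

/-! ### Identities in rings with an element of finite order -/

section Rings

variable {A : Type*} [Ring A] {p : ℕ}

theorem one_sub_mul_sum_geom_sum (t : A) :
    (1 - t) * ∑ i ∈ Finset.range p, ∑ j ∈ Finset.range i, t ^ j =
      p - ∑ i ∈ Finset.range p, t ^ i := by
  rw [Finset.mul_sum]
  simp only [mul_neg_geom_sum, Finset.sum_sub_distrib]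
  simp

/-- The factor 1 - t telescopes each geometric sum to 1 - t^(p - k), which leaves the sum of the
conjugates of π. That sum is the identity when π projects onto a fundamental domain, so this formula
and `contraction_right` become contracting homotopies for d and s. -/
theorem contraction_left (t π : A) :
    π * (∑ i ∈ Finset.range p, t ^ i) + (1 - t) *
        (-∑ k ∈ Finset.range p, (∑ j ∈ Finset.range (p - k), t ^ j) * π * t ^ k) =
      ∑ k ∈ Finset.range p, t ^ (p - k) * π * t ^ k := by
  have h : ∀ k, (1 - t) * ((∑ j ∈ Finset.range (p - k), t ^ j) * π * t ^ k) =
      π * t ^ k - t ^ (p - k) * π * t ^ k := fun k => by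
    rw [← mul_assoc, ← mul_assoc, mul_neg_geom_sum, sub_mul, sub_mul, one_mul]
  rw [mul_neg, Finset.mul_sum _ _ (1 - t), Finset.sum_congr rfl fun k _ => h k,
    Finset.sum_sub_distrib, Finset.mul_sum]
  abel

theorem contraction_right {t : A} (ht : t ^ p = 1) (π : A) :
    (∑ i ∈ Finset.range p, t ^ i) * π +
        (-∑ k ∈ Finset.range p, t ^ (p - k) * π * (∑ j ∈ Finset.range k, t ^ j)) * (1 - t) =
      ∑ k ∈ Finset.range p, t ^ (p - k) * π * t ^ k := by
  have hs : ∑ i ∈ Finset.range p, t ^ i = ∑ k ∈ Finset.range p, t ^ (p - k) := by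
    have h1 := Finset.sum_range_succ (fun k => t ^ k) p
    have h2 := Finset.sum_range_succ' (fun k => t ^ k) p
    rw [h1, ht, pow_zero] at h2
    rw [add_right_cancel h2, ← Finset.sum_range_reflect]
    refine Finset.sum_congr rfl fun k hk => ?_
    have := Finset.mem_range.1 hk
    congr 1; omega
  have h : ∀ k, t ^ (p - k) * π * (∑ j ∈ Finset.range k, t ^ j) * (1 - t) =
      t ^ (p - k) * π - t ^ (p - k) * π * t ^ k := fun k => by
    rw [mul_assoc, geom_sum_mul_neg, mul_sub, mul_one]
  rw [neg_mul, Finset.sum_mul _ _ (1 - t), Finset.sum_congr rfl fun k _ => h k,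
    Finset.sum_sub_distrib, hs, Finset.sum_mul]
  abel

end Rings

/-! ### The augmented chain complex -/

variable {p : ℕ} {V : Type*} [LinearOrder V]

/-- The simplices of `K`, the empty one included. -/
abbrev Cell (K : ZpComplex p V) : Type _ := {σ : Finset V // σ = ∅ ∨ σ ∈ K.faces}

theorem cell_of_subset (K : ZpComplex p V) {σ τ : Finset V} (hσ : σ = ∅ ∨ σ ∈ K.faces)
    (h : τ ⊆ σ) : τ = ∅ ∨ τ ∈ K.faces := by
  rcases Finset.eq_empty_or_nonempty τ with h0 | h0
  · exact Or.inl h0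
  · rcases hσ with rfl | hσ
    · exact Or.inl (Finset.subset_empty.1 h)
    · exact Or.inr ((K.isRelLowerSet_faces hσ).2 h h0)

/-- The empty simplex. -/
def emptyCell (K : ZpComplex p V) : K.Cell := ⟨∅, Or.inl rfl⟩

/-- Removal of a vertex. -/
def eraseCell (K : ZpComplex p V) (σ : K.Cell) (v : V) : K.Cell :=
  ⟨σ.1.erase v, K.cell_of_subset σ.2 (Finset.erase_subset _ _)⟩

theorem map_pow_mem (K : ZpComplex p V) (k : ℕ) {σ : Finset V} (hσ : σ ∈ K.faces) :
    σ.map (K.t ^ k).toEmbedding ∈ K.faces := by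
  induction k with
  | zero =>
    have : σ.map ((K.t ^ 0).toEmbedding) = σ := Finset.map_refl
    rwa [this]
  | succ k ih =>
    have : σ.map (K.t ^ (k + 1)).toEmbedding = (σ.map (K.t ^ k).toEmbedding).map K.t.toEmbedding := by
      rw [Finset.map_map]; congr 1; ext x; simp [pow_succ']
    rw [this]
    exact K.map_mem _ ih

/-- The image of a cell under `t ^ k`. -/
def powCell (K : ZpComplex p V) (k : ℕ) (σ : K.Cell) : K.Cell :=
  ⟨σ.1.map (K.t ^ k).toEmbedding, σ.2.imp (fun h => by rw [h, Finset.map_empty]) (K.map_pow_mem k)⟩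

/-- The augmented chains with coefficients in `R`, in all dimensions. -/
abbrev AugChain (K : ZpComplex p V) (R : Type*) [CommRing R] : Type _ := K.Cell →₀ R

variable (K : ZpComplex p V) (R : Type*) [CommRing R]

/-- A simplex as an augmented chain. -/
abbrev gen (σ : K.Cell) : K.AugChain R := Finsupp.single σ (1 : R)

/-- The augmented boundary operator. -/
def bd : Module.End R (K.AugChain R) :=
  Finsupp.linearCombination R fun σ => ∑ v ∈ σ.1, (-1 : R) ^ position σ.1 v • K.gen R (K.eraseCell σ v)

/-- The action of `t` on augmented chains. -/
def T : Module.End R (K.AugChain R) :=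
  Finsupp.linearCombination R fun σ => (-1 : R) ^ inversions K.t σ.1 • K.gen R (K.powCell 1 σ)

/-- The operators `d` and `s` on augmented chains. -/
def augOp : Special → Module.End R (K.AugChain R)
  | .d => 1 - K.T R
  | .s => ∑ i ∈ Finset.range p, K.T R ^ i

/-- The augmented chains spanned by the simplices with `n` vertices. -/
def H (n : ℕ) : Submodule R (K.AugChain R) := Finsupp.supported R R {σ | σ.1.card = n}

variable {R}

theorem bd_gen (σ : K.Cell) : K.bd R (K.gen R σ) =
    ∑ v ∈ σ.1, (-1 : R) ^ position σ.1 v • K.gen R (K.eraseCell σ v) := by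
  simp [bd]

theorem T_gen (σ : K.Cell) :
    K.T R (K.gen R σ) = (-1 : R) ^ inversions K.t σ.1 • K.gen R (K.powCell 1 σ) := by
  simp [T]

theorem powCell_comp (i j : ℕ) (σ : K.Cell) : K.powCell i (K.powCell j σ) = K.powCell (i + j) σ := by
  apply Subtype.ext
  simp only [powCell, Finset.map_map]
  congr 1; ext x; simp [pow_add]

theorem powCell_zero (σ : K.Cell) : K.powCell 0 σ = σ :=
  Subtype.ext Finset.map_refl

theorem T_pow_gen (k : ℕ) (σ : K.Cell) :
    (K.T R ^ k) (K.gen R σ) = (-1 : R) ^ inversions (K.t ^ k) σ.1 • K.gen R (K.powCell k σ) := by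
  induction k with
  | zero => simp [inversions_one, powCell_zero]
  | succ k ih =>
    rw [pow_succ', Module.End.mul_apply, ih, map_smul, T_gen, smul_smul, powCell_comp, add_comm 1 k,
      ← pow_add, pow_succ']
    obtain ⟨c, hc⟩ := inversions_mul (K.t ^ k) K.t σ.1
    rw [← neg_one_pow_of_add_two_mul R hc]
    rfl

theorem powCell_p (σ : K.Cell) : K.powCell p σ = σ := by
  apply Subtype.ext
  simp only [powCell, K.t_pow]
  exact Finset.map_refl

theorem T_pow_p : K.T R ^ p = 1 := by
  refine Finsupp.lhom_ext' fun σ => LinearMap.ext_ring ?_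
  show (K.T R ^ p) (K.gen R σ) = K.gen R σ
  rw [T_pow_gen, K.t_pow, inversions_one, powCell_p]
  simp

theorem gen_mem_H (σ : K.Cell) : K.gen R σ ∈ K.H R σ.1.card :=
  Finsupp.single_mem_supported R 1 rfl

variable {K} in
theorem gen_mem {n : ℕ} {σ : K.Cell} (h : σ.1.card = n) : K.gen R σ ∈ K.H R n :=
  h ▸ K.gen_mem_H σ

variable {K} in
theorem eqOn_H {M : Type*} [AddCommGroup M] [Module R M] {n : ℕ} {f g : K.AugChain R →ₗ[R] M}
    (h : ∀ σ : K.Cell, σ.1.card = n → f (K.gen R σ) = g (K.gen R σ)) {x : K.AugChain R}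
    (hx : x ∈ K.H R n) : f x = g x := by
  rw [H, Finsupp.supported_eq_span_single] at hx
  refine LinearMap.eqOn_span (s := (fun i => Finsupp.single i (1 : R)) '' {σ : K.Cell | σ.1.card = n})
    ?_ hx
  rintro _ ⟨σ, hσ, rfl⟩
  exact h σ hσ

variable {K} in
theorem maps_H {W : Type*} [LinearOrder W] {L : ZpComplex p W} {n m : ℕ}
    {f : K.AugChain R →ₗ[R] L.AugChain R}
    (h : ∀ σ : K.Cell, σ.1.card = n → f (K.gen R σ) ∈ L.H R m) {x : K.AugChain R}
    (hx : x ∈ K.H R n) : f x ∈ L.H R m := by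
  rw [H, Finsupp.supported_eq_span_single] at hx
  refine Submodule.span_le (p := (L.H R m).comap f) |>.2 ?_ hx
  rintro _ ⟨σ, hσ, rfl⟩
  exact h σ hσ

theorem card_powCell (k : ℕ) (σ : K.Cell) : (K.powCell k σ).1.card = σ.1.card :=
  Finset.card_map _

variable {K}

theorem T_pow_mem {n : ℕ} (k : ℕ) {x : K.AugChain R} (hx : x ∈ K.H R n) :
    (K.T R ^ k) x ∈ K.H R n := by
  refine maps_H (fun σ hσ => ?_) hx
  rw [T_pow_gen]
  exact Submodule.smul_mem _ _ (gen_mem ((K.card_powCell k σ).trans hσ))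

theorem T_mem {n : ℕ} {x : K.AugChain R} (hx : x ∈ K.H R n) : K.T R x ∈ K.H R n := by
  simpa using T_pow_mem 1 hx

theorem augOp_s_apply (x : K.AugChain R) :
    K.augOp R .s x = ∑ i ∈ Finset.range p, (K.T R ^ i) x := by
  simp [augOp, LinearMap.sum_apply]

theorem augOp_d_apply (x : K.AugChain R) : K.augOp R .d x = x - K.T R x := rfl

theorem augOp_mem {n : ℕ} (ρ : Special) {x : K.AugChain R} (hx : x ∈ K.H R n) :
    K.augOp R ρ x ∈ K.H R n := by
  cases ρ with
  | d => exact Submodule.sub_mem _ hx (T_mem hx)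
  | s =>
    rw [augOp_s_apply]
    exact Submodule.sum_mem _ fun i _ => T_pow_mem i hx

theorem bd_mem {n : ℕ} {x : K.AugChain R} (hx : x ∈ K.H R (n + 1)) : K.bd R x ∈ K.H R n := by
  refine maps_H (fun σ hσ => ?_) hx
  rw [bd_gen]
  refine Submodule.sum_mem _ fun v hv => Submodule.smul_mem _ _ (gen_mem ?_)
  have := Finset.card_erase_of_mem hv
  show (σ.1.erase v).card = n
  omega

theorem bd_zero_mem {x : K.AugChain R} (hx : x ∈ K.H R 0) : K.bd R x = 0 := by
  have := eqOn_H (f := K.bd R) (g := 0) (n := 0) (fun σ hσ => ?_) hx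
  · simpa using this
  · rw [bd_gen, Finset.card_eq_zero.1 hσ]; simp

variable (K)

theorem T_pow_zero_mem {x : K.AugChain R} (k : ℕ) (hx : x ∈ K.H R 0) : (K.T R ^ k) x = x := by
  refine eqOn_H (f := K.T R ^ k) (g := 1) (n := 0) (fun σ hσ => ?_) hx
  have h := Finset.card_eq_zero.1 hσ
  have h1 : K.powCell k σ = σ := Subtype.ext (by simp [powCell, h])
  have h2 : inversions (K.t ^ k) σ.1 = 0 := by simp [inversions, h]
  rw [T_pow_gen, h1, h2]; simp

theorem T_bd : K.T R * K.bd R = K.bd R * K.T R := by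
  refine Finsupp.lhom_ext' fun σ => LinearMap.ext_ring ?_
  show K.T R (K.bd R (K.gen R σ)) = K.bd R (K.T R (K.gen R σ))
  rw [T_gen, map_smul, bd_gen, bd_gen, map_sum, Finset.smul_sum]
  simp only [powCell, pow_one]
  rw [Finset.sum_map]
  refine Finset.sum_congr rfl fun v hv => ?_
  rw [map_smul, T_gen, smul_smul, smul_smul]
  have hc : K.powCell 1 (K.eraseCell σ v) =
      K.eraseCell ⟨σ.1.map K.t.toEmbedding, (K.powCell 1 σ).2⟩ (K.t v) :=
    Subtype.ext (by simp [powCell, eraseCell, Finset.map_erase])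
  obtain ⟨c, hc'⟩ := inversions_erase K.t σ.1 v hv
  have h1 := neg_one_pow_of_add_two_mul R hc'
  rw [hc]
  congr 1
  have h2 : (-1 : R) ^ position (σ.1.map K.t.toEmbedding) (K.t v) *
    (-1 : R) ^ position (σ.1.map K.t.toEmbedding) (K.t v) = 1 := by
    rw [← pow_add, ← two_mul, pow_mul]; simp
  rw [← h1, pow_add, pow_add]
  show (-1 : R) ^ position σ.1 v * (-1) ^ inversions K.t (σ.1.erase v) = _ *
    (-1 : R) ^ position (σ.1.map K.t.toEmbedding) (K.t v)
  linear_combination (-(-1 : R) ^ position σ.1 v * (-1) ^ inversions K.t (σ.1.erase v)) * h2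

theorem bd_bd_apply (x : K.AugChain R) : K.bd R (K.bd R x) = 0 := by
  suffices h : K.bd R ∘ₗ K.bd R = 0 from LinearMap.congr_fun h x
  refine Finsupp.lhom_ext' fun σ => LinearMap.ext_ring ?_
  show K.bd R (K.bd R (K.gen R σ)) = 0
  rw [bd_gen, map_sum]
  simp only [map_smul, bd_gen, Finset.smul_sum, smul_smul]
  rw [Finset.sum_sigma']
  have hP : ∀ v w : V, v ∈ σ.1 → w ∈ σ.1 → w < v →
      (-1 : R) ^ position σ.1 v * (-1) ^ position (σ.1.erase v) w =
      - ((-1 : R) ^ position σ.1 w * (-1) ^ position (σ.1.erase w) v) := by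
    intro v w hv hw h
    rw [position_erase_of_lt h, ← position_erase_of_gt hw h, pow_succ]
    ring
  refine Finset.sum_involution (fun x _ => ⟨x.2, x.1⟩) ?_ ?_ ?_ ?_
  · rintro ⟨v, w⟩ h
    simp only [Finset.mem_sigma, eraseCell, Finset.mem_erase] at h
    obtain ⟨hv, hne, hw⟩ := h
    have he : K.eraseCell (K.eraseCell σ v) w = K.eraseCell (K.eraseCell σ w) v :=
      Subtype.ext Finset.erase_right_comm
    simp only [he]
    rw [← add_smul]
    have : (-1 : R) ^ position σ.1 v * (-1) ^ position (σ.1.erase v) w +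
      (-1 : R) ^ position σ.1 w * (-1) ^ position (σ.1.erase w) v = 0 := by
      rcases lt_or_gt_of_ne hne with h | h
      · rw [hP v w hv hw h]; ring
      · rw [hP w v hw hv h]; ring
    show ((-1 : R) ^ position σ.1 v * (-1) ^ position (σ.1.erase v) w +
      (-1 : R) ^ position σ.1 w * (-1) ^ position (σ.1.erase w) v) • _ = _
    rw [this, zero_smul]
  · rintro ⟨v, w⟩ h _ h'
    simp only [Finset.mem_sigma, eraseCell, Finset.mem_erase] at h
    simp only [Sigma.mk.injEq] at h'
    exact h.2.1 h'.1
  · rintro ⟨v, w⟩ h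
    simp only [Finset.mem_sigma, eraseCell, Finset.mem_erase] at h ⊢
    exact ⟨h.2.2, Ne.symm h.2.1, h.1⟩
  · rintro ⟨v, w⟩ h; rfl

theorem bd_T_pow (k : ℕ) (x : K.AugChain R) :
    K.bd R ((K.T R ^ k) x) = (K.T R ^ k) (K.bd R x) := by
  have h : Commute (K.bd R) (K.T R ^ k) := Commute.pow_right (T_bd K).symm k
  exact LinearMap.congr_fun h x

theorem bd_T (x : K.AugChain R) : K.bd R (K.T R x) = K.T R (K.bd R x) := by
  simpa using K.bd_T_pow 1 x

theorem bd_augOp (ρ : Special) (x : K.AugChain R) :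
    K.bd R (K.augOp R ρ x) = K.augOp R ρ (K.bd R x) := by
  cases ρ with
  | d => rw [augOp_d_apply, augOp_d_apply, map_sub, bd_T]
  | s =>
    rw [augOp_s_apply, augOp_s_apply, map_sum]
    exact Finset.sum_congr rfl fun i _ => K.bd_T_pow i x

theorem T_pow_augOp (ρ : Special) (k : ℕ) (x : K.AugChain R) :
    (K.T R ^ k) (K.augOp R ρ x) = K.augOp R ρ ((K.T R ^ k) x) := by
  cases ρ with
  | d =>
    rw [augOp_d_apply, augOp_d_apply, map_sub, ← Module.End.mul_apply, ← Module.End.mul_apply,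
      ← pow_succ, ← pow_succ']
  | s =>
    rw [augOp_s_apply, augOp_s_apply, map_sum]
    refine Finset.sum_congr rfl fun i _ => ?_
    rw [← Module.End.mul_apply, ← Module.End.mul_apply, ← pow_add, ← pow_add, add_comm]

theorem T_augOp (ρ : Special) (x : K.AugChain R) :
    K.T R (K.augOp R ρ x) = K.augOp R ρ (K.T R x) := by
  simpa using K.T_pow_augOp ρ 1 x

theorem sub_T_mul_s : (1 - K.T R) * K.augOp R .s = 0 := by
  exact (mul_neg_geom_sum (K.T R) p).trans (by rw [T_pow_p, sub_self])

theorem s_mul_sub_T : K.augOp R .s * (1 - K.T R) = 0 := by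
  exact (geom_sum_mul_neg (K.T R) p).trans (by rw [T_pow_p, sub_self])

theorem augOp_d_s (x : K.AugChain R) : K.augOp R .d (K.augOp R .s x) = 0 :=
  LinearMap.congr_fun K.sub_T_mul_s x

theorem augOp_s_d (x : K.AugChain R) : K.augOp R .s (K.augOp R .d x) = 0 :=
  LinearMap.congr_fun K.s_mul_sub_T x

theorem augOp_bar (ρ : Special) (x : K.AugChain R) : K.augOp R ρ.bar (K.augOp R ρ x) = 0 := by
  cases ρ
  · exact K.augOp_s_d x
  · exact K.augOp_d_s x

theorem T_s (x : K.AugChain R) : K.T R (K.augOp R .s x) = K.augOp R .s x := by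
  have := K.augOp_d_s x
  rw [augOp_d_apply, sub_eq_zero] at this
  exact this.symm

theorem T_pow_s (k : ℕ) (x : K.AugChain R) : (K.T R ^ k) (K.augOp R .s x) = K.augOp R .s x := by
  induction k with
  | zero => simp
  | succ k ih => rw [pow_succ, Module.End.mul_apply, T_s, ih]

theorem s_T (x : K.AugChain R) : K.augOp R .s (K.T R x) = K.augOp R .s x := by
  rw [← T_augOp, T_s]

theorem s_s (x : K.AugChain R) : K.augOp R .s (K.augOp R .s x) = (p : R) • K.augOp R .s x := by
  rw [augOp_s_apply (K := K) (K.augOp R .s x)]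
  simp [T_pow_s, Nat.cast_smul_eq_nsmul]

/-- An operator whose composite with `d` is `p - s`. -/
def vOp (R : Type*) [CommRing R] : Module.End R (K.AugChain R) :=
  ∑ i ∈ Finset.range p, ∑ j ∈ Finset.range i, K.T R ^ j

theorem d_vOp (x : K.AugChain R) :
    K.augOp R .d (K.vOp R x) = (p : R) • x - K.augOp R .s x := by
  have : (1 - K.T R) * K.vOp R = (p : Module.End R (K.AugChain R)) - K.augOp R .s :=
    one_sub_mul_sum_geom_sum (K.T R)
  have := LinearMap.congr_fun this x
  simpa [augOp, Nat.cast_smul_eq_nsmul] using this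

theorem vOp_comm {f : Module.End R (K.AugChain R)} (h : Commute (K.T R) f) (x : K.AugChain R) :
    K.vOp R (f x) = f (K.vOp R x) := by
  have : Commute (K.vOp R) f :=
    Commute.sum_left _ _ _ fun i _ => Commute.sum_left _ _ _ fun j _ => h.pow_left j
  exact LinearMap.congr_fun this x

theorem vOp_T (x : K.AugChain R) : K.vOp R (K.T R x) = K.T R (K.vOp R x) :=
  K.vOp_comm (Commute.refl _) x

theorem vOp_bd (x : K.AugChain R) : K.vOp R (K.bd R x) = K.bd R (K.vOp R x) :=
  K.vOp_comm K.T_bd x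

variable {K} in
theorem vOp_mem {n : ℕ} {x : K.AugChain R} (hx : x ∈ K.H R n) : K.vOp R x ∈ K.H R n := by
  rw [vOp, LinearMap.sum_apply]
  refine Submodule.sum_mem _ fun i _ => ?_
  rw [LinearMap.sum_apply]
  exact Submodule.sum_mem _ fun j _ => T_pow_mem j hx

/-! ### Exactness -/

theorem powCell_mul_p (k : ℕ) (σ : K.Cell) : K.powCell (k * p) σ = σ := by
  induction k with
  | zero => rw [zero_mul, powCell_zero]
  | succ k ih => rw [add_mul, one_mul, ← powCell_comp, powCell_p, ih]

/-- Two simplices are equivalent if they lie in the same orbit. -/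
def orbitSetoid (hp : 0 < p) : Setoid K.Cell where
  r σ τ := ∃ k : ℕ, τ = K.powCell k σ
  iseqv := by
    refine ⟨fun σ => ⟨0, (K.powCell_zero σ).symm⟩, ?_, ?_⟩
    · rintro σ τ ⟨k, rfl⟩
      refine ⟨k * (p - 1), ?_⟩
      have : k * (p - 1) + k = k * p := by
        rw [← Nat.mul_succ, Nat.succ_eq_add_one, Nat.sub_add_cancel hp]
      rw [powCell_comp, this, powCell_mul_p]
    · rintro σ τ υ ⟨k, rfl⟩ ⟨l, rfl⟩
      exact ⟨l + k, K.powCell_comp l k σ⟩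

/-- The representative of the orbit of a simplex. -/
def orbitRep (hp : 0 < p) (σ : K.Cell) : K.Cell :=
  (Quotient.mk (K.orbitSetoid hp) σ).out

theorem orbitRep_powCell (hp : 0 < p) (k : ℕ) (σ : K.Cell) :
    K.orbitRep hp (K.powCell k σ) = K.orbitRep hp σ := by
  unfold orbitRep
  congr 1
  exact (Quotient.sound (s := K.orbitSetoid hp) ⟨k, rfl⟩).symm

theorem exists_powCell_eq_orbitRep (hp : 0 < p) (σ : K.Cell) :
    ∃ k, K.orbitRep hp σ = K.powCell k σ :=
  (K.orbitSetoid hp).symm (Quotient.mk_out (s := K.orbitSetoid hp) σ)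

theorem powCell_mod (k : ℕ) (σ : K.Cell) : K.powCell (k % p) σ = K.powCell k σ := by
  conv_rhs => rw [← Nat.mod_add_div k p, ← powCell_comp, mul_comm, powCell_mul_p]

theorem powCell_inj {σ : K.Cell} (hσ : σ.1.Nonempty) {i j : ℕ} (hi : i < p) (hj : j < p)
    (h : K.powCell i σ = K.powCell j σ) : i = j := by
  wlog hij : i ≤ j generalizing i j
  · exact (this hj hi h.symm (le_of_not_ge hij)).symm
  by_contra hne
  have hmem : σ.1 ∈ K.faces := σ.2.resolve_left hσ.ne_empty
  have h2 : K.powCell (j - i) σ = σ := by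
    have h1 := congrArg (K.powCell (p - i)) h
    rw [powCell_comp, powCell_comp, Nat.sub_add_cancel hi.le, powCell_p,
      show p - i + j = (j - i) + p by omega, ← powCell_comp, powCell_p] at h1
    exact h1.symm
  refine K.simple σ.1 hmem (j - i) (fun hd => ?_) (congrArg Subtype.val h2)
  have := Nat.le_of_dvd (by omega) hd
  omega

/-- The projection onto the chains supported in a fundamental domain. -/
def fundProj (hp : 0 < p) (R : Type*) [CommRing R] : Module.End R (K.AugChain R) :=
  Finsupp.linearCombination R fun σ =>
    haveI := Classical.dec (K.orbitRep hp σ = σ)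
    if K.orbitRep hp σ = σ then K.gen R σ else 0

theorem fundProj_gen (hp : 0 < p) (σ : K.Cell) [Decidable (K.orbitRep hp σ = σ)] :
    K.fundProj hp R (K.gen R σ) = if K.orbitRep hp σ = σ then K.gen R σ else 0 := by
  simp only [fundProj, gen, Finsupp.linearCombination_single, one_smul]
  congr

variable {K} in
theorem fundProj_mem (hp : 0 < p) {n : ℕ} {x : K.AugChain R} (hx : x ∈ K.H R n) :
    K.fundProj hp R x ∈ K.H R n := by
  classical
  refine maps_H (fun σ hσ => ?_) hx
  rw [fundProj_gen]
  split_ifs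
  · exact gen_mem hσ
  · exact Submodule.zero_mem _

/-- By freeness exactly one power t^k with k < p carries a nonempty simplex to the representative of
its orbit, so only one summand survives. On the empty simplex all p summands survive, hence the
degree n + 1. -/
theorem sum_conj_fundProj (hp : 0 < p) {n : ℕ} {x : K.AugChain R} (hx : x ∈ K.H R (n + 1)) :
    ∑ k ∈ Finset.range p, (K.T R ^ (p - k)) (K.fundProj hp R ((K.T R ^ k) x)) = x := by
  classical
  have key := eqOn_H (f := ∑ k ∈ Finset.range p, K.T R ^ (p - k) * K.fundProj hp R * K.T R ^ k)
    (g := 1) (fun σ hσ => ?_) hx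
  · rw [LinearMap.sum_apply] at key
    exact key
  · rw [LinearMap.sum_apply]
    obtain ⟨k, hk⟩ := K.exists_powCell_eq_orbitRep hp σ
    have hne : σ.1.Nonempty := Finset.card_pos.1 (by omega)
    have hkp : k % p < p := Nat.mod_lt _ hp
    rw [← powCell_mod] at hk
    rw [Finset.sum_eq_single_of_mem (k % p) (Finset.mem_range.2 hkp)]
    · rw [Module.End.mul_apply, Module.End.mul_apply]
      have h1 : K.fundProj hp R ((K.T R ^ (k % p)) (K.gen R σ)) = (K.T R ^ (k % p)) (K.gen R σ) := by
        rw [T_pow_gen, map_smul, fundProj_gen, orbitRep_powCell, if_pos hk]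
      rw [h1, ← Module.End.mul_apply, ← pow_add, Nat.sub_add_cancel hkp.le, T_pow_p]
    · intro j hj hjk
      rw [Module.End.mul_apply, Module.End.mul_apply]
      have h1 : K.fundProj hp R ((K.T R ^ j) (K.gen R σ)) = 0 := by
        rw [T_pow_gen, map_smul, fundProj_gen, orbitRep_powCell, if_neg, smul_zero]
        intro h
        exact hjk (K.powCell_inj hne (Finset.mem_range.1 hj) hkp (h.symm.trans hk))
      rw [h1, map_zero]

/-- Contracting homotopies for the pair `d`, `s`. -/
theorem exists_contraction (hp : 0 < p) (R : Type*) [CommRing R] :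
    ∃ π h h' : Module.End R (K.AugChain R),
      (∀ n, ∀ x ∈ K.H R n, π x ∈ K.H R n ∧ h x ∈ K.H R n ∧ h' x ∈ K.H R n) ∧
      (∀ n, ∀ x ∈ K.H R (n + 1),
        π (K.augOp R .s x) + K.augOp R .d (h x) = x ∧
        K.augOp R .s (π x) + h' (K.augOp R .d x) = x) := by
  set π := K.fundProj hp R with hπ
  refine ⟨π, -∑ k ∈ Finset.range p, (∑ j ∈ Finset.range (p - k), K.T R ^ j) * π * K.T R ^ k,
    -∑ k ∈ Finset.range p, K.T R ^ (p - k) * π * (∑ j ∈ Finset.range k, K.T R ^ j),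
    fun n x hx => ⟨fundProj_mem hp hx, ?_, ?_⟩, fun n x hx => ⟨?_, ?_⟩⟩
  · rw [LinearMap.neg_apply, LinearMap.sum_apply]
    refine Submodule.neg_mem _ (Submodule.sum_mem _ fun k _ => ?_)
    rw [Module.End.mul_apply, Module.End.mul_apply, LinearMap.sum_apply]
    exact Submodule.sum_mem _ fun j _ => T_pow_mem _ (fundProj_mem hp (T_pow_mem _ hx))
  · rw [LinearMap.neg_apply, LinearMap.sum_apply]
    refine Submodule.neg_mem _ (Submodule.sum_mem _ fun k _ => ?_)
    rw [Module.End.mul_apply, Module.End.mul_apply, LinearMap.sum_apply]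
    exact T_pow_mem _ (fundProj_mem hp (Submodule.sum_mem _ fun j _ => T_pow_mem _ hx))
  · have := LinearMap.congr_fun (contraction_left (p := p) (K.T R) π) x
    rw [LinearMap.sum_apply] at this
    exact this.trans (K.sum_conj_fundProj hp hx)
  · have := LinearMap.congr_fun (contraction_right K.T_pow_p π) x
    rw [LinearMap.sum_apply] at this
    exact this.trans (K.sum_conj_fundProj hp hx)

variable {K}

theorem exact_chain (hp : 0 < p) {n : ℕ} (ρ : Special) {x : K.AugChain R} (hx : x ∈ K.H R (n + 1))
    (h : K.augOp R ρ x = 0) : ∃ y ∈ K.H R (n + 1), x = K.augOp R ρ.bar y := by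
  obtain ⟨π, k, k', hmem, hid⟩ := K.exists_contraction hp R
  cases ρ with
  | d =>
    refine ⟨π x, (hmem _ x hx).1, ?_⟩
    have := (hid n x hx).2
    rw [h, map_zero, add_zero] at this
    exact this.symm
  | s =>
    refine ⟨k x, (hmem _ x hx).2.1, ?_⟩
    have := (hid n x hx).1
    rw [h, map_zero, zero_add] at this
    exact this.symm

/-- The homotopies of the chains are composed with G. The homotopies exist over every commutative
ring, so this serves both the integral and the mod p arguments. -/
theorem exact_cochain (hp : 0 < p) {n : ℕ} (ρ : Special) (G : K.AugChain R →ₗ[R] R)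
    (h : ∀ x ∈ K.H R (n + 1), G (K.augOp R ρ x) = 0) :
    ∃ G' : K.AugChain R →ₗ[R] R, ∀ x ∈ K.H R (n + 1), G x = G' (K.augOp R ρ.bar x) := by
  obtain ⟨π, k, k', hmem, hid⟩ := K.exists_contraction hp R
  cases ρ with
  | d =>
    refine ⟨G ∘ₗ π, fun x hx => ?_⟩
    have := congrArg G (hid n x hx).1
    rw [map_add, h _ (hmem _ x hx).2.1, add_zero] at this
    exact this.symm
  | s =>
    refine ⟨G ∘ₗ k', fun x hx => ?_⟩
    have := congrArg G (hid n x hx).2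
    rw [map_add, h _ (hmem _ x hx).1, zero_add] at this
    exact this.symm

end ZpComplex

end

noncomputable section

namespace ZpComplex

/-! ### Products of chains in a join -/

section

variable {V W : Type*}

/-- The set of vertices of the join with the given parts. -/
def joinSet (σ : Finset V) (τ : Finset W) : Finset (V ⊕ₗ W) :=
  (σ.disjSum τ).map toLex.toEmbedding

theorem joinSet_map_ofLex (σ : Finset V) (τ : Finset W) :
    (joinSet σ τ).map ofLex.toEmbedding = σ.disjSum τ := by
  rw [joinSet, Finset.map_map]
  exact Finset.map_refl

theorem leftPart_joinSet (σ : Finset V) (τ : Finset W) : leftPart (joinSet σ τ) = σ := by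
  rw [leftPart, joinSet_map_ofLex, Finset.toLeft_disjSum]

theorem rightPart_joinSet (σ : Finset V) (τ : Finset W) : rightPart (joinSet σ τ) = τ := by
  rw [rightPart, joinSet_map_ofLex, Finset.toRight_disjSum]

theorem joinSet_leftPart_rightPart (ω : Finset (V ⊕ₗ W)) :
    joinSet (leftPart ω) (rightPart ω) = ω := by
  rw [joinSet, leftPart, rightPart, Finset.toLeft_disjSum_toRight, Finset.map_map]
  exact Finset.map_refl

theorem card_joinSet (σ : Finset V) (τ : Finset W) : (joinSet σ τ).card = σ.card + τ.card := by
  rw [joinSet, Finset.card_map, Finset.card_disjSum]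

theorem sum_joinSet {M : Type*} [AddCommMonoid M] (σ : Finset V) (τ : Finset W)
    (f : V ⊕ₗ W → M) : ∑ x ∈ joinSet σ τ, f x =
      ∑ v ∈ σ, f (toLex (Sum.inl v)) + ∑ w ∈ τ, f (toLex (Sum.inr w)) := by
  rw [joinSet, Finset.sum_map, Finset.sum_disjSum]
  rfl

theorem joinSet_map (g : Equiv.Perm V) (h : Equiv.Perm W) (σ : Finset V) (τ : Finset W) :
    (joinSet σ τ).map (joinPerm g h).toEmbedding =
      joinSet (σ.map g.toEmbedding) (τ.map h.toEmbedding) := by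
  rw [← joinSet_leftPart_rightPart ((joinSet σ τ).map _), leftPart_map, rightPart_map,
    leftPart_joinSet, rightPart_joinSet]

end

variable {p : ℕ} {V W : Type*} [LinearOrder V] [LinearOrder W]

theorem position_joinSet_inl (σ : Finset V) (τ : Finset W) (v : V) :
    position (joinSet σ τ) (toLex (Sum.inl v)) = position σ v := by
  rw [position_eq_sum, position_eq_sum, sum_joinSet]
  simp

theorem position_joinSet_inr (σ : Finset V) (τ : Finset W) (w : W) :
    position (joinSet σ τ) (toLex (Sum.inr w)) = σ.card + position τ w := by
  rw [position_eq_sum, position_eq_sum, sum_joinSet]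
  simp

theorem joinPerm_inl (g : Equiv.Perm V) (h : Equiv.Perm W) (v : V) :
    joinPerm g h (toLex (Sum.inl v)) = toLex (Sum.inl (g v)) := rfl

theorem joinPerm_inr (g : Equiv.Perm V) (h : Equiv.Perm W) (w : W) :
    joinPerm g h (toLex (Sum.inr w)) = toLex (Sum.inr (h w)) := rfl

theorem inversions_joinSet (g : Equiv.Perm V) (h : Equiv.Perm W) (σ : Finset V) (τ : Finset W) :
    inversions (joinPerm g h) (joinSet σ τ) = inversions g σ + inversions h τ := by
  simp only [inversions_eq_sum, sum_joinSet, joinPerm_inl, joinPerm_inr]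
  simp

theorem joinSet_erase_inl (σ : Finset V) (τ : Finset W) (v : V) :
    (joinSet σ τ).erase (toLex (Sum.inl v)) = joinSet (σ.erase v) τ := by
  ext x
  obtain ⟨x, rfl⟩ := toLex.surjective x
  rcases x with x | x <;> simp [joinSet]

theorem joinSet_erase_inr (σ : Finset V) (τ : Finset W) (w : W) :
    (joinSet σ τ).erase (toLex (Sum.inr w)) = joinSet σ (τ.erase w) := by
  ext x
  obtain ⟨x, rfl⟩ := toLex.surjective x
  rcases x with x | x <;> simp [joinSet]

variable (K : ZpComplex p V) (L : ZpComplex p W)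

/-- The join of two simplices. -/
def joinCell (σ : K.Cell) (τ : L.Cell) : (K.join L).Cell :=
  ⟨joinSet σ.1 τ.1, by
    rcases Finset.eq_empty_or_nonempty (joinSet σ.1 τ.1) with h | h
    · exact Or.inl h
    · exact Or.inr ⟨h, by rw [leftPart_joinSet]; exact σ.2, by rw [rightPart_joinSet]; exact τ.2⟩⟩

variable {K L}

/-- The part of a simplex of the join in the first complex. -/
def leftCell (ω : (K.join L).Cell) : K.Cell :=
  ⟨leftPart ω.1, by
    rcases ω.2 with h | h
    · left; rw [h]; rfl
    · exact h.2.1⟩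

/-- The part of a simplex of the join in the second complex. -/
def rightCell (ω : (K.join L).Cell) : L.Cell :=
  ⟨rightPart ω.1, by
    rcases ω.2 with h | h
    · left; rw [h]; rfl
    · exact h.2.2⟩

theorem joinCell_leftCell_rightCell (ω : (K.join L).Cell) :
    K.joinCell L (leftCell ω) (rightCell ω) = ω :=
  Subtype.ext (joinSet_leftPart_rightPart ω.1)

theorem leftCell_joinCell (σ : K.Cell) (τ : L.Cell) : leftCell (K.joinCell L σ τ) = σ :=
  Subtype.ext (leftPart_joinSet _ _)

theorem rightCell_joinCell (σ : K.Cell) (τ : L.Cell) : rightCell (K.joinCell L σ τ) = τ :=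
  Subtype.ext (rightPart_joinSet _ _)

theorem card_joinCell (σ : K.Cell) (τ : L.Cell) :
    (K.joinCell L σ τ).1.card = σ.1.card + τ.1.card := card_joinSet _ _

variable {R : Type*} [CommRing R]

variable (K L R) in
/-- The product of chains with values in the chains of the join. -/
def jmul : K.AugChain R →ₗ[R] L.AugChain R →ₗ[R] (K.join L).AugChain R :=
  Finsupp.linearCombination R fun σ =>
    Finsupp.linearCombination R fun τ => (K.join L).gen R (K.joinCell L σ τ)

theorem jmul_gen (σ : K.Cell) (τ : L.Cell) :
    jmul K L R (K.gen R σ) (L.gen R τ) = (K.join L).gen R (K.joinCell L σ τ) := by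
  simp [jmul]

theorem eqOn_H₂ {M : Type*} [AddCommGroup M] [Module R M] {m n : ℕ}
    {f g : K.AugChain R →ₗ[R] L.AugChain R →ₗ[R] M}
    (h : ∀ (σ : K.Cell) (τ : L.Cell), σ.1.card = m → τ.1.card = n →
      f (K.gen R σ) (L.gen R τ) = g (K.gen R σ) (L.gen R τ))
    {x : K.AugChain R} (hx : x ∈ K.H R m) {y : L.AugChain R} (hy : y ∈ L.H R n) :
    f x y = g x y := by
  have h1 : ∀ σ : K.Cell, σ.1.card = m → f (K.gen R σ) y = g (K.gen R σ) y := fun σ hσ =>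
    eqOn_H (f := f (K.gen R σ)) (g := g (K.gen R σ)) (fun τ hτ => h σ τ hσ hτ) hy
  exact eqOn_H (f := f.flip y) (g := g.flip y) h1 hx

theorem jmul_mem {m n : ℕ} {x : K.AugChain R} (hx : x ∈ K.H R m) {y : L.AugChain R}
    (hy : y ∈ L.H R n) : jmul K L R x y ∈ (K.join L).H R (m + n) := by
  have h1 : ∀ σ : K.Cell, σ.1.card = m → jmul K L R (K.gen R σ) y ∈ (K.join L).H R (m + n) :=
    fun σ hσ => maps_H (f := jmul K L R (K.gen R σ)) (fun τ hτ => by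
      rw [jmul_gen]; exact gen_mem (by rw [card_joinCell, hσ, hτ])) hy
  exact maps_H (f := (jmul K L R).flip y) h1 hx

theorem T_jmul (x : K.AugChain R) (y : L.AugChain R) :
    (K.join L).T R (jmul K L R x y) = jmul K L R (K.T R x) (L.T R y) := by
  suffices h : (jmul K L R).compr₂ ((K.join L).T R) = (jmul K L R).compl₁₂ (K.T R) (L.T R) from
    LinearMap.congr_fun (LinearMap.congr_fun h x) y
  refine Finsupp.lhom_ext' fun σ => LinearMap.ext_ring (Finsupp.lhom_ext' fun τ =>
    LinearMap.ext_ring ?_)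
  show (K.join L).T R (jmul K L R (K.gen R σ) (L.gen R τ)) =
    jmul K L R (K.T R (K.gen R σ)) (L.T R (L.gen R τ))
  rw [jmul_gen, T_gen, T_gen, T_gen, map_smul, map_smul, LinearMap.smul_apply, smul_smul,
    jmul_gen, ← pow_add, add_comm]
  have h1 : inversions (K.join L).t (K.joinCell L σ τ).1 = inversions K.t σ.1 + inversions L.t τ.1 :=
    inversions_joinSet _ _ _ _
  have h2 : (K.join L).powCell 1 (K.joinCell L σ τ) = K.joinCell L (K.powCell 1 σ) (L.powCell 1 τ) :=
    Subtype.ext (joinSet_map _ _ _ _)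
  rw [h1, h2]

theorem T_pow_jmul (k : ℕ) (x : K.AugChain R) (y : L.AugChain R) :
    ((K.join L).T R ^ k) (jmul K L R x y) = jmul K L R ((K.T R ^ k) x) ((L.T R ^ k) y) := by
  induction k with
  | zero => simp
  | succ k ih =>
    rw [pow_succ', Module.End.mul_apply, ih, T_jmul, pow_succ', pow_succ']
    rfl

/-- The Leibniz rule. All vertices of K precede those of L, so removing a vertex of L picks up one
sign for each of the m vertices of the first factor; m is the number of vertices, not the dimension.
-/
theorem bd_jmul {m : ℕ} {x : K.AugChain R} (hx : x ∈ K.H R m) (y : L.AugChain R) :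
    (K.join L).bd R (jmul K L R x y) =
      jmul K L R (K.bd R x) y + (-1 : R) ^ m • jmul K L R x (L.bd R y) := by
  have key : ∀ σ : K.Cell, σ.1.card = m → (K.join L).bd R ∘ₗ jmul K L R (K.gen R σ) =
      jmul K L R (K.bd R (K.gen R σ)) + (-1 : R) ^ m • (jmul K L R (K.gen R σ) ∘ₗ L.bd R) := by
    intro σ hσ
    refine Finsupp.lhom_ext' fun τ => LinearMap.ext_ring ?_
    show (K.join L).bd R (jmul K L R (K.gen R σ) (L.gen R τ)) =
      jmul K L R (K.bd R (K.gen R σ)) (L.gen R τ) +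
        (-1 : R) ^ m • jmul K L R (K.gen R σ) (L.bd R (L.gen R τ))
    rw [jmul_gen, bd_gen, bd_gen, bd_gen]
    show ∑ v ∈ joinSet σ.1 τ.1, (-1 : R) ^ position (joinSet σ.1 τ.1) v •
      (K.join L).gen R ((K.join L).eraseCell (K.joinCell L σ τ) v) = _
    rw [sum_joinSet, map_sum, LinearMap.sum_apply, map_sum, Finset.smul_sum]
    congr 1
    · refine Finset.sum_congr rfl fun v _ => ?_
      rw [map_smul, LinearMap.smul_apply, jmul_gen, position_joinSet_inl]
      congr 3
      exact Subtype.ext (joinSet_erase_inl _ _ _)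
    · refine Finset.sum_congr rfl fun v _ => ?_
      rw [map_smul, jmul_gen, position_joinSet_inr, smul_smul, pow_add, hσ]
      congr 3
      exact Subtype.ext (joinSet_erase_inr _ _ _)
  exact eqOn_H (f := (K.join L).bd R ∘ₗ (jmul K L R).flip y)
    (g := (jmul K L R).flip y ∘ₗ K.bd R + (-1 : R) ^ m • (jmul K L R).flip (L.bd R y))
    (fun σ hσ => LinearMap.congr_fun (key σ hσ) y) hx

/-- Linear maps on chains of a join are determined by their values on products. -/
theorem eqOn_join_H {M : Type*} [AddCommGroup M] [Module R M] {N : ℕ}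
    {f g : (K.join L).AugChain R →ₗ[R] M}
    (h : ∀ m n, m + n = N → ∀ x ∈ K.H R m, ∀ y ∈ L.H R n, f (jmul K L R x y) = g (jmul K L R x y))
    {x : (K.join L).AugChain R} (hx : x ∈ (K.join L).H R N) : f x = g x := by
  refine eqOn_H (fun ω hω => ?_) hx
  have := h (leftCell ω).1.card (rightCell ω).1.card
    (by rw [← card_joinCell, joinCell_leftCell_rightCell, hω]) _ (K.gen_mem_H _) _ (L.gen_mem_H _)
  rwa [jmul_gen, joinCell_leftCell_rightCell] at this

/-- Invariant factors can be moved out of `ρ`. -/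
theorem augOp_jmul_of_left_invariant (ρ : Special) {x : K.AugChain R} (hx : K.T R x = x)
    (y : L.AugChain R) :
    (K.join L).augOp R ρ (jmul K L R x y) = jmul K L R x (L.augOp R ρ y) := by
  have hk : ∀ k, (K.T R ^ k) x = x := fun k => by
    induction k with
    | zero => simp
    | succ k ih => rw [pow_succ, Module.End.mul_apply, hx, ih]
  cases ρ with
  | d => rw [augOp_d_apply, augOp_d_apply, T_jmul, hx, map_sub]
  | s =>
    rw [augOp_s_apply, augOp_s_apply, map_sum]
    exact Finset.sum_congr rfl fun k _ => by rw [T_pow_jmul, hk]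

theorem augOp_jmul_of_right_invariant (ρ : Special) (x : K.AugChain R) {y : L.AugChain R}
    (hy : L.T R y = y) :
    (K.join L).augOp R ρ (jmul K L R x y) = jmul K L R (K.augOp R ρ x) y := by
  have hk : ∀ k, (L.T R ^ k) y = y := fun k => by
    induction k with
    | zero => simp
    | succ k ih => rw [pow_succ, Module.End.mul_apply, hy, ih]
  cases ρ with
  | d => rw [augOp_d_apply, augOp_d_apply, T_jmul, hy, map_sub, LinearMap.sub_apply]
  | s =>
    rw [augOp_s_apply, augOp_s_apply, map_sum, LinearMap.sum_apply]
    exact Finset.sum_congr rfl fun k _ => by rw [T_pow_jmul, hk]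

end ZpComplex

end

noncomputable section

namespace Special

theorem parity_succ (j : ℕ) : parity (j + 1) = (parity j).bar := by
  unfold parity
  rcases Nat.even_or_odd j with h | h
  · rw [if_pos h, if_neg (Nat.not_even_iff_odd.2 h.add_one)]; rfl
  · rw [if_neg (Nat.not_even_iff_odd.2 h), if_pos h.add_one]; rfl

theorem parity_even {j : ℕ} (h : Even j) : parity j = d := if_pos h

theorem parity_odd {j : ℕ} (h : Odd j) : parity j = s :=
  if_neg (Nat.not_even_iff_odd.2 h)

theorem bar_bar (ρ : Special) : ρ.bar.bar = ρ := by cases ρ <;> rfl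

end Special

namespace ZpComplex

open Special

variable {p : ℕ} {V : Type*} [LinearOrder V] (K : ZpComplex p V) (R : Type*) [CommRing R]

/-! ### Comparison of graded and ungraded cochains -/

variable {K} in
/-- A simplex as a cell. -/
def cellOf {j : ℕ} (σ : K.Simplex j) : K.Cell := ⟨σ.1, Or.inr σ.2.1⟩

/-- The inclusion of chains into augmented chains. -/
def incl (j : ℕ) : K.Chain j →ₗ[ℤ] K.AugChain R :=
  Finsupp.linearCombination ℤ fun σ => K.gen R (cellOf σ)

variable {R}

theorem incl_single {j : ℕ} (σ : K.Simplex j) :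
    K.incl R j (Finsupp.single σ 1) = K.gen R (cellOf σ) := by
  simp [incl]

variable {K} in
theorem chain_hom_ext {j : ℕ} {M : Type*} [AddCommGroup M] {f g : K.Chain j →ₗ[ℤ] M}
    (h : ∀ σ, f (Finsupp.single σ 1) = g (Finsupp.single σ 1)) : f = g :=
  Finsupp.lhom_ext' fun σ => LinearMap.ext_ring (h σ)

theorem incl_mem {j : ℕ} (x : K.Chain j) : K.incl R j x ∈ K.H R (j + 1) := by
  induction x using Finsupp.induction_linear with
  | zero => rw [map_zero]; exact Submodule.zero_mem _
  | add x y hx hy => rw [map_add]; exact Submodule.add_mem _ hx hy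
  | single σ c =>
    rw [← mul_one c, ← smul_eq_mul, ← Finsupp.smul_single, map_smul, incl_single]
    exact zsmul_mem (gen_mem σ.2.2) c

theorem incl_boundary {j : ℕ} (x : K.Chain (j + 1)) :
    K.incl R j (K.boundary j x) = K.bd R (K.incl R (j + 1) x) := by
  suffices h : K.incl R j ∘ₗ K.boundary j =
      (K.bd R).toAddMonoidHom.toIntLinearMap ∘ₗ K.incl R (j + 1) from LinearMap.congr_fun h x
  refine chain_hom_ext fun σ => ?_
  show K.incl R j (K.boundary j (Finsupp.single σ 1)) =
    K.bd R (K.incl R (j + 1) (Finsupp.single σ 1))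
  rw [incl_single, bd_gen, boundary, Finsupp.linearCombination_single, one_smul, map_sum]
  show _ = ∑ v ∈ σ.1, _
  rw [← Finset.sum_attach σ.1]
  refine Finset.sum_congr rfl fun v _ => ?_
  rw [map_smul, incl_single]
  show ((-1 : ℤ) ^ position σ.1 v.1) • K.gen R (K.eraseCell (cellOf σ) v.1) = _
  rw [← Int.cast_smul_eq_zsmul R]
  simp
  rfl

theorem incl_tChain {j : ℕ} (x : K.Chain j) :
    K.incl R j (K.tChain j x) = K.T R (K.incl R j x) := by
  suffices h : K.incl R j ∘ₗ K.tChain j =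
      (K.T R).toAddMonoidHom.toIntLinearMap ∘ₗ K.incl R j from LinearMap.congr_fun h x
  refine chain_hom_ext fun σ => ?_
  show K.incl R j (K.tChain j (Finsupp.single σ 1)) = K.T R (K.incl R j (Finsupp.single σ 1))
  rw [incl_single, T_gen, tChain, Finsupp.linearCombination_single, one_smul, map_smul, incl_single,
    ← Int.cast_smul_eq_zsmul R]
  have : cellOf (K.act σ) = K.powCell 1 (cellOf σ) :=
    Subtype.ext (by simp [cellOf, act, powCell])
  rw [this]
  simp
  rfl

theorem incl_op {j : ℕ} (ρ : Special) (x : K.Chain j) :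
    K.incl R j (K.op j ρ x) = K.augOp R ρ (K.incl R j x) := by
  cases ρ with
  | d => rw [augOp_d_apply, ← incl_tChain, ← map_sub]; rfl
  | s =>
    have hk : ∀ k, K.incl R j ((K.tChain j ^ k) x) = (K.T R ^ k) (K.incl R j x) := fun k => by
      induction k with
      | zero => simp
      | succ k ih => rw [pow_succ', Module.End.mul_apply, incl_tChain, ih, pow_succ']; rfl
    rw [augOp_s_apply]
    simp only [← hk]
    rw [← map_sum, op, LinearMap.sum_apply]

/-- The restriction of a functional on augmented chains to a cochain. -/
def restr (F : K.AugChain R →ₗ[R] R) (j : ℕ) : K.Cochain R j :=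
  F.toAddMonoidHom.toIntLinearMap ∘ₗ K.incl R j

variable {K}

theorem restr_apply (F : K.AugChain R →ₗ[R] R) {j : ℕ} (x : K.Chain j) :
    K.restr F j x = F (K.incl R j x) := rfl

theorem coboundary_restr (F : K.AugChain R →ₗ[R] R) (j : ℕ) :
    K.coboundary R j (K.restr F j) = K.restr (F ∘ₗ K.bd R) (j + 1) := by
  ext x
  exact congrArg F (K.incl_boundary _)

theorem coop_restr (ρ : Special) (F : K.AugChain R →ₗ[R] R) (j : ℕ) :
    K.coop R ρ j (K.restr F j) = K.restr (F ∘ₗ K.augOp R ρ) j := by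
  ext x
  exact congrArg F (K.incl_op ρ _)

theorem exists_cellOf {j : ℕ} {σ : K.Cell} (hσ : σ.1.card = j + 1) : ∃ σ' : K.Simplex j, cellOf σ' = σ :=
  ⟨⟨σ.1, σ.2.resolve_left (fun h => by simp [h] at hσ), hσ⟩, rfl⟩

theorem restr_eq_iff {F G : K.AugChain R →ₗ[R] R} {j : ℕ} :
    K.restr F j = K.restr G j ↔ ∀ x ∈ K.H R (j + 1), F x = G x := by
  constructor
  · intro h x hx
    refine eqOn_H (fun σ hσ => ?_) hx
    obtain ⟨σ', rfl⟩ := exists_cellOf hσ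
    have := LinearMap.congr_fun h (Finsupp.single σ' 1)
    rwa [restr_apply, restr_apply, incl_single] at this
  · intro h
    exact LinearMap.ext fun x => h _ (K.incl_mem x)

theorem exists_restr_eq {j : ℕ} (y : K.Cochain R j) : ∃ F, K.restr F j = y := by
  classical
  refine ⟨Finsupp.linearCombination R fun σ =>
    if h : ∃ σ' : K.Simplex j, cellOf σ' = σ then y (Finsupp.single h.choose 1) else 0,
    chain_hom_ext fun σ => ?_⟩
  have h : ∃ σ' : K.Simplex j, cellOf σ' = cellOf σ := ⟨σ, rfl⟩
  have h2 : h.choose = σ :=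
    Subtype.ext (congrArg (fun τ : K.Cell => τ.1) h.choose_spec)
  rw [restr_apply, incl_single, gen, Finsupp.linearCombination_single, one_smul, dif_pos h, h2]

theorem restr_mem_specialCochains {ρ : Special} {F : K.AugChain R →ₗ[R] R} {j : ℕ} :
    K.restr F j ∈ K.specialCochains R ρ j ↔ ∀ x ∈ K.H R (j + 1), F (K.augOp R ρ x) = 0 := by
  rw [specialCochains, LinearMap.mem_ker, coop_restr]
  exact restr_eq_iff (G := 0)

theorem restr_mem_coboundaries {ρ : Special} {F : K.AugChain R →ₗ[R] R} {j : ℕ} :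
    K.restr F (j + 1) ∈ K.coboundaries R ρ (j + 1) ↔ ∃ G : K.AugChain R →ₗ[R] R,
      (∀ x ∈ K.H R (j + 1), G (K.augOp R ρ x) = 0) ∧ ∀ x ∈ K.H R (j + 2), F x = G (K.bd R x) := by
  constructor
  · rintro ⟨y, hy, h⟩
    obtain ⟨G, rfl⟩ := exists_restr_eq y
    refine ⟨G, restr_mem_specialCochains.1 hy, ?_⟩
    rw [coboundary_restr, restr_eq_iff] at h
    exact fun x hx => (h x hx).symm
  · rintro ⟨G, hG, h⟩
    refine ⟨K.restr G j, restr_mem_specialCochains.2 hG, ?_⟩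
    rw [coboundary_restr, restr_eq_iff]
    exact fun x hx => (h x hx).symm

/-! ### Resolutions as functionals on augmented chains -/

/-- A resolution of `1`, as a functional on augmented chains. -/
structure IsAugResolution (F : K.AugChain R →ₗ[R] R) : Prop where
  empty : F (K.gen R K.emptyCell) = 1
  bd : ∀ n, ∀ x ∈ K.H R n, F (K.bd R x) = F (K.augOp R (parity n) x)

/-- A vertex has the empty simplex as its augmented boundary, so the relation for one vertex
together with F(∅) = 1 is the condition sψ₀ = 1. -/
theorem IsAugResolution.isResolution {F : K.AugChain ℤ →ₗ[ℤ] ℤ} (hF : IsAugResolution F) :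
    K.IsResolution fun j => K.restr F j := by
  refine ⟨?_, fun j => ⟨fun hj => ?_, fun hj => ?_⟩⟩
  · rw [coop_restr]
    refine chain_hom_ext fun σ => ?_
    rw [restr_apply, incl_single]
    have h1 : K.gen ℤ (cellOf σ) ∈ K.H ℤ 1 := gen_mem σ.2.2
    have h2 := hF.bd 1 _ h1
    rw [parity_odd odd_one] at h2
    rw [LinearMap.comp_apply, ← h2, bd_gen]
    obtain ⟨v, hv⟩ := Finset.card_eq_one.1 σ.2.2
    have h3 : ∀ w ∈ (cellOf σ).1, (-1 : ℤ) ^ position (cellOf σ).1 w •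
      K.gen ℤ (K.eraseCell (cellOf σ) w) = K.gen ℤ K.emptyCell := by
      intro w hw
      have hw' : w ∈ σ.1 := hw
      rw [hv, Finset.mem_singleton] at hw'
      subst hw'
      have e1 : K.eraseCell (cellOf σ) w = K.emptyCell :=
        Subtype.ext (by show σ.1.erase w = ∅; rw [hv]; simp)
      have e2 : position (cellOf σ).1 w = 0 := by
        show position σ.1 w = 0
        rw [hv]; simp [position]
      rw [e1, e2]; simp
    rw [Finset.sum_congr rfl h3, Finset.sum_const]
    have : (cellOf σ).1.card = 1 := σ.2.2
    rw [this, one_smul, hF.empty, one]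
    simp
  · rw [coop_restr, coboundary_restr, restr_eq_iff]
    intro x hx
    have := hF.bd _ x hx
    rwa [parity_even (j := j + 1 + 1) hj.add_one.add_one] at this
  · rw [coop_restr, coboundary_restr, restr_eq_iff]
    intro x hx
    have := hF.bd _ x hx
    rwa [parity_odd (j := j + 1 + 1) hj.add_one.add_one] at this

theorem bd_gen_of_card_eq_one {σ : K.Cell} (hσ : σ.1.card = 1) :
    K.bd R (K.gen R σ) = K.gen R K.emptyCell := by
  obtain ⟨v, hv⟩ := Finset.card_eq_one.1 hσ
  rw [bd_gen, hv, Finset.sum_singleton]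
  have e1 : K.eraseCell σ v = K.emptyCell := Subtype.ext (by show σ.1.erase v = ∅; rw [hv]; simp)
  have e2 : position ({v} : Finset V) v = 0 := by
    rw [position_eq_sum]; simp
  rw [e1, e2]
  simp

theorem augOp_parity_zero {x : K.AugChain R} (hx : x ∈ K.H R 0) : K.augOp R (parity 0) x = 0 := by
  rw [parity_even Even.zero, augOp_d_apply, sub_eq_zero]
  have := K.T_pow_zero_mem 1 hx
  rw [pow_one] at this
  exact this.symm

theorem exists_isAugResolution {ψ : (j : ℕ) → K.Cochain ℤ j} (hψ : K.IsResolution ψ) :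
    ∃ F : K.AugChain ℤ →ₗ[ℤ] ℤ, IsAugResolution F ∧ ∀ j, K.restr F j = ψ j := by
  classical
  -- Truncated subtraction makes the first condition fail exactly on the empty simplex, which
  -- thereby gets the default value 1 that `empty` requires.
  let F : K.AugChain ℤ →ₗ[ℤ] ℤ := Finsupp.linearCombination ℤ fun σ =>
    if h : σ.1.card - 1 + 1 = σ.1.card ∧ σ.1 ∈ K.faces then
      ψ (σ.1.card - 1) (Finsupp.single ⟨σ.1, h.2, h.1.symm⟩ 1) else 1
  have hr : ∀ j, K.restr F j = ψ j := by
    refine fun j => chain_hom_ext fun σ => ?_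
    rw [restr_apply, incl_single]
    obtain ⟨σ, h1, h2⟩ := σ
    have h3 : j = σ.card - 1 := by omega
    subst h3
    have h : σ.card - 1 + 1 = σ.card ∧ σ ∈ K.faces := ⟨h2.symm, h1⟩
    simp only [F, gen, Finsupp.linearCombination_single, one_smul, cellOf]
    rw [dif_pos h]
  have h0 : F (K.gen ℤ K.emptyCell) = 1 := by
    simp [F, emptyCell]
  refine ⟨F, ⟨h0, fun n x hx => ?_⟩, hr⟩
  rcases n with _ | _ | n
  · rw [bd_zero_mem hx, augOp_parity_zero hx]
  · refine eqOn_H (f := F ∘ₗ K.bd ℤ) (g := F ∘ₗ K.augOp ℤ _) (fun σ hσ => ?_) hx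
    rw [LinearMap.comp_apply, bd_gen_of_card_eq_one hσ, h0, zero_add, parity_odd odd_one]
    have h1 := hψ.1
    rw [← hr, coop_restr] at h1
    obtain ⟨σ', rfl⟩ := exists_cellOf hσ
    have := LinearMap.congr_fun h1 (Finsupp.single σ' 1)
    rw [restr_apply, incl_single] at this
    rw [this, one]; simp
  · rcases Nat.even_or_odd n with hn | hn
    · have h1 := (hψ.2 n).1 hn
      rw [← hr, ← hr, coop_restr, coboundary_restr, restr_eq_iff] at h1
      rw [parity_even hn.add_one.add_one]
      exact h1 x hx
    · have h1 := (hψ.2 n).2 hn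
      rw [← hr, ← hr, coop_restr, coboundary_restr, restr_eq_iff] at h1
      rw [parity_odd hn.add_one.add_one]
      exact h1 x hx

theorem smithOp_restr (F : K.AugChain ℤ →ₗ[ℤ] ℤ) (j : ℕ) :
    K.smithOp j (K.restr F j) = K.restr (F ∘ₗ K.augOp ℤ (parity (j + 1))) j := by
  rw [smithOp, coop_restr, parity_succ]

theorem IsAugResolution.smithOp_mem {F : K.AugChain ℤ →ₗ[ℤ] ℤ} (hF : IsAugResolution F) (j : ℕ) :
    K.smithOp j (K.restr F j) ∈ K.cocycles ℤ (parity j) j := by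
  rw [smithOp_restr]
  refine ⟨restr_mem_specialCochains.2 fun x hx => ?_, ?_⟩
  · rw [LinearMap.comp_apply, parity_succ, augOp_bar, map_zero]
  · show K.coboundary ℤ j _ = 0
    rw [coboundary_restr]
    refine restr_eq_iff (G := 0).2 fun x hx => ?_
    rw [LinearMap.comp_apply, LinearMap.comp_apply, ← hF.bd _ _ (bd_mem hx), bd_bd_apply, map_zero]
    rfl

theorem isSmithClass_zero_iff {j : ℕ} : K.IsSmithClass j 0 ↔
    ∃ F : K.AugChain ℤ →ₗ[ℤ] ℤ, IsAugResolution F ∧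
      K.smithOp j (K.restr F j) ∈ K.coboundaries ℤ (parity j) j := by
  constructor
  · rintro ⟨ψ, hψ, h, ha⟩
    obtain ⟨F, hF, hr⟩ := exists_isAugResolution hψ
    refine ⟨F, hF, ?_⟩
    rw [hr]
    exact ((Submodule.Quotient.mk_eq_zero
      ((K.coboundaries ℤ (parity j) j).submoduleOf (K.cocycles ℤ (parity j) j))).1 ha.symm :)
  · rintro ⟨F, hF, h⟩
    exact ⟨_, hF.isResolution, hF.smithOp_mem j, ((Submodule.Quotient.mk_eq_zero
      ((K.coboundaries ℤ (parity j) j).submoduleOf (K.cocycles ℤ (parity j) j))).2 h).symm⟩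

theorem isSmithClass_mod_iff {q j : ℕ} :
    (∃ a, K.IsSmithClass j a ∧ K.cohomologyReduce q j (parity j) a = 0) ↔
    ∃ F : K.AugChain ℤ →ₗ[ℤ] ℤ, IsAugResolution F ∧
      K.reduce q j (K.smithOp j (K.restr F j)) ∈ K.coboundaries (ZMod q) (parity j) j := by
  constructor
  · rintro ⟨a, ⟨ψ, hψ, h, rfl⟩, ha⟩
    obtain ⟨F, hF, hr⟩ := exists_isAugResolution hψ
    refine ⟨F, hF, ?_⟩
    rw [hr]
    exact ((Submodule.Quotient.mk_eq_zero ((K.coboundaries (ZMod q) (parity j) j).submoduleOf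
      (K.cocycles (ZMod q) (parity j) j))).1 ha :)
  · rintro ⟨F, hF, h⟩
    exact ⟨_, ⟨_, hF.isResolution, hF.smithOp_mem j, rfl⟩,
      (Submodule.Quotient.mk_eq_zero ((K.coboundaries (ZMod q) (parity j) j).submoduleOf
        (K.cocycles (ZMod q) (parity j) j))).2 h⟩

theorem isSmithClass_zero_mod {q j : ℕ} (h : K.IsSmithClass j 0) :
    ∃ a, K.IsSmithClass j a ∧ K.cohomologyReduce q j (parity j) a = 0 :=
  ⟨0, h, map_zero _⟩

end ZpComplex

end

noncomputable section

namespace ZpComplex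

open Special

variable {p : ℕ} {V : Type*} [LinearOrder V] {K : ZpComplex p V} {R : Type*} [CommRing R]

/-! ### Reduction of coefficients -/

variable (K) in
/-- The reduction of augmented chains. -/
def red (q : ℕ) : K.AugChain ℤ →ₗ[ℤ] K.AugChain (ZMod q) :=
  Finsupp.linearCombination ℤ fun σ => K.gen (ZMod q) σ

/-- The reduction of a functional. -/
def redF (q : ℕ) (F : K.AugChain ℤ →ₗ[ℤ] ℤ) : K.AugChain (ZMod q) →ₗ[ZMod q] ZMod q :=
  Finsupp.linearCombination (ZMod q) fun σ => ((F (K.gen ℤ σ) : ℤ) : ZMod q)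

theorem red_gen (q : ℕ) (σ : K.Cell) : K.red q (K.gen ℤ σ) = K.gen (ZMod q) σ := by
  simp [red]

theorem augChain_hom_ext {M : Type*} [AddCommGroup M] {f g : K.AugChain ℤ →ₗ[ℤ] M}
    (h : ∀ σ, f (K.gen ℤ σ) = g (K.gen ℤ σ)) : f = g :=
  Finsupp.lhom_ext' fun σ => LinearMap.ext_ring (h σ)

theorem redF_red (q : ℕ) (F : K.AugChain ℤ →ₗ[ℤ] ℤ) (x : K.AugChain ℤ) :
    redF q F (K.red q x) = (F x : ZMod q) := by
  suffices h : (redF q F).toAddMonoidHom.toIntLinearMap ∘ₗ K.red q =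
      (Int.castAddHom (ZMod q)).toIntLinearMap ∘ₗ F from LinearMap.congr_fun h x
  refine augChain_hom_ext fun σ => ?_
  show redF q F (K.red q (K.gen ℤ σ)) = ((F (K.gen ℤ σ) : ℤ) : ZMod q)
  rw [red_gen]; simp [redF]

theorem red_T (q : ℕ) (x : K.AugChain ℤ) : K.red q (K.T ℤ x) = K.T (ZMod q) (K.red q x) := by
  suffices h : K.red q ∘ₗ K.T ℤ = (K.T (ZMod q)).toAddMonoidHom.toIntLinearMap ∘ₗ K.red q from
    LinearMap.congr_fun h x
  refine augChain_hom_ext fun σ => ?_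
  show K.red q (K.T ℤ (K.gen ℤ σ)) = K.T (ZMod q) (K.red q (K.gen ℤ σ))
  rw [red_gen, T_gen, T_gen, map_smul, red_gen, ← Int.cast_smul_eq_zsmul (ZMod q)]
  simp

theorem red_bd (q : ℕ) (x : K.AugChain ℤ) : K.red q (K.bd ℤ x) = K.bd (ZMod q) (K.red q x) := by
  suffices h : K.red q ∘ₗ K.bd ℤ = (K.bd (ZMod q)).toAddMonoidHom.toIntLinearMap ∘ₗ K.red q from
    LinearMap.congr_fun h x
  refine augChain_hom_ext fun σ => ?_
  show K.red q (K.bd ℤ (K.gen ℤ σ)) = K.bd (ZMod q) (K.red q (K.gen ℤ σ))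
  rw [red_gen, bd_gen, bd_gen, map_sum]
  refine Finset.sum_congr rfl fun v _ => ?_
  rw [map_smul, red_gen, ← Int.cast_smul_eq_zsmul (ZMod q)]
  simp

theorem red_T_pow (q k : ℕ) (x : K.AugChain ℤ) :
    K.red q ((K.T ℤ ^ k) x) = (K.T (ZMod q) ^ k) (K.red q x) := by
  induction k with
  | zero => simp
  | succ k ih => rw [pow_succ', pow_succ', Module.End.mul_apply, red_T, ih]; rfl

theorem red_augOp (q : ℕ) (ρ : Special) (x : K.AugChain ℤ) :
    K.red q (K.augOp ℤ ρ x) = K.augOp (ZMod q) ρ (K.red q x) := by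
  cases ρ with
  | d => rw [augOp_d_apply, augOp_d_apply, map_sub, red_T]
  | s =>
    rw [augOp_s_apply, augOp_s_apply, map_sum]
    exact Finset.sum_congr rfl fun k _ => red_T_pow q k x

theorem red_mem {q n : ℕ} {x : K.AugChain ℤ} (hx : x ∈ K.H ℤ n) : K.red q x ∈ K.H (ZMod q) n := by
  rw [H, Finsupp.supported_eq_span_single] at hx
  refine Submodule.span_le (p := ((K.H (ZMod q) n).restrictScalars ℤ).comap (K.red q)) |>.2 ?_ hx
  rintro _ ⟨σ, hσ, rfl⟩
  show K.red q (K.gen ℤ σ) ∈ K.H (ZMod q) n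
  rw [red_gen]
  exact gen_mem hσ

theorem red_eq_zero {q : ℕ} (x : K.AugChain ℤ) : K.red q ((q : ℤ) • x) = 0 := by
  rw [map_smul, ← Int.cast_smul_eq_zsmul (ZMod q)]
  simp

theorem reduce_restr (q j : ℕ) (F : K.AugChain ℤ →ₗ[ℤ] ℤ) :
    K.reduce q j (K.restr F j) = K.restr (redF q F) j := by
  refine chain_hom_ext fun σ => ?_
  rw [restr_apply, incl_single, ← red_gen, redF_red, ← incl_single]
  rfl

theorem redF_comp (q : ℕ) (F : K.AugChain ℤ →ₗ[ℤ] ℤ) (f : Module.End ℤ (K.AugChain ℤ))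
    (f' : Module.End (ZMod q) (K.AugChain (ZMod q))) (h : ∀ x, K.red q (f x) = f' (K.red q x)) :
    redF q (F ∘ₗ f) = redF q F ∘ₗ f' := by
  refine Finsupp.lhom_ext' fun σ => LinearMap.ext_ring ?_
  show redF q (F ∘ₗ f) (K.gen (ZMod q) σ) = redF q F (f' (K.gen (ZMod q) σ))
  rw [← red_gen, ← h, redF_red, redF_red, LinearMap.comp_apply]

theorem exists_redF_eq {q : ℕ} (G : K.AugChain (ZMod q) →ₗ[ZMod q] ZMod q) :
    ∃ F, redF q F = G := by
  choose f hf using fun σ => ZMod.intCast_surjective (G (K.gen (ZMod q) σ))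
  refine ⟨Finsupp.linearCombination ℤ f, Finsupp.lhom_ext' fun σ => LinearMap.ext_ring ?_⟩
  show redF q _ (K.gen (ZMod q) σ) = G (K.gen (ZMod q) σ)
  rw [← red_gen, redF_red, red_gen, ← hf]
  simp

theorem IsAugResolution.redF {F : K.AugChain ℤ →ₗ[ℤ] ℤ} (hF : IsAugResolution F) (q : ℕ) :
    IsAugResolution (redF q F) := by
  refine ⟨by rw [← red_gen, redF_red, hF.empty, Int.cast_one], fun n x hx => ?_⟩
  refine eqOn_H (f := ZpComplex.redF q F ∘ₗ K.bd _) (g := ZpComplex.redF q F ∘ₗ K.augOp _ _)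
    (fun σ hσ => ?_) hx
  rw [LinearMap.comp_apply, LinearMap.comp_apply, ← red_gen, ← red_bd, ← red_augOp, redF_red,
    redF_red, hF.bd n _ (gen_mem hσ)]

/-! ### Extension of partial resolutions -/

/-- The functional with prescribed restrictions to the chains of each dimension. -/
def glue (c : ℕ → K.AugChain R →ₗ[R] R) : K.AugChain R →ₗ[R] R :=
  Finsupp.linearCombination R fun σ => c σ.1.card (K.gen R σ)

theorem glue_apply (c : ℕ → K.AugChain R →ₗ[R] R) {n : ℕ} {x : K.AugChain R} (hx : x ∈ K.H R n) :
    glue c x = c n x :=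
  eqOn_H (fun σ hσ => by simp [glue, hσ]) hx

/-- A resolution of `1` in dimensions less than `M`. -/
structure IsPartialResolution (M : ℕ) (F : K.AugChain R →ₗ[R] R) : Prop where
  empty : F (K.gen R K.emptyCell) = 1
  bd : ∀ n ≤ M, ∀ x ∈ K.H R n, F (K.bd R x) = F (K.augOp R (parity n) x)

theorem emptyCell_mem : K.gen R K.emptyCell ∈ K.H R 0 := gen_mem rfl

/-- The obstruction to the next cochain vanishes: F∂ is killed by the previous special element, so
by exactness it factors through the other one. -/
theorem IsPartialResolution.comp_bd_augOp {M : ℕ} {F : K.AugChain R →ₗ[R] R}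
    (hF : IsPartialResolution M F) {x : K.AugChain R} (hx : x ∈ K.H R (M + 1)) :
    F (K.bd R (K.augOp R (parity M) x)) = 0 := by
  rw [bd_augOp, ← hF.bd M le_rfl _ (bd_mem hx), bd_bd_apply, map_zero]

theorem IsPartialResolution.glue_next {M : ℕ} {F G : K.AugChain R →ₗ[R] R}
    (hF : IsPartialResolution M F)
    (hG : ∀ x ∈ K.H R (M + 1), F (K.bd R x) = G (K.augOp R (parity (M + 1)) x)) :
    IsPartialResolution (M + 1) (glue fun n => if n ≤ M then F else G) := by
  refine ⟨?_, fun n hn x hx => ?_⟩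
  · rw [glue_apply _ emptyCell_mem, if_pos (Nat.zero_le _), hF.empty]
  · rcases n with _ | n
    · rw [bd_zero_mem hx, augOp_parity_zero hx]
    · rw [glue_apply _ (bd_mem hx), glue_apply _ (augOp_mem _ hx), if_pos (by omega)]
      by_cases h : n + 1 ≤ M
      · rw [if_pos h, hF.bd _ h x hx]
      · rw [if_neg h]
        obtain rfl : n = M := by omega
        exact hG x hx

theorem IsPartialResolution.exists_extend (hp : 0 < p) {M : ℕ} {F : K.AugChain R →ₗ[R] R}
    (hF : IsPartialResolution M F) (k : ℕ) :
    ∃ F', IsPartialResolution (M + k) F' ∧ ∀ n ≤ M, ∀ x ∈ K.H R n, F' x = F x := by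
  induction k with
  | zero => exact ⟨F, hF, fun _ _ _ _ => rfl⟩
  | succ k ih =>
    obtain ⟨F', hF', hag⟩ := ih
    obtain ⟨G, hG⟩ := exact_cochain hp (parity (M + k)) (F' ∘ₗ K.bd R)
      (fun x hx => hF'.comp_bd_augOp hx)
    refine ⟨_, hF'.glue_next (G := G) fun x hx => ?_, fun n hn x hx => ?_⟩
    · rw [parity_succ]; exact hG x hx
    · rw [glue_apply _ hx, if_pos (by omega), hag n hn x hx]

theorem H_eq_zero [Fintype V] {n : ℕ} (hn : Fintype.card V < n) {x : K.AugChain R}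
    (hx : x ∈ K.H R n) : x = 0 := by
  refine eqOn_H (f := LinearMap.id) (g := 0) (fun σ hσ => ?_) hx
  have := Finset.card_le_univ σ.1
  omega

/-- There are no chains with more vertices than V has elements, so finitely many extension steps
suffice. -/
theorem IsPartialResolution.exists_isAugResolution [Fintype V] (hp : 0 < p) {M : ℕ}
    {F : K.AugChain R →ₗ[R] R} (hF : IsPartialResolution M F) :
    ∃ F', IsAugResolution F' ∧ ∀ n ≤ M, ∀ x ∈ K.H R n, F' x = F x := by
  obtain ⟨F', hF', hag⟩ := hF.exists_extend hp (Fintype.card V)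
  refine ⟨F', ⟨hF'.empty, fun n x hx => ?_⟩, hag⟩
  by_cases h : n ≤ M + Fintype.card V
  · exact hF'.bd n h x hx
  · rw [H_eq_zero (by omega) hx, map_zero, map_zero, map_zero, map_zero]

theorem exists_resolution [Fintype V] (hp : 0 < p) (K : ZpComplex p V) (R : Type*) [CommRing R] :
    ∃ F : K.AugChain R →ₗ[R] R, IsAugResolution F := by
  -- Only the value on the empty simplex matters here: the relation for n = 0 reads 0 = 0.
  have : IsPartialResolution (K := K) (R := R) 0 (Finsupp.linearCombination R fun _ => (1 : R)) := by
    refine ⟨by simp, fun n hn x hx => ?_⟩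
    obtain rfl : n = 0 := by omega
    rw [bd_zero_mem hx, augOp_parity_zero hx]
  obtain ⟨F, hF, _⟩ := this.exists_isAugResolution hp
  exact ⟨F, hF⟩

theorem IsAugResolution.isPartialResolution {F : K.AugChain R →ₗ[R] R} (hF : IsAugResolution F)
    (M : ℕ) : IsPartialResolution M F := ⟨hF.empty, fun n _ => hF.bd n⟩

/-! ### Criteria for the vanishing of Smith classes -/

theorem isSmithClass_zero_of_vanishing {N : ℕ} {F : K.AugChain ℤ →ₗ[ℤ] ℤ}
    (hF : IsAugResolution F) (h : ∀ x ∈ K.H ℤ (N + 1), F x = 0) : K.IsSmithClass N 0 := by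
  refine isSmithClass_zero_iff.2 ⟨F, hF, ?_⟩
  have : K.restr (F ∘ₗ K.augOp ℤ (parity (N + 1))) N = 0 :=
    restr_eq_iff (G := 0) |>.2 fun x hx => h _ (augOp_mem _ hx)
  rw [smithOp_restr, this]
  exact Submodule.zero_mem _

theorem IsAugResolution.apply_s_gen {F : K.AugChain R →ₗ[R] R} (hF : IsAugResolution F) {σ : K.Cell}
    (hσ : σ.1.card = 1) : F (K.augOp R .s (K.gen R σ)) = 1 := by
  rw [← parity_odd odd_one, ← hF.bd 1 _ (gen_mem hσ), bd_gen_of_card_eq_one hσ, hF.empty]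

/-- The cocycle Fρ agrees with F∂ by the resolution relation, so its triviality means F∂ = G∂ for a
special cochain G. In dimension 0 there are no coboundaries except 0, which is recorded as G = 0;
the empty simplex must not contribute. -/
theorem exists_restr_augOp_eq {j : ℕ} {F : K.AugChain R →ₗ[R] R} (hF : IsAugResolution F)
    (h : K.restr (F ∘ₗ K.augOp R (parity (j + 1))) j ∈ K.coboundaries R (parity j) j) :
    ∃ G : K.AugChain R →ₗ[R] R, (j = 0 → G = 0) ∧ (∀ x ∈ K.H R j, G (K.augOp R (parity j) x) = 0) ∧
      ∀ x ∈ K.H R (j + 1), F (K.bd R x) = G (K.bd R x) := by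
  rcases j with _ | j
  · have h0 : K.restr (F ∘ₗ K.augOp R (parity 1)) 0 = K.restr 0 0 := h
    rw [restr_eq_iff] at h0
    refine ⟨0, fun _ => rfl, fun x hx => rfl, fun x hx => ?_⟩
    rw [hF.bd 1 x hx]
    exact h0 x hx
  · obtain ⟨G, hG, hG'⟩ := restr_mem_coboundaries.1 h
    exact ⟨G, fun h => by omega, hG, fun x hx => by rw [hF.bd _ x hx]; exact hG' x hx⟩

theorem restr_augOp_mem {j : ℕ} {F : K.AugChain R →ₗ[R] R} (hF : IsAugResolution F)
    {G : K.AugChain R →ₗ[R] R} (h0 : j = 0 → G = 0)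
    (hG : ∀ x ∈ K.H R j, G (K.augOp R (parity j) x) = 0)
    (h : ∀ x ∈ K.H R (j + 1), F (K.bd R x) = G (K.bd R x)) :
    K.restr (F ∘ₗ K.augOp R (parity (j + 1))) j ∈ K.coboundaries R (parity j) j := by
  rcases j with _ | j
  · show K.restr (F ∘ₗ K.augOp R (parity 1)) 0 = K.restr 0 0
    rw [restr_eq_iff]
    intro x hx
    rw [LinearMap.comp_apply, ← hF.bd 1 x hx, h x hx, h0 rfl]
    rfl
  · exact restr_mem_coboundaries.2 ⟨G, hG, fun x hx => by
      rw [LinearMap.comp_apply, ← hF.bd _ x hx, h x hx]⟩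

/-- A vertex v would give F(∂v) = F(∅) = 1. So A⁰ vanishes only if there are no vertices at all. -/
theorem IsAugResolution.H_eq_zero [Nontrivial R] {F : K.AugChain R →ₗ[R] R} (hF : IsAugResolution F)
    (h : ∀ x ∈ K.H R 1, F (K.bd R x) = 0) {R' : Type*} [CommRing R'] {n : ℕ} (hn : 0 < n)
    {x : K.AugChain R'} (hx : x ∈ K.H R' n) : x = 0 := by
  refine eqOn_H (f := LinearMap.id) (g := 0) (fun σ hσ => ?_) hx
  exfalso
  obtain ⟨v, hv⟩ := Finset.card_pos.1 (hσ ▸ hn)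
  have hτ := K.cell_of_subset σ.2 (Finset.singleton_subset_iff.2 hv)
  have h2 := h _ (gen_mem (σ := ⟨{v}, hτ⟩) (Finset.card_singleton v))
  rw [bd_gen_of_card_eq_one (Finset.card_singleton v), hF.empty] at h2
  exact one_ne_zero h2

theorem isSmithClass_zero_of_eq {N : ℕ} {F : K.AugChain ℤ →ₗ[ℤ] ℤ}
    (hF : IsAugResolution F) {G : K.AugChain ℤ →ₗ[ℤ] ℤ} (h0 : N = 0 → G = 0)
    (hG : ∀ x ∈ K.H ℤ N, G (K.augOp ℤ (parity N) x) = 0)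
    (h : ∀ x ∈ K.H ℤ (N + 1), F (K.bd ℤ x) = G (K.bd ℤ x)) : K.IsSmithClass N 0 :=
  isSmithClass_zero_iff.2 ⟨F, hF, by rw [smithOp_restr]; exact restr_augOp_mem hF h0 hG h⟩

/-- If the Smith class vanishes, there is a resolution that vanishes from that dimension on. -/
theorem exists_vanishing_of_isSmithClass_zero {N : ℕ} (h : K.IsSmithClass N 0) :
    ∃ F : K.AugChain ℤ →ₗ[ℤ] ℤ, IsAugResolution F ∧ ∀ n, N < n → ∀ x ∈ K.H ℤ n, F x = 0 := by
  obtain ⟨F, hF, h⟩ := isSmithClass_zero_iff.1 h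
  rw [smithOp_restr] at h
  obtain ⟨G, hG0, hG, hG'⟩ := exists_restr_augOp_eq hF h
  by_cases h0 : N = 0
  · subst h0
    obtain rfl := hG0 rfl
    exact ⟨F, hF, fun n hn x hx => by rw [hF.H_eq_zero hG' hn hx, map_zero]⟩
  -- Subtracting the special cochain G on chains with N vertices makes the coboundary there vanish,
  -- so the resolution can be continued by 0.
  · refine ⟨glue fun n => if n < N then F else if n = N then F - G else 0,
      ⟨?_, fun n x hx => ?_⟩, fun n hn x hx => ?_⟩
    · rw [glue_apply _ emptyCell_mem, if_pos (by omega), hF.empty]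
    · rcases n with _ | n
      · rw [bd_zero_mem hx, augOp_parity_zero hx]
      · rw [glue_apply _ (bd_mem hx), glue_apply _ (augOp_mem _ hx)]
        rcases lt_trichotomy (n + 1) N with h | h | h
        · rw [if_pos h, if_pos (by omega), hF.bd _ x hx]
        · subst h
          rw [if_pos (by omega), if_neg (by omega), if_pos rfl, hF.bd _ x hx,
            LinearMap.sub_apply, hG x hx, sub_zero]
        · rw [if_neg (by omega : ¬ n + 1 < N), if_neg (by omega : ¬ n + 1 = N), if_neg (by omega)]
          split_ifs with h'
          · subst h'
            rw [LinearMap.sub_apply, hG' x hx, sub_self]; rfl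
          · rfl
    · rw [glue_apply _ hx, if_neg (by omega), if_neg (by omega)]; rfl

theorem reduce_smithOp_restr (q j : ℕ) (F : K.AugChain ℤ →ₗ[ℤ] ℤ) :
    K.reduce q j (K.smithOp j (K.restr F j)) =
      K.restr (redF q F ∘ₗ K.augOp (ZMod q) (parity (j + 1))) j := by
  rw [smithOp_restr, reduce_restr, redF_comp q F _ _ (red_augOp q _)]

/-- If the Smith class vanishes modulo `p`, there is a resolution that is divisible by `p` in that
dimension. -/
theorem exists_divisible_of_isSmithClass_mod [Fintype V] (hp : p.Prime) {N : ℕ}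
    (h : ∃ a, K.IsSmithClass N a ∧ K.cohomologyReduce p N (parity N) a = 0) :
    ∃ F η : K.AugChain ℤ →ₗ[ℤ] ℤ, IsAugResolution F ∧ ∀ x ∈ K.H ℤ (N + 1), F x = p * η x := by
  have : Fact p.Prime := ⟨hp⟩
  obtain ⟨F, hF, h⟩ := isSmithClass_mod_iff.1 h
  rw [reduce_smithOp_restr] at h
  obtain ⟨G, hG0, hG, hG'⟩ := exists_restr_augOp_eq (hF.redF p) h
  by_cases h0 : N = 0
  · subst h0
    obtain rfl := hG0 rfl
    exact ⟨F, 0, hF, fun x hx => by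
      rw [(hF.redF p).H_eq_zero hG' one_pos hx, map_zero, map_zero, mul_zero]⟩
  · obtain ⟨M, rfl⟩ : ∃ M, N = M + 1 := ⟨N - 1, by omega⟩
    -- A lift of G itself need not be special over ℤ. Writing G as a composite with the
    -- complementary element and lifting the other factor gives an integral cochain E' that is
    -- exactly special.
    obtain ⟨G', hGG'⟩ := exact_cochain hp.pos _ G hG
    obtain ⟨E, rfl⟩ := exists_redF_eq G'
    set E' : K.AugChain ℤ →ₗ[ℤ] ℤ := E ∘ₗ K.augOp ℤ (parity (M + 1)).bar with hE'
    have hmod : ∀ x ∈ K.H ℤ (M + 2), (p : ℤ) ∣ F (K.bd ℤ x) - E' (K.bd ℤ x) := by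
      intro x hx
      rw [← ZMod.intCast_eq_intCast_iff_dvd_sub, hE', LinearMap.comp_apply, ← redF_red, ← redF_red,
        red_augOp, red_bd, ← hGG' _ (bd_mem (red_mem hx)), hG' _ (red_mem hx)]
    set F₁ : K.AugChain ℤ →ₗ[ℤ] ℤ := glue fun n => if n ≤ M then F else F - E' with hF₁
    have hP : IsPartialResolution (M + 1) F₁ := by
      refine (hF.isPartialResolution M).glue_next fun x hx => ?_
      rw [hF.bd _ x hx, LinearMap.sub_apply, hE', LinearMap.comp_apply, augOp_bar, map_zero,
        sub_zero]
    have hdiv : ∀ σ : K.Cell, ∃ c : ℤ, σ.1.card = M + 2 → F₁ (K.bd ℤ (K.gen ℤ σ)) = p * c := by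
      intro σ
      by_cases hσ : σ.1.card = M + 2
      · obtain ⟨c, hc⟩ := hmod _ (gen_mem hσ)
        refine ⟨c, fun _ => ?_⟩
        rw [hF₁, glue_apply _ (bd_mem (gen_mem hσ)), if_neg (by omega), LinearMap.sub_apply, hc]
      · exact ⟨0, fun h => absurd h hσ⟩
    choose χ hχ using hdiv
    set X : K.AugChain ℤ →ₗ[ℤ] ℤ := Finsupp.linearCombination ℤ χ
    have hX : ∀ x ∈ K.H ℤ (M + 2), F₁ (K.bd ℤ x) = p * X x := by
      intro x hx
      refine eqOn_H (f := F₁ ∘ₗ K.bd ℤ) (g := (p : ℤ) • X) (fun σ hσ => ?_) hx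
      rw [LinearMap.comp_apply, hχ σ hσ]
      simp [X]
    have hp0 : (p : ℤ) ≠ 0 := by exact_mod_cast hp.ne_zero
    -- After the correction the coboundary is pX. As ℤ has no p-torsion, X satisfies the exactness
    -- condition itself, so X factors through the next special element and pη is an admissible next
    -- cochain.
    obtain ⟨η, hη⟩ := exact_cochain hp.pos (parity (M + 1)) X fun x hx => by
      have h1 := hP.comp_bd_augOp hx
      rw [hX _ (augOp_mem _ hx)] at h1
      exact (mul_eq_zero.1 h1).resolve_left hp0
    have hP' := hP.glue_next (G := (p : ℤ) • η) fun x hx => by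
      rw [hX x hx, hη x hx, parity_succ (M + 1)]; rfl
    obtain ⟨F₂, hF₂, hag⟩ := hP'.exists_isAugResolution hp.pos
    refine ⟨F₂, η, hF₂, fun x hx => ?_⟩
    rw [hag _ le_rfl x hx, glue_apply _ hx, if_neg (by omega)]
    rfl

/-- The values of `smithIndex` and `smithIndexMod` are attained. -/
theorem exists_isSmithClass_zero [Fintype V] (hp : 0 < p) (K : ZpComplex p V) :
    ∃ N, K.IsSmithClass N 0 := by
  obtain ⟨F, hF⟩ := exists_resolution hp K ℤ
  exact ⟨Fintype.card V, isSmithClass_zero_of_vanishing hF fun x hx => by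
    rw [H_eq_zero (Nat.lt_succ_self _) hx, map_zero]⟩

theorem isSmithClass_smithIndex [Fintype V] (hp : 0 < p) (K : ZpComplex p V) :
    K.IsSmithClass K.smithIndex 0 :=
  Nat.sInf_mem (exists_isSmithClass_zero hp K)

theorem isSmithClass_smithIndexMod [Fintype V] (hp : 0 < p) (K : ZpComplex p V) (q : ℕ) :
    ∃ a, K.IsSmithClass (K.smithIndexMod q) a ∧
      K.cohomologyReduce q _ (parity (K.smithIndexMod q)) a = 0 := by
  obtain ⟨N, hN⟩ := exists_isSmithClass_zero hp K
  exact Nat.sInf_mem (s := {n | ∃ a, K.IsSmithClass n a ∧ K.cohomologyReduce q n (parity n) a = 0})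
    ⟨N, isSmithClass_zero_mod hN⟩

theorem smithIndexMod_le_smithIndex [Fintype V] (hp : 0 < p) (K : ZpComplex p V) (q : ℕ) :
    K.smithIndexMod q ≤ K.smithIndex :=
  Nat.sInf_le (isSmithClass_zero_mod (isSmithClass_smithIndex hp K))

theorem smithIndex_le {N : ℕ} (h : K.IsSmithClass N 0) : K.smithIndex ≤ N := Nat.sInf_le h

end ZpComplex

end

noncomputable section

namespace ZpComplex

open Special

/-! ### Double sums over a triangle -/

section Triangles

variable {R : Type*} [CommRing R] (f g : ℕ → R)

/-- Shifting the triangle k ≤ j along the diagonal changes it only by its last column and its first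
row. This and the next two summations by parts are the identities that make the triangular product
of cochains fit into a resolution. -/
theorem sum_triangle_shift (n : ℕ) :
    ∑ j ∈ Finset.range n, ∑ k ∈ Finset.range (j + 1), (f (k + 1) * g (j + 1) - f k * g j) =
      (∑ k ∈ Finset.range n, f (k + 1)) * g n - f 0 * ∑ j ∈ Finset.range n, g j := by
  induction n with
  | zero => simp
  | succ n ih =>
    rw [Finset.sum_range_succ, ih, Finset.sum_sub_distrib, ← Finset.sum_mul, ← Finset.sum_mul,
      Finset.sum_range_succ' f n, Finset.sum_range_succ (fun k => f (k + 1)) n,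
      Finset.sum_range_succ g n]
    ring

theorem sum_triangle_left (n : ℕ) :
    ∑ j ∈ Finset.range n, ∑ k ∈ Finset.range (j + 1), (f k - f (k + 1)) * g j =
      f 0 * ∑ j ∈ Finset.range n, g j - ∑ j ∈ Finset.range n, f (j + 1) * g j := by
  rw [Finset.mul_sum, ← Finset.sum_sub_distrib]
  refine Finset.sum_congr rfl fun j _ => ?_
  rw [← Finset.sum_mul, Finset.sum_range_sub']
  ring

theorem sum_triangle_right (n : ℕ) :
    ∑ j ∈ Finset.range n, ∑ k ∈ Finset.range (j + 1), f k * (g j - g (j + 1)) =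
      ∑ k ∈ Finset.range n, f k * g k - (∑ k ∈ Finset.range n, f k) * g n := by
  induction n with
  | zero => simp
  | succ n ih =>
    rw [Finset.sum_range_succ, ih, ← Finset.sum_mul, Finset.sum_range_succ f n,
      Finset.sum_range_succ (fun k => f k * g k) n]
    ring

end Triangles

variable {p : ℕ} {V W : Type*} [LinearOrder V] [LinearOrder W] {K : ZpComplex p V}
  {L : ZpComplex p W} {R : Type*} [CommRing R]

/-! ### The join of two resolutions -/

/-- The functional on the chains of a join with prescribed values on products. -/
def joinGlue (c : ℕ → ℕ → K.AugChain R →ₗ[R] L.AugChain R →ₗ[R] R) :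
    (K.join L).AugChain R →ₗ[R] R :=
  Finsupp.linearCombination R fun ω =>
    c (leftCell ω).1.card (rightCell ω).1.card (K.gen R (leftCell ω)) (L.gen R (rightCell ω))

theorem joinGlue_jmul (c : ℕ → ℕ → K.AugChain R →ₗ[R] L.AugChain R →ₗ[R] R) {m n : ℕ}
    {x : K.AugChain R} (hx : x ∈ K.H R m) {y : L.AugChain R} (hy : y ∈ L.H R n) :
    joinGlue c (jmul K L R x y) = c m n x y := by
  refine eqOn_H₂ (f := (jmul K L R).compr₂ (joinGlue c)) (fun σ τ hσ hτ => ?_) hx hy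
  rw [LinearMap.compr₂_apply, jmul_gen, joinGlue, gen, Finsupp.linearCombination_single, one_smul,
    leftCell_joinCell, rightCell_joinCell, hσ, hτ]

/-- The product of two functionals on chains. -/
def prodForm (F : K.AugChain R →ₗ[R] R) (F' : L.AugChain R →ₗ[R] R) :
    K.AugChain R →ₗ[R] L.AugChain R →ₗ[R] R :=
  F.smulRight F'

theorem prodForm_apply (F : K.AugChain R →ₗ[R] R) (F' : L.AugChain R →ₗ[R] R) (x : K.AugChain R)
    (y : L.AugChain R) : prodForm F F' x y = F x * F' y := rfl

/-- The product of cochains of even dimension that enters the join of two resolutions. -/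
def triangleForm (F : K.AugChain R →ₗ[R] R) (F' : L.AugChain R →ₗ[R] R) :
    K.AugChain R →ₗ[R] L.AugChain R →ₗ[R] R :=
  -∑ j ∈ Finset.range p, ∑ k ∈ Finset.range (j + 1),
    prodForm (F ∘ₗ (K.T R ^ k)) (F' ∘ₗ (L.T R ^ j))

theorem triangleForm_apply (F : K.AugChain R →ₗ[R] R) (F' : L.AugChain R →ₗ[R] R)
    (x : K.AugChain R) (y : L.AugChain R) : triangleForm F F' x y =
      -∑ j ∈ Finset.range p, ∑ k ∈ Finset.range (j + 1), F ((K.T R ^ k) x) * F' ((L.T R ^ j) y) := by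
  simp [triangleForm, LinearMap.sum_apply, prodForm_apply]

/-- The products of cochains that enter the join of two resolutions. -/
def joinForm (F : K.AugChain R →ₗ[R] R) (F' : L.AugChain R →ₗ[R] R) (m n : ℕ) :
    K.AugChain R →ₗ[R] L.AugChain R →ₗ[R] R :=
  if Even n then prodForm F F' else if Even m then prodForm (F ∘ₗ K.T R) F' else triangleForm F F'

/-- The join of two functionals. -/
def joinF (F : K.AugChain R →ₗ[R] R) (F' : L.AugChain R →ₗ[R] R) :
    (K.join L).AugChain R →ₗ[R] R := joinGlue (joinForm F F')

section

variable {F : K.AugChain R →ₗ[R] R} {F' : L.AugChain R →ₗ[R] R} {m n : ℕ} {x : K.AugChain R}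
  {y : L.AugChain R}

theorem joinF_of_even (hn : Even n) (hx : x ∈ K.H R m) (hy : y ∈ L.H R n) :
    joinF F F' (jmul K L R x y) = F x * F' y := by
  rw [joinF, joinGlue_jmul _ hx hy, joinForm, if_pos hn, prodForm_apply]

theorem joinF_of_even_odd (hm : Even m) (hn : Odd n) (hx : x ∈ K.H R m) (hy : y ∈ L.H R n) :
    joinF F F' (jmul K L R x y) = F (K.T R x) * F' y := by
  rw [joinF, joinGlue_jmul _ hx hy, joinForm, if_neg (Nat.not_even_iff_odd.2 hn), if_pos hm]
  rfl

theorem joinF_of_odd_odd (hm : Odd m) (hn : Odd n) (hx : x ∈ K.H R m) (hy : y ∈ L.H R n) :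
    joinF F F' (jmul K L R x y) =
      -∑ j ∈ Finset.range p, ∑ k ∈ Finset.range (j + 1), F ((K.T R ^ k) x) * F' ((L.T R ^ j) y) := by
  rw [joinF, joinGlue_jmul _ hx hy, joinForm, if_neg (Nat.not_even_iff_odd.2 hn),
    if_neg (Nat.not_even_iff_odd.2 hm), triangleForm_apply]

theorem bd_mem_odd (hm : Even m) (hx : x ∈ K.H R m) : ∃ k, Odd k ∧ K.bd R x ∈ K.H R k := by
  rcases m with _ | m
  · exact ⟨1, odd_one, by rw [bd_zero_mem hx]; exact Submodule.zero_mem _⟩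
  · exact ⟨m, by simpa [Nat.even_add_one] using hm, bd_mem hx⟩

theorem bd_mem_even (hm : Odd m) (hx : x ∈ K.H R m) : ∃ k, Even k ∧ K.bd R x ∈ K.H R k := by
  obtain ⟨k, rfl⟩ := hm
  exact ⟨2 * k, even_two_mul k, bd_mem hx⟩

theorem IsAugResolution.bd_even (hF : IsAugResolution F) (hm : Even m) (hx : x ∈ K.H R m) :
    F (K.bd R x) = F x - F (K.T R x) := by
  rw [hF.bd m x hx, parity_even hm, augOp_d_apply, map_sub]

theorem IsAugResolution.bd_odd (hF : IsAugResolution F) (hm : Odd m) (hx : x ∈ K.H R m) :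
    F (K.bd R x) = ∑ k ∈ Finset.range p, F ((K.T R ^ k) x) := by
  rw [hF.bd m x hx, parity_odd hm, augOp_s_apply, map_sum]

theorem T_pow_succ_apply (k : ℕ) (x : K.AugChain R) :
    (K.T R ^ (k + 1)) x = K.T R ((K.T R ^ k) x) := by
  rw [pow_succ']; rfl

theorem T_pow_succ_apply' (k : ℕ) (x : K.AugChain R) :
    (K.T R ^ (k + 1)) x = (K.T R ^ k) (K.T R x) := by
  rw [pow_succ]; rfl

/-- On products the resolution relation becomes an identity between the sequences F(Tᵏx) and
F'(Tᵏy), the second p-periodic. The four parities of (m, n) need, in order: the splitting of 1 - T ⊗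
T, and the triangle sums with differences in the left factor, in the right factor, and in both
indices at once. -/
theorem IsAugResolution.joinF_bd_jmul (hF : IsAugResolution F) (hF' : IsAugResolution F')
    (hx : x ∈ K.H R m) (hy : y ∈ L.H R n) :
    joinF F F' ((K.join L).bd R (jmul K L R x y)) =
      joinF F F' ((K.join L).augOp R (parity (m + n)) (jmul K L R x y)) := by
  set f : ℕ → R := fun k => F ((K.T R ^ k) x) with hf
  set g : ℕ → R := fun k => F' ((L.T R ^ k) y) with hg
  have hf0 : F x = f 0 := by simp [hf]
  have hg0 : F' y = g 0 := by simp [hg]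
  have hf1 : F (K.T R x) = f 1 := by simp [hf]
  have hg1 : F' (L.T R y) = g 1 := by simp [hg]
  have hgp : g p = g 0 := by simp [hg, T_pow_p]
  rw [bd_jmul hx, map_add, map_smul, smul_eq_mul]
  rcases Nat.even_or_odd m with hm | hm <;> rcases Nat.even_or_odd n with hn | hn
  · obtain ⟨m', hm', hx'⟩ := bd_mem_odd hm hx
    obtain ⟨n', hn', hy'⟩ := bd_mem_odd hn hy
    rw [parity_even (hm.add hn), augOp_d_apply, T_jmul, map_sub, joinF_of_even hn hx' hy,
      joinF_of_even_odd hm hn' hx hy', joinF_of_even hn hx hy,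
      joinF_of_even hn (T_mem hx) (T_mem hy), hF.bd_even hm hx, hF'.bd_even hn hy, hm.neg_one_pow]
    ring
  · obtain ⟨m', hm', hx'⟩ := bd_mem_odd hm hx
    obtain ⟨n', hn', hy'⟩ := bd_mem_even hn hy
    have h1 : ∀ k j, F ((K.T R ^ k) (K.bd R x)) * F' ((L.T R ^ j) y) =
        (f k - f (k + 1)) * g j := fun k j => by
      rw [← bd_T_pow, hF.bd_even hm (T_pow_mem k hx), ← T_pow_succ_apply]
    rw [parity_odd (hm.add_odd hn), augOp_s_apply, map_sum, joinF_of_odd_odd hm' hn hx' hy,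
      joinF_of_even hn' hx hy', hF'.bd_odd hn hy, hm.neg_one_pow]
    simp only [h1]
    have h2 : ∀ k, ZpComplex.joinF F F' (((K.join L).T R ^ k) (jmul K L R x y)) =
        f (k + 1) * g k := fun k => by
      rw [T_pow_jmul, joinF_of_even_odd hm hn (T_pow_mem k hx) (T_pow_mem k hy), ← T_pow_succ_apply]
    simp only [h2]
    rw [sum_triangle_left, hf0]
    ring
  · obtain ⟨m', hm', hx'⟩ := bd_mem_even hm hx
    obtain ⟨n', hn', hy'⟩ := bd_mem_odd hn hy
    have h1 : ∀ k j, F ((K.T R ^ k) x) * F' ((L.T R ^ j) (L.bd R y)) =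
        f k * (g j - g (j + 1)) := fun k j => by
      rw [← bd_T_pow, hF'.bd_even hn (T_pow_mem j hy), ← T_pow_succ_apply]
    rw [parity_odd (hm.add_even hn), augOp_s_apply, map_sum, joinF_of_odd_odd hm hn' hx hy',
      joinF_of_even hn hx' hy, hF.bd_odd hm hx, hm.neg_one_pow]
    simp only [h1]
    have h2 : ∀ k, ZpComplex.joinF F F' (((K.join L).T R ^ k) (jmul K L R x y)) =
        f k * g k := fun k => by
      rw [T_pow_jmul, joinF_of_even hn (T_pow_mem k hx) (T_pow_mem k hy)]
    simp only [h2]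
    rw [sum_triangle_right, hgp, hg0]
    ring
  · obtain ⟨m', hm', hx'⟩ := bd_mem_even hm hx
    obtain ⟨n', hn', hy'⟩ := bd_mem_even hn hy
    rw [parity_even (hm.add_odd hn), augOp_d_apply, T_jmul, map_sub,
      joinF_of_even_odd hm' hn hx' hy, joinF_of_even hn' hx hy', joinF_of_odd_odd hm hn hx hy,
      joinF_of_odd_odd hm hn (T_mem hx) (T_mem hy), hm.neg_one_pow, ← bd_T,
      hF.bd_odd hm (T_mem hx), hF'.bd_odd hn hy]
    simp only [← T_pow_succ_apply']
    have := sum_triangle_shift f g p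
    simp only [Finset.sum_sub_distrib] at this
    rw [hgp] at this
    rw [hf0, hg0]
    linear_combination -this

theorem IsAugResolution.joinF (hF : IsAugResolution F) (hF' : IsAugResolution F') :
    IsAugResolution (joinF F F') := by
  refine ⟨?_, fun N z hz => ?_⟩
  · have : (K.join L).gen R (K.join L).emptyCell =
        jmul K L R (K.gen R K.emptyCell) (L.gen R L.emptyCell) := by
      rw [jmul_gen]; congr 1
    rw [this, joinF_of_even Even.zero emptyCell_mem emptyCell_mem, hF.empty, hF'.empty, mul_one]
  · refine eqOn_join_H (f := ZpComplex.joinF F F' ∘ₗ (K.join L).bd R)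
      (g := ZpComplex.joinF F F' ∘ₗ (K.join L).augOp R (parity N)) (fun m n h x hx y hy => ?_) hz
    subst h
    exact hF.joinF_bd_jmul hF' hx hy

theorem joinForm_eq_zero_left (h : ∀ x ∈ K.H R m, F x = 0) (hx : x ∈ K.H R m) :
    joinForm F F' m n x y = 0 := by
  have h' : ∀ k, F ((K.T R ^ k) x) = 0 := fun k => h _ (T_pow_mem k hx)
  rw [joinForm]
  split_ifs
  · rw [prodForm_apply, h x hx, zero_mul]
  · rw [prodForm_apply, LinearMap.comp_apply, h _ (T_mem hx), zero_mul]
  · rw [triangleForm_apply]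
    simp [h']

theorem joinForm_eq_zero_right (h : ∀ y ∈ L.H R n, F' y = 0) (hy : y ∈ L.H R n) :
    joinForm F F' m n x y = 0 := by
  have h' : ∀ k, F' ((L.T R ^ k) y) = 0 := fun k => h _ (T_pow_mem k hy)
  rw [joinForm]
  split_ifs
  · rw [prodForm_apply, h y hy, mul_zero]
  · rw [prodForm_apply, h _ hy, mul_zero]
  · rw [triangleForm_apply]
    simp [h']

end

theorem joinF_vanishing {F : K.AugChain R →ₗ[R] R} {F' : L.AugChain R →ₗ[R] R} {a b : ℕ}
    (h : ∀ n, a < n → ∀ x ∈ K.H R n, F x = 0) (h' : ∀ n, b < n → ∀ x ∈ L.H R n, F' x = 0)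
    {m n : ℕ} (hmn : a < m ∨ b < n) {x : K.AugChain R} (hx : x ∈ K.H R m) {y : L.AugChain R}
    (hy : y ∈ L.H R n) : joinF F F' (jmul K L R x y) = 0 := by
  rw [joinF, joinGlue_jmul _ hx hy]
  rcases hmn with hm | hn
  · exact joinForm_eq_zero_left (h m hm) hx
  · exact joinForm_eq_zero_right (h' n hn) hy

/-- The Smith index of a join is at most the sum of the Smith indices. -/
theorem smithIndex_join_le [Fintype V] [Fintype W] (hp : 0 < p) (K : ZpComplex p V)
    (L : ZpComplex p W) : (K.join L).smithIndex ≤ K.smithIndex + L.smithIndex := by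
  obtain ⟨F, hF, h⟩ := exists_vanishing_of_isSmithClass_zero (isSmithClass_smithIndex hp K)
  obtain ⟨F', hF', h'⟩ := exists_vanishing_of_isSmithClass_zero (isSmithClass_smithIndex hp L)
  -- A product with I(K) + I(L) + 1 vertices has more than I(K) in the first factor or more than
  -- I(L) in the second.
  refine smithIndex_le (isSmithClass_zero_of_vanishing (hF.joinF hF') fun z hz => ?_)
  exact eqOn_join_H (f := joinF F F') (g := 0)
    (fun m n hmn x hx y hy => joinF_vanishing h h' (by omega) hx hy) hz

end ZpComplex

end

/-! ### Vanishing of the Smith class of a join when both factors vanish modulo p -/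

noncomputable section

namespace ZpComplex

open Special

variable {p : ℕ} {V W : Type*} [LinearOrder V] [LinearOrder W] {K : ZpComplex p V}
  {L : ZpComplex p W}

/-- A resolution that is divisible by `p` on the simplices with `n + 1` vertices can be changed to
one that vanishes on larger simplices. -/
theorem IsAugResolution.exists_top (hp : 0 < p) {n : ℕ} {F η : K.AugChain ℤ →ₗ[ℤ] ℤ}
    (hF : IsAugResolution F) (hη : ∀ x ∈ K.H ℤ (n + 1), F x = p * η x) :
    ∃ F' : K.AugChain ℤ →ₗ[ℤ] ℤ, IsAugResolution F' ∧ (∀ k, n + 1 < k → ∀ x ∈ K.H ℤ k, F' x = 0) ∧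
      (Even n → ∀ x ∈ K.H ℤ (n + 1), F' x = η (K.augOp ℤ .s x)) ∧
      (Odd n → (∀ x ∈ K.H ℤ (n + 1), F' x = p * η x - η (K.augOp ℤ .s x)) ∧
        ∀ x ∈ K.H ℤ (n + 2), η (K.augOp ℤ .d (K.bd ℤ x)) = 0) := by
  have hp0 : (p : ℤ) ≠ 0 := by exact_mod_cast hp.ne'
  -- Since F = pη, the relation for F gives p·ηρ∂ = Fρ∂ = F∂ρ = 0, and p can be cancelled over ℤ.
  have hsη : ∀ x ∈ K.H ℤ (n + 2), p * η (K.augOp ℤ (parity (n + 1)) (K.bd ℤ x)) = 0 := by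
    intro x hx
    rw [← hη _ (augOp_mem _ (bd_mem hx)), ← bd_augOp, hF.bd _ _ (augOp_mem _ hx), parity_succ (n + 1),
      augOp_bar, map_zero]
  have hsη' : ∀ x ∈ K.H ℤ (n + 2), η (K.augOp ℤ (parity (n + 1)) (K.bd ℤ x)) = 0 := fun x hx =>
    (mul_eq_zero.1 (hsη x hx)).resolve_left hp0
  -- E must satisfy Eρ = pηρ, so that it continues the resolution, and E∂ = 0, so that 0 can follow.
  -- For ρ = s the choice ηs works because s² = ps; for ρ = d one subtracts ηs from pη, which sd = 0
  -- permits.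
  set E : K.AugChain ℤ →ₗ[ℤ] ℤ := if Even n then η ∘ₗ K.augOp ℤ .s else
    (p : ℤ) • η - η ∘ₗ K.augOp ℤ .s with hE
  set F' : K.AugChain ℤ →ₗ[ℤ] ℤ := glue fun k => if k ≤ n then F else if k = n + 1 then E else 0
    with hF'
  have htop : ∀ x ∈ K.H ℤ (n + 1), F' x = E x := fun x hx => by
    rw [hF', glue_apply _ hx, if_neg (by omega), if_pos rfl]
  have hEop : ∀ x ∈ K.H ℤ (n + 1), F (K.bd ℤ x) = E (K.augOp ℤ (parity (n + 1)) x) := by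
    intro x hx
    rw [hF.bd _ x hx, hη _ (augOp_mem _ hx), hE]
    rcases Nat.even_or_odd n with h | h
    · rw [if_pos h, parity_odd h.add_one, LinearMap.comp_apply, s_s, map_smul, smul_eq_mul]
    · rw [if_neg (Nat.not_even_iff_odd.2 h), parity_even h.add_one]
      simp [augOp_s_d]
  have hEbd : ∀ x ∈ K.H ℤ (n + 2), E (K.bd ℤ x) = 0 := by
    intro x hx
    have h1 := hsη' x hx
    rw [hE]
    rcases Nat.even_or_odd n with h | h
    · rw [parity_odd h.add_one] at h1
      rw [if_pos h]; exact h1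
    · rw [parity_even h.add_one] at h1
      have h2 := hF.bd _ x hx
      -- As ηd∂ = 0, the functional η∂ is invariant, whence ηs∂ = pη∂ and E∂ = 0.
      have h3 : ∀ k, η ((K.T ℤ ^ k) (K.bd ℤ x)) = η (K.bd ℤ x) := fun k => by
        induction k with
        | zero => simp
        | succ k ih =>
          have h4 := hsη' _ (T_pow_mem k hx)
          rw [parity_even h.add_one, augOp_d_apply, map_sub, bd_T_pow, ← T_pow_succ_apply] at h4
          rw [← ih]; linarith
      rw [if_neg (Nat.not_even_iff_odd.2 h), LinearMap.sub_apply, LinearMap.comp_apply,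
        augOp_s_apply, map_sum]
      simp [h3]
  refine ⟨F', ⟨?_, fun k x hx => ?_⟩, fun k hk x hx => ?_, fun h x hx => ?_, fun h =>
    ⟨fun x hx => ?_, ?_⟩⟩
  · rw [hF', glue_apply _ emptyCell_mem, if_pos (Nat.zero_le _), hF.empty]
  · rcases k with _ | k
    · rw [bd_zero_mem hx, augOp_parity_zero hx]
    · rw [hF', glue_apply _ (bd_mem hx), glue_apply _ (augOp_mem _ hx)]
      rcases lt_trichotomy k n with h | rfl | h
      · rw [if_pos (by omega), if_pos (by omega), hF.bd _ x hx]
      · rw [if_pos le_rfl, if_neg (by omega), if_pos rfl, hEop x hx]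
      · rw [if_neg (by omega), if_neg (by omega : ¬ k + 1 ≤ n), if_neg (by omega : ¬ k + 1 = n + 1)]
        split_ifs with h'
        · subst h'; rw [hEbd x hx]; rfl
        · rfl
  · rw [hF', glue_apply _ hx, if_neg (by omega), if_neg (by omega)]; rfl
  · rw [htop x hx, hE, if_pos h]; rfl
  · rw [htop x hx, hE, if_neg (Nat.not_even_iff_odd.2 h)]; simp
  · intro x hx
    have := hsη' x hx
    rwa [parity_even h.add_one] at this

theorem joinF_augOp_eq_zero {F : K.AugChain ℤ →ₗ[ℤ] ℤ} {F' : L.AugChain ℤ →ₗ[ℤ] ℤ} {a b : ℕ}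
    (h : ∀ n, a < n → ∀ x ∈ K.H ℤ n, F x = 0) (h' : ∀ n, b < n → ∀ x ∈ L.H ℤ n, F' x = 0)
    {m n : ℕ} (hmn : a < m ∨ b < n) (ρ : Special) {x : K.AugChain ℤ} (hx : x ∈ K.H ℤ m)
    {y : L.AugChain ℤ} (hy : y ∈ L.H ℤ n) :
    joinF F F' ((K.join L).augOp ℤ ρ (jmul K L ℤ x y)) = 0 := by
  have h1 : ∀ k, joinF F F' (((K.join L).T ℤ ^ k) (jmul K L ℤ x y)) = 0 := fun k => by
    rw [T_pow_jmul]
    exact joinF_vanishing h h' hmn (T_pow_mem k hx) (T_pow_mem k hy)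
  cases ρ with
  | d =>
    have h2 := h1 0
    have h3 := h1 1
    rw [pow_zero, Module.End.one_apply] at h2
    rw [pow_one] at h3
    rw [augOp_d_apply, map_sub, h2, h3, sub_zero]
  | s => rw [augOp_s_apply, map_sum]; exact Finset.sum_eq_zero fun k _ => h1 k

/-- The average of the product of two functionals. -/
def avgForm (F : K.AugChain ℤ →ₗ[ℤ] ℤ) (F' : L.AugChain ℤ →ₗ[ℤ] ℤ) :
    K.AugChain ℤ →ₗ[ℤ] L.AugChain ℤ →ₗ[ℤ] ℤ :=
  ∑ k ∈ Finset.range p, prodForm (F ∘ₗ (K.T ℤ ^ k)) (F' ∘ₗ (L.T ℤ ^ k))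

section

variable (F : K.AugChain ℤ →ₗ[ℤ] ℤ) (F' : L.AugChain ℤ →ₗ[ℤ] ℤ) (x : K.AugChain ℤ)
  (y : L.AugChain ℤ)

theorem avgForm_apply : avgForm F F' x y =
    ∑ k ∈ Finset.range p, F ((K.T ℤ ^ k) x) * F' ((L.T ℤ ^ k) y) := by
  simp [avgForm, LinearMap.sum_apply, prodForm_apply]

theorem avgForm_T_T : avgForm F F' (K.T ℤ x) (L.T ℤ y) = avgForm F F' x y := by
  rw [avgForm_apply, avgForm_apply]
  simp only [← T_pow_succ_apply']
  have h1 := Finset.sum_range_succ (fun k => F ((K.T ℤ ^ k) x) * F' ((L.T ℤ ^ k) y)) p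
  rw [Finset.sum_range_succ'] at h1
  rw [T_pow_p, T_pow_p, pow_zero, pow_zero] at h1
  exact add_right_cancel h1

theorem avgForm_s_left : avgForm F F' (K.augOp ℤ .s x) y =
    F (K.augOp ℤ .s x) * F' (L.augOp ℤ .s y) := by
  rw [avgForm_apply, augOp_s_apply y, map_sum, Finset.mul_sum]
  simp only [T_pow_s]

theorem avgForm_s_right : avgForm F F' x (L.augOp ℤ .s y) =
    F (K.augOp ℤ .s x) * F' (L.augOp ℤ .s y) := by
  rw [avgForm_apply, augOp_s_apply x, map_sum, Finset.sum_mul]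
  simp only [T_pow_s]

theorem exists_T_eq (hp : 0 < p) : ∃ y', L.T ℤ y' = y := by
  refine ⟨(L.T ℤ ^ (p - 1)) y, ?_⟩
  rw [← T_pow_succ_apply, Nat.sub_add_cancel hp, T_pow_p]
  rfl

/-- Invariance of the averaged form moves d from one factor to the other, up to sign and a
translation. Then dv = p - s: the terms with p cancel, and so do those with s, because s may be
applied to either argument of the average. -/
theorem avgForm_d_v (hp : 0 < p) : avgForm F F' (K.augOp ℤ .d x) (L.vOp ℤ y) +
    avgForm F F' (K.augOp ℤ .d (K.vOp ℤ (K.T ℤ x))) y = 0 := by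
  obtain ⟨y, rfl⟩ := exists_T_eq y hp
  have h1 : avgForm F F' (K.augOp ℤ .d x) (L.vOp ℤ (L.T ℤ y)) =
      - avgForm F F' x (L.augOp ℤ .d (L.vOp ℤ y)) := by
    rw [vOp_T, augOp_d_apply, map_sub, LinearMap.sub_apply, avgForm_T_T, augOp_d_apply, map_sub]
    ring
  rw [h1, vOp_T, ← T_augOp, avgForm_T_T, d_vOp, d_vOp, map_sub, map_sub, LinearMap.sub_apply,
    avgForm_s_left, avgForm_s_right, map_smul, map_smul, LinearMap.smul_apply]
  ring

end

/-- If the Smith classes of `K` and `L` vanish modulo `p` in dimensions `n` and `m`, then the Smith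
class of the join vanishes in dimension `n + m + 1`. -/
theorem isSmithClass_join_zero [Fintype V] [Fintype W] (hp : p.Prime) {n m : ℕ}
    (hK : ∃ a, K.IsSmithClass n a ∧ K.cohomologyReduce p n (parity n) a = 0)
    (hL : ∃ a, L.IsSmithClass m a ∧ L.cohomologyReduce p m (parity m) a = 0) :
    (K.join L).IsSmithClass (n + m + 1) 0 := by
  obtain ⟨F₀, η, hF₀, hη⟩ := exists_divisible_of_isSmithClass_mod hp hK
  obtain ⟨F, hF, hF0, hFe, hFo⟩ := hF₀.exists_top hp.pos hη
  obtain ⟨F₀', η', hF₀', hη'⟩ := exists_divisible_of_isSmithClass_mod hp hL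
  obtain ⟨F', hF', hF0', hFe', hFo'⟩ := hF₀'.exists_top hp.pos hη'
  have hJ := hF.joinF hF'
  clear hF₀ hη hF₀' hη' F₀ F₀' hK hL
  by_cases hodd : Odd n ∧ Odd m
  · obtain ⟨hn, hm⟩ := hodd
    obtain ⟨hFn, hηd⟩ := hFo hn
    obtain ⟨hFm, -⟩ := hFo' hm
    -- With v = `vOp`, put G = ηd ⊗ F'v + ηdvT ⊗ F', concentrated on n + 1 and m vertices. On n + 1
    -- and m + 1 vertices the rules pηd = Fd, ηdvT = FT and F'(v∂y) = pF'(y) turn G∂ into F ⊗ F' -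
    -- FT ⊗ F'T, the coboundary of the join resolution. On n + 2 and m vertices G∂ vanishes because
    -- ηd∂ = 0. Finally Gs = 0 is `avgForm_d_v`.
    let c : ℕ → ℕ → K.AugChain ℤ →ₗ[ℤ] L.AugChain ℤ →ₗ[ℤ] ℤ := fun a b =>
      if a = n + 1 ∧ b = m then prodForm (η ∘ₗ K.augOp ℤ .d) (F' ∘ₗ L.vOp ℤ) +
        prodForm (η ∘ₗ K.augOp ℤ .d ∘ₗ K.vOp ℤ ∘ₗ K.T ℤ) F' else 0
    have hc : ∀ x y, c (n + 1) m x y = η (K.augOp ℤ .d x) * F' (L.vOp ℤ y) +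
        η (K.augOp ℤ .d (K.vOp ℤ (K.T ℤ x))) * F' y := fun x y => by
      simp only [c, and_self, if_true]; rfl
    have hc0 : ∀ a b, ¬ (a = n + 1 ∧ b = m) → ∀ x y, c a b x y = 0 := fun a b h x y => by
      simp only [c, if_neg h]; rfl
    refine isSmithClass_zero_of_eq (G := joinGlue c) hJ (fun h => by omega) (fun z hz => ?_)
      (fun z hz => ?_)
    · rw [parity_odd (hn.add_odd hm).add_one]
      refine eqOn_join_H (f := joinGlue c ∘ₗ (K.join L).augOp ℤ .s) (g := 0)
        (fun a b hab x hx y hy => ?_) hz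
      rw [LinearMap.comp_apply, augOp_s_apply, map_sum]
      simp only [T_pow_jmul]
      rw [Finset.sum_congr rfl fun k _ => joinGlue_jmul c (T_pow_mem k hx) (T_pow_mem k hy)]
      by_cases h : a = n + 1 ∧ b = m
      · obtain ⟨rfl, rfl⟩ := h
        have h1 := avgForm_d_v η F' x y hp.pos
        rw [avgForm_apply, avgForm_apply, ← Finset.sum_add_distrib] at h1
        rw [LinearMap.zero_apply, ← h1]
        refine Finset.sum_congr rfl fun k _ => ?_
        have hv : Commute (L.T ℤ) (L.T ℤ ^ k) := Commute.pow_right (Commute.refl _) k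
        have hv' : Commute (K.T ℤ) (K.T ℤ ^ k) := Commute.pow_right (Commute.refl _) k
        rw [hc, T_pow_augOp, T_pow_augOp, ← L.vOp_comm hv, ← K.vOp_comm hv', ← T_pow_succ_apply,
          T_pow_succ_apply']
      · exact Finset.sum_eq_zero fun k _ => hc0 a b h _ _
    · refine eqOn_join_H (f := joinF F F' ∘ₗ (K.join L).bd ℤ)
        (g := joinGlue c ∘ₗ (K.join L).bd ℤ) (fun a b hab x hx y hy => ?_) hz
      rw [LinearMap.comp_apply, LinearMap.comp_apply, hJ.bd _ _ (jmul_mem hx hy)]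
      have hg : ∀ h : ¬ (a = n + 1 ∧ b = m + 1), joinGlue c (jmul K L ℤ x (L.bd ℤ y)) = 0 := by
        intro h
        rcases b with _ | b
        · rw [bd_zero_mem hy, map_zero, map_zero]
        · rw [joinGlue_jmul c hx (bd_mem hy)]
          exact hc0 _ _ (by omega) _ _
      have hg' : joinGlue c (jmul K L ℤ (K.bd ℤ x) y) = 0 := by
        rcases a with _ | a
        · rw [bd_zero_mem hx, map_zero, LinearMap.zero_apply, map_zero]
        · rw [joinGlue_jmul c (bd_mem hx) hy]
          by_cases h : a = n + 1 ∧ b = m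
          · obtain ⟨rfl, rfl⟩ := h
            rw [hc, hηd x hx, ← bd_T, vOp_bd,
              hηd _ (vOp_mem (T_mem hx))]
            ring
          · exact hc0 _ _ h _ _
      rw [bd_jmul hx, map_add, map_smul, hg', zero_add]
      by_cases h : a = n + 1 ∧ b = m + 1
      · obtain ⟨rfl, rfl⟩ := h
        have h1 : F' (L.augOp ℤ .s y) = 0 := by
          rw [hFm _ (augOp_mem _ hy), s_s, map_smul]; simp
        have h2 : p * η (K.augOp ℤ .d x) = F x - F (K.T ℤ x) := by
          have := hFn _ (augOp_mem .d hx)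
          rw [augOp_s_d, map_zero, sub_zero] at this
          rw [← this, augOp_d_apply, map_sub]
        have h3 : η (K.augOp ℤ .d (K.vOp ℤ (K.T ℤ x))) = F (K.T ℤ x) := by
          rw [d_vOp, hFn _ (T_mem hx), map_sub, map_smul]; simp
        have h4 : F' (L.vOp ℤ (L.bd ℤ y)) = p * F' y := by
          rw [vOp_bd, hF'.bd _ _ (vOp_mem hy), parity_even hm.add_one, d_vOp, map_sub, h1, map_smul]
          simp
        rw [joinGlue_jmul c hx (bd_mem hy), hc, hn.add_one.neg_one_pow, h3, h4,
          hF'.bd_even hm.add_one hy, parity_even (hn.add_one.add hm.add_one), augOp_d_apply, T_jmul,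
          map_sub, joinF_of_even hm.add_one hx hy, joinF_of_even hm.add_one (T_mem hx) (T_mem hy),
          one_smul]
        linear_combination (-(F' y)) * h2
      · rw [hg h, joinF_augOp_eq_zero hF0 hF0' (by omega) _ hx hy, smul_zero]
  -- If n or m is even, the coboundary of the join resolution is already zero: an even-dimensional
  -- top cochain ηs is invariant, and an odd-dimensional one pη - ηs is killed by s.
  · refine isSmithClass_zero_of_eq (G := 0) hJ (fun _ => rfl) (fun z hz => rfl) (fun z hz => ?_)
    rw [hJ.bd _ z hz]
    refine eqOn_join_H (f := joinF F F' ∘ₗ (K.join L).augOp ℤ (parity (n + m + 1 + 1)))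
        (g := 0) (fun a b hab x hx y hy => ?_) hz
    rw [LinearMap.comp_apply]
    by_cases h : a = n + 1 ∧ b = m + 1
    · obtain ⟨rfl, rfl⟩ := h
      have hinv : Even n → ∀ k, F ((K.T ℤ ^ k) x) = F x := fun he k => by
        rw [hFe he _ (T_pow_mem k hx), hFe he _ hx, ← T_pow_augOp, T_pow_s]
      have hinv' : Even m → ∀ k, F' ((L.T ℤ ^ k) y) = F' y := fun he k => by
        rw [hFe' he _ (T_pow_mem k hy), hFe' he _ hy, ← T_pow_augOp, T_pow_s]
      have hs : Odd n → ∑ k ∈ Finset.range p, F ((K.T ℤ ^ k) x) = 0 := fun ho => by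
        rw [← map_sum, ← augOp_s_apply, (hFo ho).1 _ (augOp_mem _ hx), s_s, map_smul]; simp
      have hs' : Odd m → ∑ k ∈ Finset.range p, F' ((L.T ℤ ^ k) y) = 0 := fun ho => by
        rw [← map_sum, ← augOp_s_apply, (hFo' ho).1 _ (augOp_mem _ hy), s_s, map_smul]; simp
      rcases Nat.even_or_odd n with hn | hn <;> rcases Nat.even_or_odd m with hm | hm
      · rw [← hab, ← hJ.bd _ _ (jmul_mem hx hy), bd_jmul hx, map_add, map_smul,
          joinF_of_even_odd hn hm.add_one (bd_mem hx) hy, joinF_of_even hm hx (bd_mem hy),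
          ← bd_T, hF.bd_odd hn.add_one (T_mem hx), hF'.bd_odd hm.add_one hy]
        simp only [← T_pow_succ_apply', hinv hn, hinv' hm, Finset.sum_const, Finset.card_range,
          hn.add_one.neg_one_pow, LinearMap.zero_apply]
        simp only [nsmul_eq_mul, smul_eq_mul]
        ring
      · rw [parity_odd (by rw [← hab]; exact hn.add_one.add_even hm.add_one), augOp_s_apply, map_sum]
        simp only [T_pow_jmul]
        rw [Finset.sum_congr rfl fun k _ =>
          joinF_of_even hm.add_one (T_pow_mem k hx) (T_pow_mem k hy)]
        simp only [hinv hn]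
        rw [← Finset.mul_sum, hs' hm, mul_zero]; rfl
      · rw [parity_odd (by rw [← hab]; exact hn.add_one.add_odd hm.add_one), augOp_s_apply, map_sum]
        simp only [T_pow_jmul]
        rw [Finset.sum_congr rfl fun k _ =>
          joinF_of_even_odd hn.add_one hm.add_one (T_pow_mem k hx) (T_pow_mem k hy)]
        simp only [hinv' hm, ← T_pow_succ_apply]
        rw [← Finset.sum_mul]
        simp only [T_pow_succ_apply']
        have h1 : ∑ k ∈ Finset.range p, F ((K.T ℤ ^ k) (K.T ℤ x)) = 0 := by
          rw [← map_sum, ← augOp_s_apply, s_T, augOp_s_apply, map_sum, hs hn]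
        rw [h1, zero_mul]; rfl
      · exact absurd ⟨hn, hm⟩ hodd
    · rw [joinF_augOp_eq_zero hF0 hF0' (by omega) _ hx hy]; rfl

end ZpComplex

end

noncomputable section

namespace ZpComplex

open Special

variable {p : ℕ} {V W : Type*} [LinearOrder V] [LinearOrder W] {K : ZpComplex p V}
  {L : ZpComplex p W}

/-! ### Dual chains -/

/-- A functional that vanishes on the kernel of a linear map factors through it. -/
theorem exists_factor_of_ker_le {k E E' : Type*} [Field k] [AddCommGroup E] [Module k E]
    [AddCommGroup E'] [Module k E'] (S : Submodule k E) (A : E →ₗ[k] E') (f : E →ₗ[k] k)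
    (h : ∀ x ∈ S, A x = 0 → f x = 0) : ∃ g : E' →ₗ[k] k, ∀ x ∈ S, f x = g (A x) := by
  have h1 : f.domRestrict S ∈ LinearMap.range (A.domRestrict S).dualMap := by
    rw [LinearMap.range_dualMap_eq_dualAnnihilator_ker, Submodule.mem_dualAnnihilator]
    exact fun x hx => h x.1 x.2 hx
  obtain ⟨g, hg⟩ := h1
  exact ⟨g, fun x hx => (LinearMap.congr_fun hg ⟨x, hx⟩).symm⟩

theorem eq_of_mem_H_zero {R : Type*} [CommRing R] {M : Type*} [AddCommGroup M] [Module R M]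
    {f g : K.AugChain R →ₗ[R] M} (h : f (K.gen R K.emptyCell) = g (K.gen R K.emptyCell))
    {x : K.AugChain R} (hx : x ∈ K.H R 0) : f x = g x := by
  refine eqOn_H (fun σ hσ => ?_) hx
  obtain rfl : σ = K.emptyCell := Subtype.ext (Finset.card_eq_zero.1 hσ)
  exact h

theorem T_empty {R : Type*} [CommRing R] :
    K.T R (K.gen R K.emptyCell) = K.gen R K.emptyCell := by
  have := K.T_pow_zero_mem (R := R) 1 emptyCell_mem
  rwa [pow_one] at this

/-- The chain `c` detects the Smith class in dimension `N` modulo `p`. -/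
structure Detects (K : ZpComplex p V) (N : ℕ) (c : K.AugChain (ZMod p)) : Prop where
  mem : c ∈ K.H (ZMod p) (N + 1)
  cycle : K.augOp (ZMod p) (parity (N + 1)) (K.bd (ZMod p) c) = 0
  ne_zero : ∀ F : K.AugChain (ZMod p) →ₗ[ZMod p] ZMod p, IsAugResolution F → F (K.bd (ZMod p) c) ≠ 0

theorem s_eq_zero_of_mem_H_zero {x : K.AugChain (ZMod p)} (hx : x ∈ K.H (ZMod p) 0) :
    K.augOp (ZMod p) .s x = 0 := by
  rw [augOp_s_apply, Finset.sum_congr rfl fun k _ => K.T_pow_zero_mem k hx]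
  simp [← Nat.cast_smul_eq_nsmul (ZMod p)]

/-- A chain whose boundary is a multiple of `ρ`. -/
theorem exists_bd_eq_augOp (hp : 0 < p) {R : Type*} [CommRing R] {N : ℕ} {c : K.AugChain R}
    (hc : c ∈ K.H R (N + 2)) (h : K.augOp R (parity (N + 2)) (K.bd R c) = 0) :
    ∃ b ∈ K.H R (N + 1), K.bd R c = K.augOp R (parity (N + 1)) b ∧
      K.augOp R (parity (N + 1)) (K.bd R b) = 0 := by
  rw [parity_succ (N + 1)] at h
  obtain ⟨b, hb, hcb⟩ := exact_chain hp _ (bd_mem hc) h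
  rw [bar_bar] at hcb
  refine ⟨b, hb, hcb, ?_⟩
  rw [← bd_augOp, ← hcb, bd_bd_apply]

/-- Replacing ∂c = ρb by ∂b lowers the number of vertices and leaves the value of any resolution
unchanged. After finitely many steps only the value on the empty simplex is left, and that is 1 for
every resolution. -/
theorem IsAugResolution.apply_bd_eq (hp : 0 < p) {R : Type*} [CommRing R]
    {F F' : K.AugChain R →ₗ[R] R} (hF : IsAugResolution F) (hF' : IsAugResolution F') {N : ℕ} :
    ∀ {c : K.AugChain R}, c ∈ K.H R (N + 1) → K.augOp R (parity (N + 1)) (K.bd R c) = 0 →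
      F (K.bd R c) = F' (K.bd R c) := by
  induction N with
  | zero =>
    intro c hc _
    exact eq_of_mem_H_zero (hF.empty.trans hF'.empty.symm) (bd_mem hc)
  | succ N ih =>
    intro c hc h
    obtain ⟨b, hb, hcb, hb'⟩ := exists_bd_eq_augOp hp hc h
    rw [hcb, ← hF.bd _ b hb, ← hF'.bd _ b hb]
    exact ih hb hb'

theorem Detects.pred (hp : 0 < p) {N : ℕ} {c : K.AugChain (ZMod p)} (h : K.Detects (N + 1) c) :
    ∃ b, K.Detects N b := by
  obtain ⟨b, hb, hcb, hb'⟩ := exists_bd_eq_augOp hp h.mem h.cycle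
  exact ⟨b, hb, hb', fun F hF => by rw [hF.bd _ b hb, ← hcb]; exact h.ne_zero F hF⟩

/-- Nonvanishing modulo p passes to all lower dimensions. The index is defined as the smallest
vanishing dimension, and this is what lets one detecting chain bound it from below. -/
theorem Detects.of_le (hp : 0 < p) {M N : ℕ} (hMN : M ≤ N) {c : K.AugChain (ZMod p)}
    (h : K.Detects N c) : ∃ b, K.Detects M b := by
  induction N, hMN using Nat.le_induction generalizing c with
  | base => exact ⟨c, h⟩
  | succ N _ ih =>
    obtain ⟨b, hb⟩ := h.pred hp
    exact ih hb

/-- If the class were trivial, F(∂c) = G(∂c) for a special cochain G; but ∂c = ρb and Gρ = 0. -/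
theorem Detects.notMem (hp : 0 < p) {N : ℕ} {c : K.AugChain (ZMod p)} (h : K.Detects N c)
    {F : K.AugChain (ZMod p) →ₗ[ZMod p] ZMod p} (hF : IsAugResolution F) :
    K.restr (F ∘ₗ K.augOp _ (parity (N + 1))) N ∉ K.coboundaries (ZMod p) (parity N) N := by
  intro hmem
  obtain ⟨G, hG0, hG, hG'⟩ := exists_restr_augOp_eq hF hmem
  refine h.ne_zero F hF ?_
  rw [hG' c h.mem]
  rcases N with _ | N
  · rw [hG0 rfl]; rfl
  · obtain ⟨b, hb, hcb, -⟩ := exists_bd_eq_augOp hp h.mem h.cycle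
    rw [hcb, hG b hb]

/-- Duality over a field: if F∂ vanishes on every c with ρ∂c = 0, it factors through ρ∂, and the
functional g ∘ ρ obtained in this way is a special cochain with coboundary F∂. -/
theorem exists_detects [Fact p.Prime] {N : ℕ} {F : K.AugChain (ZMod p) →ₗ[ZMod p] ZMod p}
    (hF : IsAugResolution F)
    (h : K.restr (F ∘ₗ K.augOp _ (parity (N + 1))) N ∉ K.coboundaries (ZMod p) (parity N) N) :
    ∃ c, K.Detects N c := by
  by_contra hno
  apply h
  have hp : 0 < p := (Fact.out : p.Prime).pos
  have key : ∀ c ∈ K.H (ZMod p) (N + 1), K.augOp (ZMod p) (parity (N + 1)) (K.bd (ZMod p) c) = 0 →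
      F (K.bd (ZMod p) c) = 0 := by
    intro c hc hc'
    by_contra hne
    exact hno ⟨c, hc, hc', fun F' hF' => by rwa [hF'.apply_bd_eq hp hF hc hc']⟩
  rcases N with _ | N
  · refine restr_augOp_mem hF (G := 0) (fun _ => rfl) (fun _ _ => rfl) fun x hx => ?_
    -- For N = 0 every chain of vertices qualifies: its boundary is a multiple of the empty simplex,
    -- on which s is multiplication by p = 0.
    rw [key x hx (by rw [zero_add, parity_odd odd_one]; exact s_eq_zero_of_mem_H_zero (bd_mem hx))]
    rfl
  · obtain ⟨g, hg⟩ := exists_factor_of_ker_le (K.H (ZMod p) (N + 2))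
      (K.augOp (ZMod p) (parity (N + 2)) ∘ₗ K.bd (ZMod p)) (F ∘ₗ K.bd (ZMod p)) key
    refine restr_augOp_mem hF (G := g ∘ₗ K.augOp (ZMod p) (parity (N + 2))) (fun h => by omega)
      (fun x hx => ?_) hg
    rw [LinearMap.comp_apply, parity_succ (N + 1), augOp_bar, map_zero]

theorem exists_detects_of_lt_smithIndexMod [Fintype V] [hp : Fact p.Prime] {N : ℕ}
    (h : N < K.smithIndexMod p) : ∃ c, K.Detects N c := by
  obtain ⟨F, hF⟩ := exists_resolution hp.out.pos K ℤ
  refine exists_detects (hF.redF p) fun hmem => ?_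
  refine Nat.notMem_of_lt_sInf h (isSmithClass_mod_iff.2 ⟨F, hF, ?_⟩)
  rwa [reduce_smithOp_restr]

theorem Detects.lt_smithIndexMod [Fintype V] (hp : 0 < p) {N : ℕ} {c : K.AugChain (ZMod p)}
    (h : K.Detects N c) : N < K.smithIndexMod p := by
  by_contra hle
  obtain ⟨b, hb⟩ := h.of_le hp (not_lt.1 hle)
  obtain ⟨F, hF, hmem⟩ := isSmithClass_mod_iff.1 (isSmithClass_smithIndexMod hp K p)
  rw [reduce_smithOp_restr] at hmem
  exact hb.notMem hp (hF.redF p) hmem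

/-! ### Products of dual chains -/

section

variable {R : Type*} [CommRing R]

theorem bd_empty : K.bd R (K.gen R K.emptyCell) = 0 := bd_zero_mem emptyCell_mem

theorem bd_jmul_empty_left (y : L.AugChain R) :
    (K.join L).bd R (jmul K L R (K.gen R K.emptyCell) y) =
      jmul K L R (K.gen R K.emptyCell) (L.bd R y) := by
  rw [bd_jmul emptyCell_mem, bd_empty]
  simp

theorem bd_jmul_empty_right {m : ℕ} {x : K.AugChain R} (hx : x ∈ K.H R m) :
    (K.join L).bd R (jmul K L R x (L.gen R L.emptyCell)) =
      jmul K L R (K.bd R x) (L.gen R L.emptyCell) := by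
  rw [bd_jmul hx, bd_empty]
  simp

theorem jmul_empty_empty : jmul K L R (K.gen R K.emptyCell) (L.gen R L.emptyCell) =
    (K.join L).gen R (K.join L).emptyCell := by
  rw [jmul_gen]; congr 1

theorem jmul_empty_mem {n : ℕ} {y : L.AugChain R} (hy : y ∈ L.H R n) :
    jmul K L R (K.gen R K.emptyCell) y ∈ (K.join L).H R n := by
  have := jmul_mem (K := K) emptyCell_mem hy
  rwa [zero_add] at this

/-- Joining with the invariant empty simplex embeds the chains of L equivariantly in those of the
join, with the same number of vertices and the same boundary. -/
theorem IsAugResolution.restrict_right {F : (K.join L).AugChain R →ₗ[R] R} (hF : IsAugResolution F) :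
    IsAugResolution (F ∘ₗ jmul K L R (K.gen R K.emptyCell)) := by
  refine ⟨?_, fun n y hy => ?_⟩
  · rw [LinearMap.comp_apply, jmul_empty_empty, hF.empty]
  · rw [LinearMap.comp_apply, LinearMap.comp_apply, ← bd_jmul_empty_left,
      hF.bd n _ (jmul_empty_mem hy), augOp_jmul_of_left_invariant _ T_empty]

theorem IsAugResolution.restrict_left {F : (K.join L).AugChain R →ₗ[R] R} (hF : IsAugResolution F) :
    IsAugResolution (F ∘ₗ (jmul K L R).flip (L.gen R L.emptyCell)) := by
  refine ⟨?_, fun n x hx => ?_⟩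
  · rw [LinearMap.comp_apply, LinearMap.flip_apply, jmul_empty_empty, hF.empty]
  · rw [LinearMap.comp_apply, LinearMap.comp_apply, LinearMap.flip_apply, LinearMap.flip_apply,
      ← bd_jmul_empty_right hx, hF.bd n _ (jmul_mem hx emptyCell_mem),
      augOp_jmul_of_right_invariant _ _ T_empty]

end

theorem augOp_two_eq (K : ZpComplex 2 V) (ρ ρ' : Special) :
    K.augOp (ZMod 2) ρ = K.augOp (ZMod 2) ρ' := by
  have h : K.augOp (ZMod 2) .d = K.augOp (ZMod 2) .s := by
    refine LinearMap.ext fun x => ?_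
    rw [augOp_d_apply, augOp_s_apply, Finset.sum_range_succ, Finset.sum_range_one, pow_zero, pow_one,
      sub_eq_add_neg]
    congr 1
    rw [← neg_one_smul (ZMod 2) (K.T (ZMod 2) x), show (-1 : ZMod 2) = 1 from rfl, one_smul]
  cases ρ <;> cases ρ' <;> simp [h]

/-- The alternative `Even k ∨ p = 2` recurs below: a factor with k vertices must change neither the
parity of ρ nor a sign, and modulo 2 neither matters. -/
theorem augOp_parity_add {k : ℕ} (hk : Even k ∨ p = 2) (n : ℕ) :
    K.augOp (ZMod p) (parity (n + k)) = K.augOp (ZMod p) (parity n) := by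
  rcases hk with hk | rfl
  · congr 1
    unfold parity
    simp [Nat.even_add, hk]
  · exact augOp_two_eq K _ _

theorem neg_one_pow_eq_one {k : ℕ} (hk : Even k ∨ p = 2) : (-1 : ZMod p) ^ k = 1 := by
  rcases hk with hk | rfl
  · exact hk.neg_one_pow
  · rw [show (-1 : ZMod 2) = 1 from rfl, one_pow]

/-- The descent ∂c = ρb again, with an invariant cycle z as a spectator: ρ and ∂ act on the second
factor alone. Both sides reach the empty simplex, where F(∅) = 1. -/
theorem apply_jmul_bd_right (hp : 0 < p) {F : (K.join L).AugChain (ZMod p) →ₗ[ZMod p] ZMod p}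
    (hF : IsAugResolution F) {k : ℕ} (hk : Even k ∨ p = 2) {z : K.AugChain (ZMod p)}
    (hz : z ∈ K.H _ k) (hzT : K.T _ z = z) (hzb : K.bd _ z = 0) {m : ℕ} :
    ∀ {c : L.AugChain (ZMod p)}, c ∈ L.H _ (m + 1) → L.augOp _ (parity (m + 1)) (L.bd _ c) = 0 →
      F (jmul K L _ z (L.bd _ c)) = F (jmul K L _ z (L.gen _ L.emptyCell)) *
        F (jmul K L _ (K.gen _ K.emptyCell) (L.bd _ c)) := by
  induction m with
  | zero =>
    intro c hc _
    refine eq_of_mem_H_zero (f := F ∘ₗ jmul K L _ z) (g := (F (jmul K L _ z (L.gen _ L.emptyCell))) •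
      (F ∘ₗ jmul K L _ (K.gen _ K.emptyCell))) ?_ (bd_mem hc)
    rw [LinearMap.smul_apply, LinearMap.comp_apply, LinearMap.comp_apply, jmul_empty_empty, hF.empty,
      smul_eq_mul, mul_one]
  | succ m ih =>
    intro c hc h
    obtain ⟨b, hb, hcb, hb'⟩ := exists_bd_eq_augOp hp hc h
    have h1 := hF.restrict_right.bd _ b hb
    rw [← hcb, LinearMap.comp_apply, LinearMap.comp_apply] at h1
    have h2 := hF.bd _ _ (jmul_mem hz hb)
    rw [add_comm k, augOp_parity_add hk, bd_jmul hz, hzb, map_zero, LinearMap.zero_apply, zero_add,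
      neg_one_pow_eq_one hk, one_smul, augOp_jmul_of_left_invariant _ hzT, ← hcb] at h2
    rw [← h1, ← h2]
    exact ih hb hb'

theorem apply_jmul_bd_left (hp : 0 < p) {F : (K.join L).AugChain (ZMod p) →ₗ[ZMod p] ZMod p}
    (hF : IsAugResolution F) {k : ℕ} (hk : Even k ∨ p = 2) {z : L.AugChain (ZMod p)}
    (hz : z ∈ L.H _ k) (hzT : L.T _ z = z) (hzb : L.bd _ z = 0) {m : ℕ} :
    ∀ {c : K.AugChain (ZMod p)}, c ∈ K.H _ (m + 1) → K.augOp _ (parity (m + 1)) (K.bd _ c) = 0 →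
      F (jmul K L _ (K.bd _ c) z) = F (jmul K L _ (K.bd _ c) (L.gen _ L.emptyCell)) *
        F (jmul K L _ (K.gen _ K.emptyCell) z) := by
  induction m with
  | zero =>
    intro c hc _
    refine eq_of_mem_H_zero (f := F ∘ₗ (jmul K L _).flip z)
      (g := (F (jmul K L _ (K.gen _ K.emptyCell) z)) •
      (F ∘ₗ (jmul K L _).flip (L.gen _ L.emptyCell))) ?_ (bd_mem hc) |>.trans (mul_comm _ _)
    rw [LinearMap.smul_apply, LinearMap.comp_apply, LinearMap.comp_apply, LinearMap.flip_apply,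
      LinearMap.flip_apply, jmul_empty_empty, hF.empty, smul_eq_mul, mul_one]
  | succ m ih =>
    intro c hc h
    obtain ⟨b, hb, hcb, hb'⟩ := exists_bd_eq_augOp hp hc h
    have h1 := hF.restrict_left.bd _ b hb
    rw [← hcb, LinearMap.comp_apply, LinearMap.comp_apply] at h1
    have h2 := hF.bd _ _ (jmul_mem hb hz)
    rw [augOp_parity_add hk, bd_jmul hb, hzb, map_zero, smul_zero, add_zero,
      augOp_jmul_of_right_invariant _ _ hzT, ← hcb] at h2
    rw [LinearMap.flip_apply, LinearMap.flip_apply] at h1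
    rw [← h1, ← h2]
    exact ih hb hb'

section

variable [hp : Fact p.Prime]

/-- The product of a detecting chain with a detecting chain whose boundary is equivariant. -/
theorem Detects.join_right {N m : ℕ} (hN : Even N ∨ p = 2) {c : K.AugChain (ZMod p)}
    (hc : K.Detects N c) (hT : K.T _ (K.bd _ c) = K.bd _ c) {b : L.AugChain (ZMod p)}
    (hb : L.Detects m b) :
    (K.join L).Detects (N + m + 1) (jmul K L _ c (L.augOp _ (parity (m + 1)) b)) := by
  -- One Leibniz term vanishes by the cycle condition on b; in the other, invariance of ∂c lets ρ
  -- act on the whole product. So F of this boundary is F(∂c ⊗ ∂b), up to the next use of the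
  -- resolution relation, and it factors.
  have hbd : (K.join L).bd _ (jmul K L _ c (L.augOp _ (parity (m + 1)) b)) =
      (K.join L).augOp _ (parity (m + 1)) (jmul K L _ (K.bd _ c) b) := by
    rw [bd_jmul hc.mem, bd_augOp, hb.cycle, map_zero, smul_zero, add_zero,
      augOp_jmul_of_left_invariant _ hT]
  refine ⟨?_, ?_, fun F hF => ?_⟩
  · have := jmul_mem hc.mem (augOp_mem (parity (m + 1)) hb.mem)
    rwa [show N + 1 + (m + 1) = N + m + 1 + 1 by omega] at this
  · rw [hbd, show N + m + 1 + 1 = m + 2 + N by omega, augOp_parity_add hN, parity_succ (m + 1),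
      augOp_bar]
  · have h2 := hF.bd _ _ (jmul_mem (bd_mem hc.mem) hb.mem)
    rw [add_comm N, augOp_parity_add hN, bd_jmul (bd_mem hc.mem), bd_bd_apply, map_zero,
      LinearMap.zero_apply, zero_add, neg_one_pow_eq_one hN, one_smul] at h2
    rw [hbd, ← h2,
      apply_jmul_bd_right hp.out.pos hF hN (bd_mem hc.mem) hT (bd_bd_apply _ _) hb.mem hb.cycle]
    exact mul_ne_zero (hc.ne_zero _ hF.restrict_left) (hb.ne_zero _ hF.restrict_right)

theorem Detects.join_left {N m : ℕ} (hN : Even N ∨ p = 2) {c : L.AugChain (ZMod p)}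
    (hc : L.Detects N c) (hT : L.T _ (L.bd _ c) = L.bd _ c) {b : K.AugChain (ZMod p)}
    (hb : K.Detects m b) :
    (K.join L).Detects (m + N + 1) (jmul K L _ (K.augOp _ (parity (m + 1)) b) c) := by
  have hbd : (K.join L).bd _ (jmul K L _ (K.augOp _ (parity (m + 1)) b) c) =
      (-1 : ZMod p) ^ (m + 1) •
        (K.join L).augOp _ (parity (m + 1)) (jmul K L _ b (L.bd _ c)) := by
    rw [bd_jmul (augOp_mem _ hb.mem), bd_augOp, hb.cycle, map_zero, LinearMap.zero_apply, zero_add,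
      augOp_jmul_of_right_invariant _ _ hT]
  refine ⟨?_, ?_, fun F hF => ?_⟩
  · have := jmul_mem (augOp_mem (parity (m + 1)) hb.mem) hc.mem
    rwa [show m + 1 + (N + 1) = m + N + 1 + 1 by omega] at this
  · rw [hbd, map_smul, show m + N + 1 + 1 = m + 2 + N by omega, augOp_parity_add hN,
      parity_succ (m + 1), augOp_bar, smul_zero]
  · have h2 := hF.bd _ _ (jmul_mem hb.mem (bd_mem hc.mem))
    rw [augOp_parity_add hN, bd_jmul hb.mem, bd_bd_apply, map_zero, smul_zero, add_zero] at h2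
    rw [hbd, map_smul, ← h2,
      apply_jmul_bd_left hp.out.pos hF hN (bd_mem hc.mem) hT (bd_bd_apply _ _) hb.mem hb.cycle]
    exact smul_ne_zero (pow_ne_zero _ (neg_ne_zero.2 one_ne_zero))
      (mul_ne_zero (hb.ne_zero _ hF.restrict_left) (hc.ne_zero _ hF.restrict_right))

/-- For products in which the other factor has no detecting chain, that is, index 0 modulo p. -/
theorem Detects.join_empty_left {m : ℕ} {b : L.AugChain (ZMod p)} (hb : L.Detects m b) :
    (K.join L).Detects m (jmul K L _ (K.gen _ K.emptyCell) b) := by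
  refine ⟨jmul_empty_mem hb.mem, ?_, fun F hF => ?_⟩
  · rw [bd_jmul_empty_left, augOp_jmul_of_left_invariant _ T_empty, hb.cycle, map_zero]
  · rw [bd_jmul_empty_left]
    exact hb.ne_zero _ hF.restrict_right

theorem Detects.join_empty_right {m : ℕ} {b : K.AugChain (ZMod p)} (hb : K.Detects m b) :
    (K.join L).Detects m (jmul K L _ b (L.gen _ L.emptyCell)) := by
  refine ⟨jmul_mem hb.mem emptyCell_mem, ?_, fun F hF => ?_⟩
  · rw [bd_jmul_empty_right hb.mem, augOp_jmul_of_right_invariant _ _ T_empty, hb.cycle, map_zero,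
      LinearMap.zero_apply]
  · rw [bd_jmul_empty_right hb.mem]
    exact hb.ne_zero _ hF.restrict_left

variable [Fintype V] [Fintype W]

theorem smithIndexMod_right_le_join (K : ZpComplex p V) (L : ZpComplex p W) :
    L.smithIndexMod p ≤ (K.join L).smithIndexMod p := by
  rcases h : L.smithIndexMod p with _ | N
  · exact Nat.zero_le _
  · obtain ⟨c, hc⟩ := exists_detects_of_lt_smithIndexMod (K := L) (N := N) (by omega)
    exact (hc.join_empty_left (K := K)).lt_smithIndexMod hp.out.pos

theorem Detects.add_le_join_right {N : ℕ} (hN : Even N ∨ p = 2) {c : K.AugChain (ZMod p)}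
    (hc : K.Detects N c) (hT : K.T _ (K.bd _ c) = K.bd _ c) (L : ZpComplex p W) :
    N + 1 + L.smithIndexMod p ≤ (K.join L).smithIndexMod p := by
  rcases h : L.smithIndexMod p with _ | m
  · exact (hc.join_empty_right (L := L)).lt_smithIndexMod hp.out.pos
  · obtain ⟨b, hb⟩ := exists_detects_of_lt_smithIndexMod (K := L) (N := m) (by omega)
    have := (hc.join_right hN hT hb).lt_smithIndexMod hp.out.pos
    omega

theorem Detects.add_le_join_left {N : ℕ} (hN : Even N ∨ p = 2) {c : L.AugChain (ZMod p)}
    (hc : L.Detects N c) (hT : L.T _ (L.bd _ c) = L.bd _ c) (K : ZpComplex p V) :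
    K.smithIndexMod p + (N + 1) ≤ (K.join L).smithIndexMod p := by
  rcases h : K.smithIndexMod p with _ | m
  · have := (hc.join_empty_left (K := K)).lt_smithIndexMod hp.out.pos
    omega
  · obtain ⟨b, hb⟩ := exists_detects_of_lt_smithIndexMod (K := K) (N := m) (by omega)
    have := (hc.join_left hN hT hb).lt_smithIndexMod hp.out.pos
    omega

end

/-- The Smith index modulo `2` of a join is at least the sum of the indices. -/
theorem smithIndexMod_two_add_le_join [Fintype V] [Fintype W] (K : ZpComplex 2 V)
    (L : ZpComplex 2 W) :
    K.smithIndexMod 2 + L.smithIndexMod 2 ≤ (K.join L).smithIndexMod 2 := by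
  rcases h : K.smithIndexMod 2 with _ | N
  · rw [zero_add]; exact smithIndexMod_right_le_join K L
  · obtain ⟨c, hc⟩ := exists_detects_of_lt_smithIndexMod (K := K) (N := N) (by omega)
    refine hc.add_le_join_right (Or.inr rfl) ?_ L
    -- Modulo 2 the cycle condition, whatever its parity, says that ∂c is invariant.
    have := hc.cycle
    rw [augOp_two_eq K _ .d, augOp_d_apply, sub_eq_zero] at this
    exact this.symm

/-- The reduction of the dual chain works: c has an odd number m + 2 of vertices, so F(∂c) = F(sc),
the value of sψ on c, which is nonzero modulo p. By `apply_bd_eq` other resolutions have the same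
value. -/
theorem HasBoundaryEquivariantDual.exists_detects (hp : 0 < p)
    (h : K.HasBoundaryEquivariantDual) : ∃ N, Even N ∧ K.smithIndex = N + 1 ∧
      ∃ c, K.Detects N c ∧ K.T _ (K.bd _ c) = K.bd _ c := by
  obtain ⟨m, hm, hI, ψ, hψ, c, ⟨⟨y, hy⟩, hne⟩, y', hy'⟩ := h
  obtain ⟨F, hF, hr⟩ := exists_isAugResolution hψ
  have hred : K.bd (ZMod p) (K.red p (K.incl ℤ (m + 1) c)) =
      K.red p (K.incl ℤ m (K.boundary m c)) := by
    rw [incl_boundary, red_bd]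
  have hcyc : K.augOp (ZMod p) (parity (m + 1 + 1)) (K.bd _ (K.red p (K.incl ℤ (m + 1) c))) = 0 := by
    rw [parity_odd hm.add_one, ← bd_augOp, ← red_augOp, ← incl_op, ← red_bd, ← incl_boundary, hy,
      map_smul, red_eq_zero]
  refine ⟨m + 1, hm, hI, K.red p (K.incl ℤ (m + 1) c), ⟨red_mem (K.incl_mem c), hcyc,
    fun F' hF' => ?_⟩, ?_⟩
  · rw [hF'.apply_bd_eq hp (hF.redF p) (red_mem (K.incl_mem c)) hcyc, ← red_bd, redF_red,
      hF.bd _ _ (K.incl_mem c), parity_odd hm.add_one, ← incl_op, Ne,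
      ZMod.intCast_zmod_eq_zero_iff_dvd]
    rw [← hr] at hne
    exact hne
  · have := congrArg (fun z => K.red p (K.incl ℤ m z)) hy'
    simp only [incl_op, red_augOp, map_smul, ← hred] at this
    rw [← map_smul, red_eq_zero, augOp_d_apply, sub_eq_zero] at this
    exact this.symm

end ZpComplex

end

/-! ### Involutions: a join whose Smith class vanishes because of 2-torsion -/

noncomputable section

namespace ZpComplex

open Special

variable {V W : Type*} [LinearOrder V] [LinearOrder W] {K : ZpComplex 2 V} {L : ZpComplex 2 W}

theorem augOp_s_two (x : K.AugChain ℤ) : K.augOp ℤ .s x = x + K.T ℤ x := by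
  rw [augOp_s_apply, Finset.sum_range_succ, Finset.sum_range_one, pow_zero, pow_one]
  rfl

theorem T_T_two (x : K.AugChain ℤ) : K.T ℤ (K.T ℤ x) = x := by
  have := LinearMap.congr_fun (K.T_pow_p (R := ℤ)) x
  rwa [pow_two] at this

/-- If twice the top cochain of a resolution for `L` is a coboundary, the Smith class of the join
with a complex `K` whose top Smith class is even vanishes. -/
theorem isSmithClass_join_zero_of_torsion [Fintype V] {n m : ℕ} (hn : Even n) (hm : Even m)
    (hK : ∃ a, K.IsSmithClass n a ∧ K.cohomologyReduce 2 n (parity n) a = 0)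
    (hdim : ∀ σ : K.Cell, σ.1.card ≠ n + 2) {F' l : L.AugChain ℤ →ₗ[ℤ] ℤ}
    (hF' : IsAugResolution F') (hF0' : ∀ k, m + 1 < k → ∀ x ∈ L.H ℤ k, F' x = 0)
    (hl : ∀ x ∈ L.H ℤ (m + 1), l (L.bd ℤ x) = 2 * F' x) :
    (K.join L).IsSmithClass (n + m + 1) 0 := by
  obtain ⟨F₀, η, hF₀, hη⟩ := exists_divisible_of_isSmithClass_mod Nat.prime_two hK
  obtain ⟨F, hF, hF0, hFe, -⟩ := hF₀.exists_top two_pos hη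
  have hFe := hFe hn
  have hJ := hF.joinF hF'
  let c : ℕ → ℕ → K.AugChain ℤ →ₗ[ℤ] L.AugChain ℤ →ₗ[ℤ] ℤ := fun a b =>
    if a = n + 1 ∧ b = m then prodForm η (l - F') else 0
  have hc : ∀ x y, c (n + 1) m x y = η x * (l y - F' y) := fun x y => by
    simp only [c, and_self, if_true]; rfl
  have hc0 : ∀ a b, ¬ (a = n + 1 ∧ b = m) → ∀ x y, c a b x y = 0 := fun a b h x y => by
    simp only [c, if_neg h]; rfl
  -- Nothing is known about the coboundary of η; the absence of simplices with n + 2 vertices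
  -- removes the term in which it would occur.
  have hno : ∀ {x : K.AugChain ℤ}, x ∈ K.H ℤ (n + 2) → x = 0 := fun hx =>
    eqOn_H (f := LinearMap.id) (g := 0) (fun σ hσ => absurd hσ (hdim σ)) hx
  have hu0 : ∀ a b, ¬ (a = n + 1 ∧ b = m + 1) → ∀ x ∈ K.H ℤ a, ∀ y ∈ L.H ℤ b,
      joinGlue c ((K.join L).bd ℤ (jmul K L ℤ x y)) = 0 := by
    intro a b h x hx y hy
    have h1 : joinGlue c (jmul K L ℤ x (L.bd ℤ y)) = 0 := by
      rcases b with _ | b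
      · rw [bd_zero_mem hy, map_zero, map_zero]
      · rw [joinGlue_jmul c hx (bd_mem hy)]
        exact hc0 _ _ (by omega) _ _
    have h2 : joinGlue c (jmul K L ℤ (K.bd ℤ x) y) = 0 := by
      rcases a with _ | a
      · rw [bd_zero_mem hx, map_zero, LinearMap.zero_apply, map_zero]
      · rw [joinGlue_jmul c (bd_mem hx) hy]
        by_cases h : a = n + 1 ∧ b = m
        · obtain ⟨rfl, rfl⟩ := h
          rw [hno hx, map_zero, map_zero, LinearMap.zero_apply]
        · exact hc0 _ _ h _ _
    rw [bd_jmul hx, map_add, map_smul, h1, h2, smul_zero, add_zero]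
  have hu : ∀ x ∈ K.H ℤ (n + 1), ∀ y ∈ L.H ℤ (m + 1),
      joinGlue c ((K.join L).bd ℤ (jmul K L ℤ x y)) = - (η x * (F' y - F' (L.T ℤ y))) := by
    intro x hx y hy
    rw [bd_jmul hx, map_add, map_smul, joinGlue_jmul c (bd_mem hx) hy,
      joinGlue_jmul c hx (bd_mem hy), hc, hc0 _ _ (by omega), hl y hy, hF'.bd _ y hy,
      parity_odd hm.add_one, augOp_s_two, map_add, hn.add_one.neg_one_pow]
    simp only [smul_eq_mul]
    ring
  -- Composition with d makes G special. As l∂ = 2F' and F'∂ = F' + F'T, the coboundary of η ⊗ (l -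
  -- F') at (x, y) is -η(x)(F'(y) - F'(Ty)). Passing to -d gives (η(x) + η(Tx))(F'(y) - F'(Ty));
  -- since F = ηs, this is the coboundary of the join resolution.
  refine isSmithClass_zero_of_eq (G := -(joinGlue c ∘ₗ (K.join L).augOp ℤ .d)) hJ
    (fun h => by omega) (fun z hz => ?_) (fun z hz => ?_)
  · rw [parity_odd (hn.add hm).add_one, LinearMap.neg_apply, LinearMap.comp_apply, augOp_d_s,
      map_zero, neg_zero]
  · refine eqOn_join_H (f := joinF F F' ∘ₗ (K.join L).bd ℤ)
      (g := -(joinGlue c ∘ₗ (K.join L).augOp ℤ .d) ∘ₗ (K.join L).bd ℤ)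
      (fun a b hab x hx y hy => ?_) hz
    simp only [LinearMap.comp_apply, LinearMap.neg_apply]
    rw [← bd_augOp, augOp_d_apply, T_jmul, map_sub, map_sub]
    by_cases h : a = n + 1 ∧ b = m + 1
    · obtain ⟨rfl, rfl⟩ := h
      rw [hu x hx y hy, hu _ (T_mem hx) _ (T_mem hy), T_T_two, bd_jmul hx, map_add, map_smul,
        joinF_of_even_odd hn hm.add_one (bd_mem hx) hy, joinF_of_even hm hx (bd_mem hy),
        ← bd_T, hF.bd_odd hn.add_one (T_mem hx), ← map_sum, ← augOp_s_apply, s_T,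
        hF'.bd _ y hy, parity_odd hm.add_one, augOp_s_two y, map_add F' y,
        hFe _ (augOp_mem _ hx), hFe x hx, s_s, map_smul, augOp_s_two x, map_add η x,
        hn.add_one.neg_one_pow]
      simp only [smul_eq_mul]
      push_cast
      ring
    · rw [hu0 a b h x hx y hy, hu0 a b h _ (T_mem hx) _ (T_mem hy), hJ.bd _ _ (jmul_mem hx hy)]
      rw [joinF_augOp_eq_zero hF0 hF0' (by omega) _ hx hy]
      simp

end ZpComplex

end

noncomputable section

namespace ZpComplex

open Special

/-! ### Explicit complexes with an involution -/

section Explicit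

variable {V : Type*} [LinearOrder V]

/-- The vertex set of a triangle. -/
def tri (x : V × V × V) : Finset V := {x.1, x.2.1, x.2.2}

/-- The complex with an involution whose maximal simplices are the triangles in `A`, possibly
degenerate, and their images. -/
def ofTriangles (A : List (V × V × V)) (t : Equiv.Perm V) (ht : ∀ v, t (t v) = v)
    (hA : ∀ v, ∃ x ∈ A, v ∈ tri x ∨ t v ∈ tri x) (hfree : A.Forall fun x => ∀ v ∈ tri x, t v ∉ tri x) :
    ZpComplex 2 V where
  faces := {σ | σ.Nonempty ∧ ∃ x ∈ A, σ ⊆ tri x ∨ σ.map t.toEmbedding ⊆ tri x}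
  isRelLowerSet_faces := by
    rintro σ ⟨hσ, x, hx, h⟩
    exact ⟨hσ, fun ρ hρ hne => ⟨hne, x, hx, h.imp hρ.trans (Finset.map_subset_map.2 hρ).trans⟩⟩
  singleton_mem := fun v => by
    obtain ⟨x, hx, h⟩ := hA v
    exact ⟨Finset.singleton_nonempty v, x, hx, by simpa using h⟩
  t := t
  t_pow := by ext v; simp [pow_two, ht]
  map_mem := by
    rintro σ ⟨hσ, x, hx, h⟩
    refine ⟨hσ.map, x, hx, h.symm.imp id fun h => ?_⟩
    intro v hv
    simp only [Finset.mem_map, Equiv.coe_toEmbedding, exists_exists_and_eq_and, ht] at hv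
    obtain ⟨v, hv, rfl⟩ := hv
    exact h hv
  simple := by
    rintro σ ⟨⟨v, hv⟩, x, hx, h⟩ k hk hσ
    -- Only odd k are excluded by the definition of a simple action, and t² = 1.
    have hk' : t ^ k = t := by
      obtain ⟨m, rfl⟩ := Nat.not_even_iff_odd.1 fun h => hk h.two_dvd
      have : t ^ 2 = 1 := by ext v; simp [pow_two, ht]
      rw [pow_succ, pow_mul, this, one_pow, one_mul]
    rw [hk'] at hσ
    have hv' : t v ∈ σ := hσ ▸ Finset.mem_map_of_mem t.toEmbedding hv
    rcases h with h | h
    · exact List.forall_iff_forall_mem.1 hfree x hx v (h hv) (h hv')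
    · exact List.forall_iff_forall_mem.1 hfree x hx _ (h (Finset.mem_map_of_mem t.toEmbedding hv))
        (h (Finset.mem_map_of_mem t.toEmbedding hv'))

section

variable {A : List (V × V × V)} {t : Equiv.Perm V} {ht : ∀ v, t (t v) = v}
  {hA : ∀ v, ∃ x ∈ A, v ∈ tri x ∨ t v ∈ tri x} {hfree : A.Forall fun x => ∀ v ∈ tri x, t v ∉ tri x}

/-- All non-empty faces of a triangle satisfy `P`. -/
abbrev AllFaces (P : Finset V → Prop) (x : V × V × V) : Prop :=
  P {x.1} ∧ P {x.2.1} ∧ P {x.2.2} ∧ P {x.1, x.2.1} ∧ P {x.2.1, x.2.2} ∧ P {x.1, x.2.2} ∧ P (tri x)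

theorem of_subset_tri {P : Finset V → Prop} (h0 : P ∅) {x : V × V × V} (h : AllFaces P x)
    {σ : Finset V} (hσ : σ ⊆ tri x) : P σ := by
  obtain ⟨h1, h2, h3, h12, h23, h13, h123⟩ := h
  obtain ⟨a, b, c⟩ := x
  have key : ∀ τ, P τ → (∀ v, v ∈ σ ↔ v ∈ τ) → P σ := fun τ hτ h => Finset.ext h ▸ hτ
  have hσ' : ∀ v ∈ σ, v = a ∨ v = b ∨ v = c := fun v hv => by simpa [tri] using hσ hv
  by_cases ha : a ∈ σ <;> by_cases hb : b ∈ σ <;> by_cases hc : c ∈ σ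
  · exact key _ h123 (by simp only [tri, Finset.mem_insert, Finset.mem_singleton]; grind)
  · exact key _ h12 (by simp only [Finset.mem_insert, Finset.mem_singleton]; grind)
  · exact key _ h13 (by simp only [Finset.mem_insert, Finset.mem_singleton]; grind)
  · exact key _ h1 (by simp only [Finset.mem_singleton]; grind)
  · exact key _ h23 (by simp only [Finset.mem_insert, Finset.mem_singleton]; grind)
  · exact key _ h2 (by simp only [Finset.mem_singleton]; grind)
  · exact key _ h3 (by simp only [Finset.mem_singleton]; grind)
  · exact key _ h0 (by simp only [Finset.notMem_empty]; grind)

/-- Reduces a statement about all cells to a decidable check of the faces of the listed triangles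
and of their images. -/
theorem forall_cell_ofTriangles {P : Finset V → Prop} (h0 : P ∅)
    (h : A.Forall fun x => AllFaces P x ∧ AllFaces P (t x.1, t x.2.1, t x.2.2))
    (σ : (ofTriangles A t ht hA hfree).Cell) : P σ.1 := by
  rw [List.forall_iff_forall_mem] at h
  obtain ⟨σ, rfl | ⟨-, x, hx, hσ | hσ⟩⟩ := σ
  · exact h0
  · exact of_subset_tri h0 (h x hx).1 hσ
  · refine of_subset_tri h0 (h x hx).2 fun v hv => ?_
    have := hσ (Finset.mem_map_of_mem t.toEmbedding hv)
    have h2 : ∀ u, t v = u ↔ v = t u := fun u => by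
      rw [← t.injective.eq_iff (b := t u), ht]
    simpa [tri, h2] using this

theorem card_cell_ofTriangles_le (σ : (ofTriangles A t ht hA hfree).Cell) : σ.1.card ≤ 3 := by
  obtain ⟨σ, rfl | ⟨-, x, hx, h1 | h1⟩⟩ := σ
  · exact Nat.zero_le _
  · exact (Finset.card_le_card h1).trans Finset.card_le_three
  · rw [← Finset.card_map t.toEmbedding]
    exact (Finset.card_le_card h1).trans Finset.card_le_three

end

variable {K : ZpComplex 2 V}

/-- The functional with the values `φ` on simplices. -/
def evalOn (K : ZpComplex 2 V) (φ : Finset V → ℤ) : K.AugChain ℤ →ₗ[ℤ] ℤ :=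
  Finsupp.linearCombination ℤ fun σ => φ σ.1

theorem evalOn_gen (φ : Finset V → ℤ) (σ : K.Cell) : K.evalOn φ (K.gen ℤ σ) = φ σ.1 := by
  simp [evalOn]

/-- The coboundary of the function `φ` on simplices. -/
def cobd (φ : Finset V → ℤ) (σ : Finset V) : ℤ :=
  ∑ v ∈ σ, (-1) ^ position σ v * φ (σ.erase v)

/-- The function obtained from `φ` by the action of `t`. -/
def pull (t : Equiv.Perm V) (φ : Finset V → ℤ) (σ : Finset V) : ℤ :=
  (-1) ^ inversions t σ * φ (σ.map t.toEmbedding)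

theorem evalOn_bd (φ : Finset V → ℤ) (x : K.AugChain ℤ) :
    K.evalOn φ (K.bd ℤ x) = K.evalOn (cobd φ) x := by
  refine LinearMap.congr_fun (f := K.evalOn φ ∘ₗ K.bd ℤ) (augChain_hom_ext fun σ => ?_) x
  rw [LinearMap.comp_apply, bd_gen, map_sum, evalOn_gen]
  refine Finset.sum_congr rfl fun v _ => ?_
  rw [map_smul, evalOn_gen]; rfl

theorem evalOn_T (φ : Finset V → ℤ) (x : K.AugChain ℤ) :
    K.evalOn φ (K.T ℤ x) = K.evalOn (pull K.t φ) x := by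
  refine LinearMap.congr_fun (f := K.evalOn φ ∘ₗ K.T ℤ) (augChain_hom_ext fun σ => ?_) x
  rw [LinearMap.comp_apply, T_gen, map_smul, evalOn_gen, evalOn_gen, smul_eq_mul]
  simp only [powCell, pow_one, pull]

theorem evalOn_eq {φ φ' : Finset V → ℤ} {n : ℕ}
    (h : ∀ σ : K.Cell, σ.1.card = n → φ σ.1 = φ' σ.1) {x : K.AugChain ℤ} (hx : x ∈ K.H ℤ n) :
    K.evalOn φ x = K.evalOn φ' x :=
  eqOn_H (fun σ hσ => by rw [evalOn_gen, evalOn_gen, h σ hσ]) hx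

/-- For an involution d = 1 - t and s = 1 + t, so the sign (-1)^card merges both kinds of relations
into one that can be checked simplex by simplex. -/
theorem isAugResolution_evalOn {φ : Finset V → ℤ} (h0 : φ ∅ = 1)
    (h : ∀ σ : K.Cell, cobd φ σ.1 = φ σ.1 - (-1) ^ σ.1.card * pull K.t φ σ.1) :
    IsAugResolution (K.evalOn φ) := by
  refine ⟨(evalOn_gen φ _).trans h0, fun n x hx => ?_⟩
  refine eqOn_H (f := K.evalOn φ ∘ₗ K.bd ℤ) (g := K.evalOn φ ∘ₗ K.augOp ℤ (parity n))
    (fun σ hσ => ?_) hx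
  rw [LinearMap.comp_apply, LinearMap.comp_apply, evalOn_bd, evalOn_gen, h, hσ]
  rcases Nat.even_or_odd n with hn | hn
  · rw [parity_even hn, augOp_d_apply, map_sub, evalOn_T, evalOn_gen, evalOn_gen, hn.neg_one_pow,
      one_mul]
  · rw [parity_odd hn, augOp_s_two, map_add, evalOn_T, evalOn_gen, evalOn_gen, hn.neg_one_pow]
    ring

variable [Fintype V]

/-- The chain with coefficients `f`. -/
def chainOf (K : ZpComplex 2 V) (f : Finset V → ℤ) : K.AugChain ℤ :=
  Finsupp.equivFunOnFinite.symm fun σ => f σ.1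

theorem chainOf_apply (f : Finset V → ℤ) (σ : K.Cell) : K.chainOf f σ = f σ.1 := rfl

/-- The boundary of the chain with coefficients `f`. -/
def bdCoeff (f : Finset V → ℤ) (ρ : Finset V) : ℤ :=
  ∑ v, if v ∈ ρ then 0 else (-1) ^ position (insert v ρ) v * f (insert v ρ)

theorem chainOf_eq_sum (f : Finset V → ℤ) [Fintype K.Cell] :
    K.chainOf f = ∑ σ : K.Cell, f σ.1 • K.gen ℤ σ := by
  ext ρ
  simp [chainOf_apply, Finsupp.finsetSum_apply, Finsupp.single_apply]

/-- `bdCoeff` runs over all sets ρ ∪ {v}, simplices or not; the hypothesis makes f vanish on those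
that are not cells. -/
theorem bd_chainOf {f : Finset V → ℤ} (hf : ∀ σ, f σ ≠ 0 → σ = ∅ ∨ σ ∈ K.faces) :
    K.bd ℤ (K.chainOf f) = K.chainOf (bdCoeff f) := by
  classical
  have := Fintype.ofFinite K.Cell
  ext ρ
  rw [chainOf_apply, chainOf_eq_sum, map_sum, Finsupp.finsetSum_apply]
  have h1 : ∀ σ : K.Cell, (K.bd ℤ (f σ.1 • K.gen ℤ σ)) ρ =
      ∑ v, if v ∈ σ.1 ∧ σ.1.erase v = ρ.1 then (-1) ^ position σ.1 v * f σ.1 else 0 := fun σ => by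
    rw [map_smul, bd_gen, Finset.smul_sum, Finsupp.finsetSum_apply,
      ← Finset.sum_filter_add_sum_filter_not Finset.univ (· ∈ σ.1),
      Finset.sum_eq_zero (s := Finset.univ.filter (¬ · ∈ σ.1)), add_zero,
      Finset.filter_mem_eq_inter, Finset.univ_inter]
    · refine Finset.sum_congr rfl fun v hv => ?_
      simp only [Finsupp.smul_apply, Finsupp.single_apply, eraseCell, Subtype.ext_iff, hv, true_and]
      split_ifs <;> simp [mul_comm]
    · intro v hv
      rw [if_neg]
      rintro ⟨h, -⟩
      exact (Finset.mem_filter.1 hv).2 h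
  rw [Finset.sum_congr rfl fun σ _ => h1 σ, Finset.sum_comm, bdCoeff]
  refine Finset.sum_congr rfl fun v _ => ?_
  split_ifs with hv
  · refine Finset.sum_eq_zero fun σ _ => if_neg ?_
    rintro ⟨-, h⟩
    rw [← h] at hv
    exact Finset.notMem_erase _ _ hv
  · by_cases h : insert v ρ.1 = ∅ ∨ insert v ρ.1 ∈ K.faces
    · rw [Finset.sum_eq_single (⟨insert v ρ.1, h⟩ : K.Cell), if_pos]
      · exact ⟨Finset.mem_insert_self _ _, Finset.erase_insert hv⟩
      · intro σ _ hσ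
        rw [if_neg]
        rintro ⟨h1, h2⟩
        exact hσ (Subtype.ext (by rw [← Finset.insert_erase h1, h2]))
      · exact fun h => absurd (Finset.mem_univ _) h
    · rw [not_ne_iff.1 (mt (hf _) h), mul_zero]
      refine Finset.sum_eq_zero fun σ _ => if_neg ?_
      rintro ⟨h1, h2⟩
      rw [← h2, Finset.insert_erase h1] at h
      exact h σ.2

/-- A pushforward would normally involve the inverse of t. Here t is an involution, and its signs on
ρ and on tρ agree because their product is the sign of the identity. -/
theorem T_chainOf (f : Finset V → ℤ) : K.T ℤ (K.chainOf f) = K.chainOf (pull K.t f) := by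
  classical
  have := Fintype.ofFinite K.Cell
  have hT : ∀ σ : K.Cell, K.powCell 1 (K.powCell 1 σ) = σ := fun σ => by
    rw [powCell_comp]; exact K.powCell_p σ
  have hm : ∀ σ : K.Cell, σ.1.map K.t.toEmbedding = (K.powCell 1 σ).1 := fun σ => by
    simp only [powCell, pow_one]
  ext ρ
  rw [chainOf_apply, chainOf_eq_sum, map_sum, Finsupp.finsetSum_apply,
    Finset.sum_eq_single (K.powCell 1 ρ)]
  · obtain ⟨c, hc⟩ := inversions_mul K.t K.t ρ.1
    have h2 : K.t * K.t = 1 := (pow_two _).symm.trans K.t_pow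
    rw [h2, inversions_one, hm] at hc
    have h3 : (-1 : ℤ) ^ (inversions K.t (K.powCell 1 ρ).1) = (-1) ^ inversions K.t ρ.1 := by
      have h4 : (-1 : ℤ) ^ (inversions K.t ρ.1 + inversions K.t (K.powCell 1 ρ).1) = 1 :=
        neg_one_pow_of_add_two_mul ℤ hc
      rw [pow_add] at h4
      rcases neg_one_pow_eq_or ℤ (inversions K.t ρ.1) with h | h <;> rw [h] at h4 ⊢ <;> linarith
    rw [map_smul, T_gen, hT, h3, pull, hm]
    simp [mul_comm]
  · intro σ _ hσ
    rw [map_smul, T_gen, Finsupp.smul_apply, Finsupp.smul_apply, Finsupp.single_eq_of_ne,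
      smul_zero, smul_zero]
    rintro rfl
    exact hσ (hT σ).symm
  · exact fun h => absurd (Finset.mem_univ _) h

theorem chainOf_mem {f : Finset V → ℤ} {n : ℕ} (hf : ∀ σ, f σ ≠ 0 → σ.card = n) :
    K.chainOf f ∈ K.H ℤ n :=
  (Finsupp.mem_supported _ _).2 fun σ hσ => hf σ.1 (Finsupp.mem_support_iff.1 hσ)

theorem ext_H {x y : K.AugChain ℤ} {n : ℕ} (hx : x ∈ K.H ℤ n) (hy : y ∈ K.H ℤ n)
    (h : ∀ σ : K.Cell, σ.1.card = n → x σ = y σ) : x = y := by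
  ext σ
  by_cases hσ : σ.1.card = n
  · exact h σ hσ
  · rw [Finsupp.notMem_support_iff.1 fun h => hσ ((Finsupp.mem_supported _ _).1 hx h),
      Finsupp.notMem_support_iff.1 fun h => hσ ((Finsupp.mem_supported _ _).1 hy h)]

/-- The function with value `1` on `P`, `-1` on `N` and `0` elsewhere. -/
def signed (P N : List (Finset V)) (σ : Finset V) : ℤ :=
  if σ ∈ P then 1 else if σ ∈ N then -1 else 0

theorem mem_of_signed_ne_zero {P N : List (Finset V)} {σ : Finset V} (h : signed P N σ ≠ 0) :
    σ ∈ P ∨ σ ∈ N := by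
  unfold signed at h
  split_ifs at h with h1 h2
  · exact Or.inl h1
  · exact Or.inr h2
  · exact absurd rfl h

theorem gen_eq_chainOf (σ : K.Cell) : K.gen ℤ σ = K.chainOf (signed [σ.1] []) := by
  ext ρ
  rw [chainOf_apply, Finsupp.single_apply]
  simp [signed, Subtype.ext_iff, eq_comm]

theorem chainOf_signed_mem {P N : List (Finset V)} {n : ℕ}
    (h : (P ++ N).Forall fun σ => σ.card = n) : K.chainOf (signed P N) ∈ K.H ℤ n :=
  chainOf_mem fun σ hσ =>
    List.forall_iff_forall_mem.1 h σ (List.mem_append.2 (mem_of_signed_ne_zero hσ))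

/-- The function g is a computable form of the coefficients of z, so the boundary formula becomes a
finite computation. -/
theorem bd_chainOf_signed_eq {A : List (V × V × V)} {t : Equiv.Perm V} {ht : ∀ v, t (t v) = v}
    {hA : ∀ v, ∃ x ∈ A, v ∈ tri x ∨ t v ∈ tri x} {hfree : A.Forall fun x => ∀ v ∈ tri x, t v ∉ tri x}
    {P N : List (Finset V)} {n : ℕ}
    (h : (P ++ N).Forall fun σ => σ.card = n + 2 ∧ ∃ x ∈ A, σ ⊆ tri x)
    {z : (ofTriangles A t ht hA hfree).AugChain ℤ}
    (hz : z ∈ (ofTriangles A t ht hA hfree).H ℤ (n + 1)) {g : Finset V → ℤ} (hg : ∀ σ, z σ = g σ.1)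
    (hbd : A.Forall fun x => AllFaces (fun σ => σ.card = n + 1 → bdCoeff (signed P N) σ = g σ) x ∧
      AllFaces (fun σ => σ.card = n + 1 → bdCoeff (signed P N) σ = g σ) (t x.1, t x.2.1, t x.2.2)) :
    (ofTriangles A t ht hA hfree).bd ℤ ((ofTriangles A t ht hA hfree).chainOf (signed P N)) = z := by
  refine ext_H (bd_mem (chainOf_signed_mem (h.imp fun σ hσ => hσ.1))) hz fun σ hσ => ?_
  rw [bd_chainOf, chainOf_apply, hg]
  · exact forall_cell_ofTriangles (fun h => absurd h n.succ_ne_zero.symm) hbd σ hσ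
  · intro σ hσ
    obtain ⟨h1, x, hx, h2⟩ :=
      List.forall_iff_forall_mem.1 h σ (List.mem_append.2 (mem_of_signed_ne_zero hσ))
    exact Or.inr ⟨Finset.card_pos.1 (by omega), x, hx, Or.inl h2⟩

end Explicit

/-! ### The Smith index of complexes of dimension two -/

section Criteria

variable {V : Type*} [LinearOrder V] {K : ZpComplex 2 V}

/-- The relations give F(dy) = F(Tv) - F(v) and F(v) + F(Tv) = 1, so F(dy) is odd; F(sy) differs
from it by 2F(Ty). -/
theorem IsAugResolution.apply_s_eq {F : K.AugChain ℤ →ₗ[ℤ] ℤ} (hF : IsAugResolution F)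
    {y : K.AugChain ℤ} (hy : y ∈ K.H ℤ 2) {v : K.Cell} (hv : v.1.card = 1)
    (h : K.bd ℤ y = K.T ℤ (K.gen ℤ v) - K.gen ℤ v) : ∃ k, F (K.augOp ℤ .s y) = 2 * k + 1 := by
  have h1 := hF.bd 2 y hy
  have h2 := hF.apply_s_gen hv
  rw [parity_even even_two, augOp_d_apply, h, map_sub, map_sub] at h1
  rw [augOp_s_two, map_add] at h2
  refine ⟨F (K.T ℤ y) - F (K.gen ℤ v), ?_⟩
  rw [augOp_s_two, map_add]
  linarith

theorem exists_smithClass_reduce_eq_zero {q N : ℕ} {F : K.AugChain ℤ →ₗ[ℤ] ℤ}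
    (hF : IsAugResolution F) (h : ∀ x ∈ K.H ℤ (N + 1), (q : ℤ) ∣ F x) :
    ∃ a, K.IsSmithClass N a ∧ K.cohomologyReduce q N (parity N) a = 0 := by
  refine isSmithClass_mod_iff.2 ⟨F, hF, ?_⟩
  have : K.restr (redF q (F ∘ₗ K.augOp ℤ (parity (N + 1)))) N = 0 :=
    restr_eq_iff (G := 0) |>.2 fun x hx => eqOn_H (fun σ hσ => by
      rw [← red_gen, redF_red, LinearMap.zero_apply, ZMod.intCast_zmod_eq_zero_iff_dvd]
      exact h _ (augOp_mem _ (gen_mem hσ))) hx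
  rw [smithOp_restr, reduce_restr, this]
  exact Submodule.zero_mem _

variable [Fintype V]

/-- A resolution modulo 2 need not be the reduction of an integral one, but its value on ∂c does not
depend on the choice, so one integral resolution decides. -/
theorem detects_red {N : ℕ} {c w : K.AugChain ℤ} (hc : c ∈ K.H ℤ (N + 1))
    (hw : K.augOp ℤ (parity (N + 1)) (K.bd ℤ c) = (2 : ℤ) • w)
    (h : ∀ F : K.AugChain ℤ →ₗ[ℤ] ℤ, IsAugResolution F → ∃ k, F (K.bd ℤ c) = 2 * k + 1) :
    K.Detects N (K.red 2 c) := by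
  have hcyc : K.augOp (ZMod 2) (parity (N + 1)) (K.bd (ZMod 2) (K.red 2 c)) = 0 := by
    rw [← red_bd, ← red_augOp, hw]
    exact red_eq_zero w
  refine ⟨red_mem hc, hcyc, fun F hF => ?_⟩
  obtain ⟨F₀, hF₀⟩ := exists_resolution two_pos K ℤ
  obtain ⟨k, hk⟩ := h F₀ hF₀
  rw [hF.apply_bd_eq two_pos (hF₀.redF 2) (red_mem hc) hcyc, ← red_bd, redF_red, hk]
  push_cast
  rw [show (2 : ZMod 2) = 0 from rfl, zero_mul, zero_add]
  exact one_ne_zero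

theorem smithIndex_eq_one [Nonempty V] (h : ∀ σ : K.Cell, σ.1.card ≠ 2) :
    K.smithIndexMod 2 = 1 ∧ K.smithIndex = 1 := by
  obtain ⟨v⟩ := ‹Nonempty V›
  obtain ⟨F, hF⟩ := exists_resolution two_pos K ℤ
  let σ : K.Cell := ⟨{v}, Or.inr (K.singleton_mem v)⟩
  have hσ : σ.1.card = 1 := Finset.card_singleton v
  have h1 : 0 < K.smithIndexMod 2 := by
    refine (detects_red (w := K.gen ℤ K.emptyCell) (gen_mem hσ) ?_ fun F hF =>
      ⟨0, ?_⟩).lt_smithIndexMod two_pos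
    · rw [bd_gen_of_card_eq_one hσ, parity_odd (by decide), augOp_s_two, T_empty, two_smul]
    · rw [bd_gen_of_card_eq_one hσ, hF.empty]; rfl
  have h2 : K.smithIndex ≤ 1 := smithIndex_le (isSmithClass_zero_of_vanishing hF fun x hx =>
    eqOn_H (g := 0) (fun σ hσ => absurd hσ (h σ)) hx)
  have h3 := smithIndexMod_le_smithIndex two_pos K 2
  omega

variable {e y f : K.AugChain ℤ} {v : K.Cell}

theorem two_le_smithIndexMod (hy : y ∈ K.H ℤ 2) (hv : v.1.card = 1)
    (h : K.bd ℤ y = K.T ℤ (K.gen ℤ v) - K.gen ℤ v) : 2 ≤ K.smithIndexMod 2 := by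
  refine (detects_red (w := K.T ℤ (K.gen ℤ v) - K.gen ℤ v) (N := 1) hy ?_ fun F hF =>
    ⟨-F (K.gen ℤ v), ?_⟩).lt_smithIndexMod two_pos
  · rw [h, parity_even (by decide), augOp_d_apply, map_sub, T_T_two, two_smul]
    abel
  · have h2 := hF.apply_s_gen hv
    rw [augOp_s_two, map_add] at h2
    rw [h, map_sub]
    linarith

/-- If the boundary of `e` is twice `s y`, where `y` is an arc from a vertex to its image, the top
Smith class is non-zero, but it may vanish modulo `2`. -/
theorem smithIndex_eq_three (he : e ∈ K.H ℤ 3) (hy : y ∈ K.H ℤ 2) (hv : v.1.card = 1)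
    (h : K.bd ℤ y = K.T ℤ (K.gen ℤ v) - K.gen ℤ v) (h2 : K.bd ℤ e = (2 : ℤ) • K.augOp ℤ .s y)
    (hdim : ∀ σ : K.Cell, σ.1.card ≠ 4) {F : K.AugChain ℤ →ₗ[ℤ] ℤ} (hF : IsAugResolution F)
    (hF2 : ∀ x ∈ K.H ℤ 3, (2 : ℤ) ∣ F x) : K.smithIndexMod 2 = 2 ∧ K.smithIndex = 3 := by
  have h3 := two_le_smithIndexMod hy hv h
  have h4 : K.smithIndexMod 2 ≤ 2 := Nat.sInf_le (exists_smithClass_reduce_eq_zero hF hF2)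
  have h5 : K.smithIndex ≤ 3 := smithIndex_le (isSmithClass_zero_of_vanishing hF fun x hx =>
    eqOn_H (g := 0) (fun σ hσ => absurd hσ (hdim σ)) hx)
  have h6 := smithIndexMod_le_smithIndex two_pos K 2
  -- A resolution G vanishing on triangles would give 0 = G(se) = G(∂e) = 2G(sy), with G(sy) odd.
  have h7 : K.smithIndex ≠ 2 := fun h7 => by
    obtain ⟨G, hG, hG0⟩ := exists_vanishing_of_isSmithClass_zero
      (h7 ▸ isSmithClass_smithIndex two_pos K)
    obtain ⟨k, hk⟩ := hG.apply_s_eq hy hv h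
    have := hG.bd 3 e he
    rw [hG0 3 (by norm_num) _ (augOp_mem _ he), h2, map_smul, hk, smul_eq_mul] at this
    omega
  omega

/-- If the boundary of `e` is `s y` modulo `2`, where `y` is an arc from a vertex to its image, the
top Smith class is non-zero modulo `2`. -/
theorem smithIndexMod_eq_three (he : e ∈ K.H ℤ 3) (hy : y ∈ K.H ℤ 2) (hv : v.1.card = 1)
    (h : K.bd ℤ y = K.T ℤ (K.gen ℤ v) - K.gen ℤ v)
    (h2 : K.bd ℤ e = K.augOp ℤ .s y + (2 : ℤ) • f)
    (hdim : ∀ σ : K.Cell, σ.1.card ≠ 4) : K.smithIndexMod 2 = 3 ∧ K.smithIndex = 3 := by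
  obtain ⟨F, hF⟩ := exists_resolution two_pos K ℤ
  have h3 : 2 < K.smithIndexMod 2 := by
    refine (detects_red (w := K.augOp ℤ .s y + K.augOp ℤ .s f) (N := 2) he ?_ fun F hF =>
      ?_).lt_smithIndexMod two_pos
    · rw [h2, parity_odd (by decide), map_add, map_smul, s_s, smul_add]
      rfl
    · obtain ⟨k, hk⟩ := hF.apply_s_eq hy hv h
      refine ⟨k + F f, ?_⟩
      rw [h2, map_add, map_smul, hk, smul_eq_mul]
      ring
  have h5 : K.smithIndex ≤ 3 := smithIndex_le (isSmithClass_zero_of_vanishing hF fun x hx =>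
    eqOn_H (g := 0) (fun σ hσ => absurd hσ (hdim σ)) hx)
  have h6 := smithIndexMod_le_smithIndex two_pos K 2
  omega

/-- Index 3 is excluded modulo 4. A resolution G vanishing on chains with more than 3 vertices
satisfies G(∂(se ⊗ w)) = 0 for a vertex w of L. But ∂(se ⊗ w) = 4(sy ⊗ w) - se, while G(se) = G(∂e)
= 2G(sy) is twice an odd number. -/
theorem smithIndex_join_eq_four {W : Type*} [LinearOrder W] [Fintype W] {L : ZpComplex 2 W}
    [Nonempty W] (hL : ∀ σ : L.Cell, σ.1.card ≠ 2) (he : e ∈ K.H ℤ 3) (hy : y ∈ K.H ℤ 2)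
    (hv : v.1.card = 1) (h : K.bd ℤ y = K.T ℤ (K.gen ℤ v) - K.gen ℤ v)
    (h2 : K.bd ℤ e = (2 : ℤ) • K.augOp ℤ .s y) (hK : K.smithIndexMod 2 = 2)
    (hK' : K.smithIndex = 3) : (K.join L).smithIndex = 4 := by
  obtain ⟨h1L, h1L'⟩ := smithIndex_eq_one hL
  have h3 := smithIndexMod_two_add_le_join K L
  have h4 := smithIndex_join_le two_pos K L
  have h6 := smithIndexMod_le_smithIndex two_pos (K.join L) 2
  have h7 : (K.join L).smithIndex ≠ 3 := fun h7 => by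
    obtain ⟨G, hG, hG0⟩ := exists_vanishing_of_isSmithClass_zero
      (h7 ▸ isSmithClass_smithIndex two_pos (K.join L))
    obtain ⟨w⟩ := ‹Nonempty W›
    let τ : L.Cell := ⟨{w}, Or.inr (L.singleton_mem w)⟩
    have hτ : τ.1.card = 1 := Finset.card_singleton w
    have hx := jmul_mem (augOp_mem .s he) (gen_mem (R := ℤ) hτ)
    obtain ⟨k, hk⟩ := hG.restrict_left.apply_s_eq hy hv h
    have h8 := hG.restrict_left.bd 3 e he
    have h9 := hG.bd _ _ hx
    rw [hG0 4 (by norm_num) _ (augOp_mem _ hx), bd_jmul (augOp_mem _ he), bd_augOp, h2,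
      map_smul, s_s, bd_gen_of_card_eq_one hτ] at h9
    rw [h2, map_smul, hk, parity_odd (by decide)] at h8
    simp only [map_add, map_smul, LinearMap.smul_apply, smul_eq_mul, LinearMap.comp_apply,
      LinearMap.flip_apply] at h8 h9
    rw [← h8] at h9
    norm_num at h9
    omega
  omega

end Criteria

end ZpComplex

end

noncomputable section

namespace ZpComplex

open Special

/-! ### The examples -/

/-- The positively oriented triangles of a disc whose boundary runs twice around a circle. -/
def discPos : List (Fin 10 × Fin 10 × Fin 10) :=
  [(0, 1, 4), (1, 2, 4), (2, 3, 4), (0, 1, 5), (1, 2, 5), (2, 3, 6), (0, 4, 6), (4, 5, 6)]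

/-- The negatively oriented triangles of that disc. -/
def discNeg : List (Fin 10 × Fin 10 × Fin 10) := [(0, 3, 5), (0, 3, 6), (3, 4, 5), (2, 5, 6)]

/-- The action on the vertices `0, …, 3` of the circle and on the inner vertices of the discs. -/
def discPerm : Equiv.Perm (Fin 10) :=
  Function.Involutive.toPerm ![2, 3, 0, 1, 7, 8, 9, 4, 5, 6] (show ∀ v, _ by decide)

/-- Two discs glued to a circle by maps of degree two, with the antipodal action on the circle. -/
def discComplex : ZpComplex 2 (Fin 10) :=
  ofTriangles (discPos ++ discNeg) discPerm (by decide +kernel) (by decide +kernel)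
    (by decide +kernel)

/-- A resolution that is even on triangles. -/
def discResolution (σ : Finset (Fin 10)) : ℤ :=
  signed [∅, {2}, {3}, {7}, {8}, {9}, {1, 2}, {4, 5}, {5, 6}, {1, 8}, {0, 9}, {1, 9}, {7, 8}, {8, 9}]
    [{2, 4}, {3, 4}, {2, 5}] σ + 2 * signed [{0, 6}, {4, 6}, {2, 9}, {7, 9}] [{0, 3, 6}] σ

theorem isAugResolution_discResolution : IsAugResolution (discComplex.evalOn discResolution) :=
  isAugResolution_evalOn (by decide +kernel) (forall_cell_ofTriangles (P := fun σ =>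
    cobd discResolution σ = discResolution σ - (-1) ^ σ.card * pull discPerm discResolution σ)
    (by decide +kernel) (by decide +kernel))

/-- The oriented disc. -/
def discChain : discComplex.AugChain ℤ :=
  discComplex.chainOf (signed (discPos.map tri) (discNeg.map tri))

/-- An arc from a vertex of the circle to its antipode. -/
def discArc : discComplex.AugChain ℤ := discComplex.chainOf (signed [{0, 1}, {1, 2}] [])

/-- The starting point of `discArc`. -/
def discVertex : discComplex.Cell := ⟨{0}, Or.inr (discComplex.singleton_mem 0)⟩

theorem discChain_mem : discChain ∈ discComplex.H ℤ 3 := chainOf_signed_mem (by decide +kernel)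

theorem discArc_mem : discArc ∈ discComplex.H ℤ 2 := chainOf_signed_mem (by decide +kernel)

theorem bd_discArc : discComplex.bd ℤ discArc =
    discComplex.T ℤ (discComplex.gen ℤ discVertex) - discComplex.gen ℤ discVertex := by
  have hv : discVertex.1.card = 1 := rfl
  refine bd_chainOf_signed_eq (n := 0) (by decide +kernel)
    (sub_mem (T_mem (gen_mem hv)) (gen_mem hv)) (g := fun σ =>
      pull discPerm (signed [{0}] []) σ - signed [{0}] [] σ) (fun σ => ?_) (by decide +kernel)
  rw [gen_eq_chainOf, T_chainOf]
  rfl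

theorem bd_discChain : discComplex.bd ℤ discChain = (2 : ℤ) • discComplex.augOp ℤ .s discArc := by
  refine bd_chainOf_signed_eq (n := 1) (by decide +kernel)
    (Submodule.smul_mem _ _ (augOp_mem _ discArc_mem)) (g := fun σ =>
      2 * (signed [{0, 1}, {1, 2}] [] σ + pull discPerm (signed [{0, 1}, {1, 2}] []) σ))
    (fun σ => ?_) (by decide +kernel)
  rw [augOp_s_two, discArc, T_chainOf]
  rfl

theorem card_discComplex_cell (σ : discComplex.Cell) : σ.1.card ≠ 4 :=
  ne_of_lt (Nat.lt_succ_of_le (card_cell_ofTriangles_le σ))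

theorem discResolution_dvd : ∀ x ∈ discComplex.H ℤ 3, (2 : ℤ) ∣ discComplex.evalOn discResolution x := by
  intro x hx
  -- The only nonzero value of the resolution on a triangle is -2.
  have h : ∀ σ : discComplex.Cell, σ.1.card = 3 → discResolution σ % 2 = 0 :=
    forall_cell_ofTriangles (P := fun σ => σ.card = 3 → discResolution σ % 2 = 0) (by decide +kernel) (by decide +kernel)
  refine (ZMod.intCast_zmod_eq_zero_iff_dvd _ 2).1 ?_
  refine eqOn_H (f := (Int.castAddHom (ZMod 2)).toIntLinearMap ∘ₗ discComplex.evalOn discResolution)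
    (g := 0) (fun σ hσ => ?_) hx
  show ((discComplex.evalOn discResolution (discComplex.gen ℤ σ) : ℤ) : ZMod 2) = 0
  rw [evalOn_gen]
  exact (ZMod.intCast_zmod_eq_zero_iff_dvd _ 2).2 (Int.dvd_of_emod_eq_zero (h σ hσ))

theorem smithIndex_discComplex : discComplex.smithIndexMod 2 = 2 ∧ discComplex.smithIndex = 3 :=
  smithIndex_eq_three discChain_mem discArc_mem (v := discVertex) rfl bd_discArc bd_discChain
    card_discComplex_cell isAugResolution_discResolution discResolution_dvd

/-- Two points, exchanged by the action. -/
def pointPair : ZpComplex 2 (Fin 2) :=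
  ofTriangles [(0, 0, 0)] (Equiv.swap 0 1) (by decide) (by decide) (by decide)

theorem card_pointPair_cell (σ : pointPair.Cell) : σ.1.card ≠ 2 :=
  forall_cell_ofTriangles (P := fun σ => σ.card ≠ 2) (by decide) (by decide) σ

theorem smithIndex_pointPair : pointPair.smithIndexMod 2 = 1 ∧ pointPair.smithIndex = 1 :=
  smithIndex_eq_one card_pointPair_cell

theorem smithIndex_discComplex_join_pointPair : (discComplex.join pointPair).smithIndex = 4 :=
  smithIndex_join_eq_four card_pointPair_cell discChain_mem discArc_mem (v := discVertex) rfl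
    bd_discArc bd_discChain smithIndex_discComplex.1 smithIndex_discComplex.2

/-- The positively oriented triangles of a disc whose boundary runs once around a circle, and
twice around a triangle on one of its edges. -/
def foldPos : List (Fin 12 × Fin 12 × Fin 12) :=
  [(0, 4, 6), (0, 4, 7), (1, 2, 8), (2, 3, 8), (0, 6, 8), (6, 7, 8)]

/-- The negatively oriented triangles of that disc. -/
def foldNeg : List (Fin 12 × Fin 12 × Fin 12) :=
  [(1, 4, 6), (0, 1, 7), (1, 4, 8), (0, 3, 8), (1, 6, 7), (4, 7, 8)]

/-- The action on the vertices `0, …, 3` of the circle and on the other vertices of the discs. -/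
def foldPerm : Equiv.Perm (Fin 12) :=
  Function.Involutive.toPerm ![2, 3, 0, 1, 5, 4, 9, 10, 11, 6, 7, 8] (show ∀ v, _ by decide)

/-- A circle with the antipodal action, and two such discs. -/
def foldComplex : ZpComplex 2 (Fin 12) :=
  ofTriangles (foldPos ++ foldNeg) foldPerm (by decide +kernel) (by decide +kernel)
    (by decide +kernel)

/-- The oriented disc. -/
def foldChain : foldComplex.AugChain ℤ :=
  foldComplex.chainOf (signed (foldPos.map tri) (foldNeg.map tri))

/-- An arc from a vertex of the circle to its antipode. -/
def foldArc : foldComplex.AugChain ℤ := foldComplex.chainOf (signed [{0, 1}, {1, 2}] [])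

/-- The triangle around which the boundary of the disc runs twice. -/
def foldLoop : foldComplex.AugChain ℤ := foldComplex.chainOf (signed [{0, 4}] [{1, 4}, {0, 1}])

/-- The starting point of `foldArc`. -/
def foldVertex : foldComplex.Cell := ⟨{0}, Or.inr (foldComplex.singleton_mem 0)⟩

theorem foldChain_mem : foldChain ∈ foldComplex.H ℤ 3 := chainOf_signed_mem (by decide +kernel)

theorem foldArc_mem : foldArc ∈ foldComplex.H ℤ 2 := chainOf_signed_mem (by decide +kernel)

theorem foldLoop_mem : foldLoop ∈ foldComplex.H ℤ 2 := chainOf_signed_mem (by decide +kernel)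

theorem bd_foldArc : foldComplex.bd ℤ foldArc =
    foldComplex.T ℤ (foldComplex.gen ℤ foldVertex) - foldComplex.gen ℤ foldVertex := by
  have hv : foldVertex.1.card = 1 := rfl
  refine bd_chainOf_signed_eq (n := 0) (by decide +kernel)
    (sub_mem (T_mem (gen_mem hv)) (gen_mem hv)) (g := fun σ =>
      pull foldPerm (signed [{0}] []) σ - signed [{0}] [] σ) (fun σ => ?_) (by decide +kernel)
  rw [gen_eq_chainOf, T_chainOf]
  rfl

theorem bd_foldChain : foldComplex.bd ℤ foldChain =
    foldComplex.augOp ℤ .s foldArc + (2 : ℤ) • foldLoop := by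
  refine bd_chainOf_signed_eq (n := 1) (by decide +kernel) (add_mem (augOp_mem _ foldArc_mem)
    (Submodule.smul_mem _ _ foldLoop_mem)) (g := fun σ =>
      signed [{0, 1}, {1, 2}] [] σ + pull foldPerm (signed [{0, 1}, {1, 2}] []) σ +
        2 * signed [{0, 4}] [{1, 4}, {0, 1}] σ) (fun σ => ?_) (by decide +kernel)
  rw [augOp_s_two, foldArc, foldLoop, T_chainOf]
  rfl

theorem card_foldComplex_cell (σ : foldComplex.Cell) : σ.1.card ≠ 4 :=
  ne_of_lt (Nat.lt_succ_of_le (card_cell_ofTriangles_le σ))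

theorem smithIndex_foldComplex : foldComplex.smithIndexMod 2 = 3 ∧ foldComplex.smithIndex = 3 :=
  smithIndexMod_eq_three foldChain_mem foldArc_mem (v := foldVertex) rfl bd_foldArc bd_foldChain
    card_foldComplex_cell

/-- A resolution of which twice the values on triangles form a coboundary. -/
def foldResolution : Finset (Fin 12) → ℤ :=
  signed [∅, {2}, {3}, {5}, {9}, {10}, {11}, {1, 2}] [{2, 8}, {3, 8}, {0, 3, 8}]

/-- A cochain with coboundary twice `foldResolution`. -/
def foldCochain (σ : Finset (Fin 12)) : ℤ :=
  signed [{0, 4}, {0, 6}, {7, 8}, {6, 8}] [{4, 7}] σ + 2 * signed [{0, 8}] [] σ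

theorem isAugResolution_foldResolution : IsAugResolution (foldComplex.evalOn foldResolution) :=
  isAugResolution_evalOn (by decide +kernel) (forall_cell_ofTriangles (P := fun σ =>
    cobd foldResolution σ = foldResolution σ - (-1) ^ σ.card * pull foldPerm foldResolution σ)
    (by decide +kernel) (by decide +kernel))

theorem foldCochain_bd {x : foldComplex.AugChain ℤ} (hx : x ∈ foldComplex.H ℤ 3) :
    foldComplex.evalOn foldCochain (foldComplex.bd ℤ x) = 2 * foldComplex.evalOn foldResolution x := by
  have h : ∀ σ : foldComplex.Cell, σ.1.card = 3 → cobd foldCochain σ = 2 * foldResolution σ :=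
    forall_cell_ofTriangles (P := fun σ => σ.card = 3 → cobd foldCochain σ = 2 * foldResolution σ)
    (by decide +kernel) (by decide +kernel)
  rw [evalOn_bd, evalOn_eq (φ' := fun σ => 2 * foldResolution σ) h hx]
  simp [evalOn, Finsupp.linearCombination_apply, Finsupp.sum, Finset.mul_sum, mul_left_comm]

/-- The lower bound is 2 + 3, from the indices modulo 2. The upper bound comes from 2-torsion: twice
the top cochain of `foldResolution` is the coboundary of `foldCochain`. -/
theorem smithIndex_discComplex_join_foldComplex :
    (discComplex.join foldComplex).smithIndex = 5 := by
  have h1 := smithIndexMod_two_add_le_join discComplex foldComplex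
  have h2 := smithIndexMod_le_smithIndex two_pos (discComplex.join foldComplex) 2
  have h3 : (discComplex.join foldComplex).smithIndex ≤ 5 := by
    have h0 : ∀ k, 2 + 1 < k → ∀ x ∈ foldComplex.H ℤ k, foldComplex.evalOn foldResolution x = 0 := by
      intro k hk x hx
      refine eqOn_H (g := 0) (fun σ hσ => ?_) hx
      have h : σ.1.card ≤ 3 := card_cell_ofTriangles_le σ
      omega
    exact smithIndex_le (isSmithClass_join_zero_of_torsion (n := 2) (m := 2) even_two even_two
      (exists_smithClass_reduce_eq_zero isAugResolution_discResolution discResolution_dvd)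
      card_discComplex_cell isAugResolution_foldResolution h0 fun x hx => foldCochain_bd hx)
  have h4 := smithIndex_discComplex.1
  have h5 := smithIndex_foldComplex.1
  omega

end ZpComplex

end

/-! ### The theorem on Smith indices of joins -/

theorem theorem2 :
    -- statements about arbitrary complexes
    (∀ (p : ℕ), p.Prime → ∀ (V : Type*) (W : Type*) [LinearOrder V] [LinearOrder W]
      [Fintype V] [Fintype W] (K : ZpComplex p V) (L : ZpComplex p W),
      -- (1)
      (K.smithIndexMod p + 1 = K.smithIndex → L.smithIndexMod p + 1 = L.smithIndex →
        (K.join L).smithIndex + 1 ≤ K.smithIndex + L.smithIndex) ∧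
      -- (2)
      (p = 2 → K.smithIndexMod p = K.smithIndex → L.smithIndexMod p = L.smithIndex →
        (K.join L).smithIndexMod p = K.smithIndex + L.smithIndex ∧
        (K.join L).smithIndex = K.smithIndex + L.smithIndex) ∧
      -- (3), the two possible values
      (p = 2 → K.smithIndexMod p + 1 = K.smithIndex → L.smithIndexMod p = L.smithIndex →
        (K.join L).smithIndex = K.smithIndex + L.smithIndex ∨
        (K.join L).smithIndex + 1 = K.smithIndex + L.smithIndex) ∧
      -- (4)
      (2 < p → K.smithIndexMod p = K.smithIndex → L.smithIndexMod p = L.smithIndex →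
        (K.HasBoundaryEquivariantDual ∨ L.HasBoundaryEquivariantDual) →
        (K.join L).smithIndexMod p = K.smithIndex + L.smithIndex ∧
        (K.join L).smithIndex = K.smithIndex + L.smithIndex)) ∧
    -- (3), the first value occurs
    (∃ (m n : ℕ) (K : ZpComplex 2 (Fin m)) (L : ZpComplex 2 (Fin n)), 0 < n ∧
      K.smithIndexMod 2 + 1 = K.smithIndex ∧ L.smithIndexMod 2 = L.smithIndex ∧
      (K.join L).smithIndex = K.smithIndex + L.smithIndex) ∧
    -- (3), the second value occurs
    (∃ (m n : ℕ) (K : ZpComplex 2 (Fin m)) (L : ZpComplex 2 (Fin n)), 0 < n ∧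
      K.smithIndexMod 2 + 1 = K.smithIndex ∧ L.smithIndexMod 2 = L.smithIndex ∧
      (K.join L).smithIndex + 1 = K.smithIndex + L.smithIndex) := by
  refine ⟨fun p hp V W _ _ _ _ K L => ?_,
    ⟨10, 2, ZpComplex.discComplex, ZpComplex.pointPair, two_pos, ?_, ?_, ?_⟩,
    ⟨10, 12, ZpComplex.discComplex, ZpComplex.foldComplex, by norm_num, ?_, ?_, ?_⟩⟩
  · have hK := ZpComplex.smithIndexMod_le_smithIndex hp.pos K p
    have hL := ZpComplex.smithIndexMod_le_smithIndex hp.pos L p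
    have hJ := ZpComplex.smithIndexMod_le_smithIndex hp.pos (K.join L) p
    have hle := ZpComplex.smithIndex_join_le hp.pos K L
    refine ⟨fun h1 h2 => ?_, ?_, ?_, fun _ h1 h2 h => ?_⟩
    -- The bound I(K * L) ≤ I_p(K) + I_p(L) + 1 holds for all complexes; the hypotheses only convert
    -- it into I(K) + I(L) - 1.
    · have := ZpComplex.smithIndex_le (ZpComplex.isSmithClass_join_zero hp
        (ZpComplex.isSmithClass_smithIndexMod hp.pos K p)
        (ZpComplex.isSmithClass_smithIndexMod hp.pos L p))
      omega
    · rintro rfl h1 h2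
      have := ZpComplex.smithIndexMod_two_add_le_join K L
      omega
    -- The index lies between I_2(K) + I_2(L) = I(K) + I(L) - 1 and I(K) + I(L).
    · rintro rfl h1 h2
      have := ZpComplex.smithIndexMod_two_add_le_join K L
      omega
    · have : Fact p.Prime := ⟨hp⟩
      rcases h with h | h <;>
        obtain ⟨N, hN, hI, c, hc, hT⟩ := ZpComplex.HasBoundaryEquivariantDual.exists_detects hp.pos h
      · have := hc.add_le_join_right (Or.inl hN) hT L
        omega
      · have := hc.add_le_join_left (Or.inl hN) hT K
        omega
  · rw [ZpComplex.smithIndex_discComplex.1, ZpComplex.smithIndex_discComplex.2]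
  · rw [ZpComplex.smithIndex_pointPair.1, ZpComplex.smithIndex_pointPair.2]
  · rw [ZpComplex.smithIndex_discComplex_join_pointPair, ZpComplex.smithIndex_discComplex.2,
      ZpComplex.smithIndex_pointPair.2]
  · rw [ZpComplex.smithIndex_discComplex.1, ZpComplex.smithIndex_discComplex.2]
  · rw [ZpComplex.smithIndex_foldComplex.1, ZpComplex.smithIndex_foldComplex.2]
  · rw [ZpComplex.smithIndex_discComplex_join_foldComplex, ZpComplex.smithIndex_discComplex.2,
      ZpComplex.smithIndex_foldComplex.2]
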